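/- Conventions. An idempotent semiring is a commutative semiring $(\alpha,\vee,+,-\infty,0)$ whose join $\vee$ is idempotent ($+$ is the semiring product); it and its modules $\mu$ are ordered by $X\le Y\iff X\vee Y=Y$. An order ideal of $\mu$ is a lower set closed under finite joins, including the empty one. An element $S\in\alpha$ is bounded if it lies between two ($+$-)invertible elements. An inclusion $\iota_1\subseteq\iota_2$ of order ideals of an $\alpha$-module $\mu$ is an integral extension if for every $X\in\iota_2$ there are a bounded $S\in\alpha$ and $Y\in\iota_1$ with $X+S\le Y+S$; $\iota$ is integrally closed if it contains every order ideal integral over it; $\mu$ is normal if for every $X\in\mu$ the order ideal $\{Y\le X\}$ is integrally closed. A normalisation of $\mu$ is a homomorphism $\mu\to\nu$ to a normal $\alpha$-module that is initial among homomorphisms from $\mu$ to normal $\alpha$-modules. Let $X^+$ be a quasi-compact quasi-separated scheme, $Z$ a (possibly infinite) collection of effective Cartier divisors on $X^+$, and $j:X\to X^+$ the complement $X=X^+\setminus Z$, that is, the universal morphism to $X^+$ whose image misses every member of $Z$. Let $M$ be a quasi-coherent $\mathcal O_X$-module. A fractional submodule of $M$ is a locally finite type $\mathcal O_{X^+}$-subsheaf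 of $j_*M$; let $\mathbb B(M;\mathcal O_{X^+})$ be the set of them. Under sum and product of submodules, $\mathbb B[\mathcal O_X;\mathcal O_{X^+}]$ is an idempotent semiring and $\mathbb B(M;\mathcal O_{X^+})$ is a module over it. An inclusion $N_1\subseteq N_2$ of fractional submodules is an integral extension (relative to $Z$) if there is a blow-up $f:\widetilde X^+\to X^+$ along a finite type ideal sheaf cosupported set-theoretically in $Z$ such that $f^{-1}N_1=f^{-1}N_2$, where $f^{-1}N$ is the image of $f^*N\to f^*M$. (Here $f$ is an isomorphism over $X$, and $f^*M$ denotes $M$ pushed forward along $X\to\widetilde X^+$.) The integral closure of $N$ is the union of all its integral extensions, and $\mathbb B^\nu(M;\mathcal O_{X^+})$ is the set of all $\mathcal O_{X^+}$-submodules of $j_*M$ that are integral closures of fractional submodules, ordered by inclusion. Proposition. There is a $\mathbb B[\mathcal O_X;\mathcal O_{X^+}]$-module structure on $\mathbb B^\nu(M;\mathcal O_{X^+})$, whose join is the least upper bound for inclusion, such that the integral closure map $$\mathbb B(M;\mathcal O_{X^+})\to\mathbb B^\nu(M;\mathcal O_{X^+})$$ is a homomorphism of $\mathbb B[\mathcal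 O_X;\mathcal O_{X^+}]$-modules and is a normalisation of $\mathbb B(M;\mathcal O_{X^+})$. (As the map is surjective, the module structure is unique.) -/

import Mathlib

open CategoryTheory AlgebraicGeometry TopologicalSpace

universe u w

namespace IntegralClosure

/-! ## Idempotent semirings and their modules

An idempotent semiring is written additively and multiplicatively: the join `∨` is `+`, the
product is `*`, and `-∞`, `0` of the max-plus notation are `0`, `1`.  A module over an idempotent
semiring is automatically an idempotent monoid, and is ordered by `x ≤ y ↔ x + y = y`. -/

section Semiring

/-- The partial order of an idempotent monoid. -/
def JoinLE {μ : Type*} [AddCommMonoid μ] (x y : μ) : Prop := x + y = y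

/-- An order ideal: a lower set closed under finite (possibly empty) joins. -/
structure IsOrderIdeal {μ : Type*} [AddCommMonoid μ] (ι : Set μ) : Prop where
  zero_mem : (0 : μ) ∈ ι
  add_mem : ∀ x ∈ ι, ∀ y ∈ ι, x + y ∈ ι
  lower : ∀ x y, JoinLE x y → y ∈ ι → x ∈ ι

/-- The order ideal generated by one element. -/
def principal {μ : Type*} [AddCommMonoid μ] (x : μ) : Set μ := {y | JoinLE y x}

/-- A bounded element: bounded above and below by invertible elements. -/
def IsBoundedElement {α : Type*} [IdemCommSemiring α] (s : α) : Prop :=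
  ∃ a b : αˣ, (a : α) ≤ s ∧ s ≤ (b : α)

/-- `ι₁ ⊆ ι₂` is an integral extension of order ideals: every `x ∈ ι₂` satisfies
`s • x ∈ s • ι₁` for some bounded `s`, where `s • ι₁` is the order ideal generated by the
translates `s • y`, `y ∈ ι₁`. -/
def IsIntegralExtension (α : Type*) [IdemCommSemiring α] {μ : Type*} [AddCommMonoid μ]
    [Module α μ] (ι₁ ι₂ : Set μ) : Prop :=
  ι₁ ⊆ ι₂ ∧ ∀ x ∈ ι₂, ∃ s : α, IsBoundedElement s ∧ ∃ y ∈ ι₁, JoinLE (s • x) (s • y)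

/-- An order ideal is integrally closed if it contains every order ideal integral over it. -/
def IsIntegrallyClosedIdeal (α : Type*) [IdemCommSemiring α] {μ : Type*} [AddCommMonoid μ]
    [Module α μ] (ι : Set μ) : Prop :=
  ∀ ι' : Set μ, IsOrderIdeal ι' → IsIntegralExtension α ι ι' → ι' ⊆ ι

/-- A module is normal if each of its elements is integrally closed. -/
def IsNormalModule (α : Type*) [IdemCommSemiring α] (μ : Type*) [AddCommMonoid μ]
    [Module α μ] : Prop :=
  ∀ x : μ, IsIntegrallyClosedIdeal α (principal x)

/-- `φ : μ → ν` is a normalisation of the `α`-module `μ`: `ν` is normal, and `φ` is initial among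
homomorphisms from `μ` to normal `α`-modules. -/
structure IsNormalisation {α : Type*} [IdemCommSemiring α] {μ ν : Type*}
    [AddCommMonoid μ] [Module α μ] [AddCommMonoid ν] [Module α ν] (φ : μ →ₗ[α] ν) : Prop where
  normal : IsNormalModule α ν
  lift : ∀ (κ : Type w) [AddCommMonoid κ] [Module α κ], IsNormalModule α κ →
    ∀ ψ : μ →ₗ[α] κ, ∃! χ : ν →ₗ[α] κ, χ ∘ₗ φ = ψ

end Semiring

/-! ## Submodule sheaves -/

section Subsheaf

/-- Restriction of sections of a sheaf of modules. -/
noncomputable def res {Y : Scheme.{u}} {G : Y.Modules} {U V : Y.Opens} (h : V ≤ U) :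
    Γ(G, U) →+ Γ(G, V) :=
  (G.presheaf.map (homOfLE h).op).hom

/-- Restriction of functions. -/
noncomputable def resFun {Y : Scheme.{u}} {U V : Y.Opens} (h : V ≤ U) : Γ(Y, U) →+* Γ(Y, V) :=
  (Y.presheaf.map (homOfLE h).op).hom

theorem res_smul {Y : Scheme.{u}} {G : Y.Modules} {U V : Y.Opens} (h : V ≤ U)
    (r : Γ(Y, U)) (m : Γ(G, U)) : res h (r • m) = resFun h r • res h m :=
  Scheme.Modules.map_smul G (homOfLE h) r m

theorem res_res {Y : Scheme.{u}} {G : Y.Modules} {U V W : Y.Opens} (h : V ≤ U) (k : W ≤ V)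
    (m : Γ(G, U)) : res k (res h m) = res (k.trans h) m := by
  have := G.presheaf.map_comp (homOfLE h).op (homOfLE k).op
  exact (congr($this m)).symm

theorem res_self {Y : Scheme.{u}} {G : Y.Modules} {U : Y.Opens} (h : U ≤ U)
    (m : Γ(G, U)) : res h m = m := by
  have := G.presheaf.map_id (Opposite.op U)
  exact congr($this m)

/-- A subsheaf of `𝒪`-modules of a sheaf of modules `G`. -/
structure Subsheaf {Y : Scheme.{u}} (G : Y.Modules) where
  carrier : ∀ U : Y.Opens, Submodule Γ(Y, U) Γ(G, U)
  res_mem : ∀ {U V : Y.Opens} (h : V ≤ U) {m : Γ(G, U)}, m ∈ carrier U → res h m ∈ carrier V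
  glue : ∀ {U : Y.Opens} (m : Γ(G, U)),
    (∀ x ∈ U, ∃ (V : Y.Opens) (h : V ≤ U), x ∈ V ∧ res h m ∈ carrier V) → m ∈ carrier U

namespace Subsheaf

theorem ext' {Y : Scheme.{u}} {G : Y.Modules} {N P : Subsheaf G} (h : N.carrier = P.carrier) :
    N = P := by
  cases N; cases P; cases h; rfl

/-- Subsheaves are ordered by inclusion. -/
noncomputable instance {Y : Scheme.{u}} {G : Y.Modules} : PartialOrder (Subsheaf G) :=
  PartialOrder.lift carrier fun _ _ h => ext' h

theorem le_def {Y : Scheme.{u}} {G : Y.Modules} {N P : Subsheaf G} :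
    N ≤ P ↔ ∀ U, N.carrier U ≤ P.carrier U := Iff.rfl

/-- The submodule of `Γ(G, V)` spanned by the restrictions to `V` of given sections over larger
open sets. -/
noncomputable def preSpan {Y : Scheme.{u}} {G : Y.Modules} (B : ∀ U : Y.Opens, Set Γ(G, U)) (V : Y.Opens) :
    Submodule Γ(Y, V) Γ(G, V) :=
  Submodule.span _ {n | ∃ (W : Y.Opens) (k : V ≤ W), ∃ b ∈ B W, n = res k b}

theorem preSpan_res {Y : Scheme.{u}} {G : Y.Modules} (B : ∀ U : Y.Opens, Set Γ(G, U))
    {U V : Y.Opens} (h : V ≤ U) {m : Γ(G, U)} (hm : m ∈ preSpan B U) :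
    res h m ∈ preSpan B V := by
  unfold preSpan at hm
  induction hm using Submodule.span_induction with
  | mem x hx =>
    obtain ⟨W, k, b, hb, rfl⟩ := hx
    rw [res_res]
    exact Submodule.subset_span ⟨W, _, b, hb, rfl⟩
  | zero => rw [map_zero]; exact zero_mem _
  | add x y _ _ hx hy => rw [map_add]; exact add_mem hx hy
  | smul a x _ hx => rw [res_smul]; exact Submodule.smul_mem _ _ hx

/-- The subsheaf of `𝒪`-modules generated by given sections: its sections are those which locally
are linear combinations of restrictions of the given ones. -/
noncomputable def span {Y : Scheme.{u}} {G : Y.Modules} (B : ∀ U : Y.Opens, Set Γ(G, U)) : Subsheaf G where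
  carrier U :=
    { carrier := {m | ∀ x ∈ U, ∃ (V : Y.Opens) (h : V ≤ U), x ∈ V ∧ res h m ∈ preSpan B V}
      zero_mem' := fun x hx => ⟨U, le_rfl, hx, by rw [map_zero]; exact zero_mem _⟩
      add_mem' := by
        intro a b ha hb x hx
        obtain ⟨V, h, hxV, hV⟩ := ha x hx
        obtain ⟨W, k, hxW, hW⟩ := hb x hx
        refine ⟨V ⊓ W, inf_le_left.trans h, ⟨hxV, hxW⟩, ?_⟩
        rw [map_add]
        refine add_mem ?_ ?_
        · rw [← res_res h inf_le_left]; exact preSpan_res B _ hV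
        · rw [← res_res k inf_le_right]; exact preSpan_res B _ hW
      smul_mem' := by
        intro r a ha x hx
        obtain ⟨V, h, hxV, hV⟩ := ha x hx
        exact ⟨V, h, hxV, by rw [res_smul]; exact Submodule.smul_mem _ _ hV⟩ }
  res_mem := by
    intro U V h m hm x hx
    obtain ⟨W, k, hxW, hW⟩ := hm x (h hx)
    refine ⟨W ⊓ V, inf_le_right, ⟨hxW, hx⟩, ?_⟩
    rw [res_res, ← res_res k inf_le_left]
    exact preSpan_res B _ hW
  glue := by
    intro U m hm x hx
    obtain ⟨V, h, hxV, hV⟩ := hm x hx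
    obtain ⟨W, k, hxW, hW⟩ := hV x hxV
    exact ⟨W, k.trans h, hxW, by rw [← res_res h k]; exact hW⟩

theorem subset_span {Y : Scheme.{u}} {G : Y.Modules} {B : ∀ U : Y.Opens, Set Γ(G, U)}
    {U : Y.Opens} {m : Γ(G, U)} (hm : m ∈ B U) : m ∈ (span B).carrier U :=
  fun _ hx => ⟨U, le_rfl, hx, Submodule.subset_span ⟨U, le_rfl, m, hm, rfl⟩⟩

theorem mem_of_mem_span {Y : Scheme.{u}} {G : Y.Modules} {B : ∀ U : Y.Opens, Set Γ(G, U)}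
    (P : Subsheaf G) {U : Y.Opens}
    (hP : ∀ (V W : Y.Opens) (_ : V ≤ U) (k : V ≤ W), ∀ b ∈ B W, res k b ∈ P.carrier V)
    {m : Γ(G, U)} (hm : m ∈ (span B).carrier U) : m ∈ P.carrier U := by
  refine P.glue m fun x hx => ?_
  obtain ⟨V, h, hxV, hV⟩ := hm x hx
  refine ⟨V, h, hxV, ?_⟩
  refine (Submodule.span_le.2 ?_ : preSpan B V ≤ P.carrier V) hV
  rintro _ ⟨W, k, b, hb, rfl⟩
  exact hP V W h k b hb

theorem span_le {Y : Scheme.{u}} {G : Y.Modules} {B : ∀ U : Y.Opens, Set Γ(G, U)}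
    {P : Subsheaf G} : span B ≤ P ↔ ∀ U, ∀ b ∈ B U, b ∈ P.carrier U :=
  ⟨fun h U _ hb => h U (subset_span hb), fun h _ _ hm =>
    mem_of_mem_span P (fun _ W _ k b hb => P.res_mem k (h W b hb)) hm⟩

/-- The family of all restrictions of a set of sections over one open set. -/
def fromOpen {Y : Scheme.{u}} {G : Y.Modules} (U : Y.Opens) (F : Set Γ(G, U)) (V : Y.Opens) :
    Set Γ(G, V) :=
  {m | ∃ h : V ≤ U, ∃ b ∈ F, m = res h b}

/-- Locally finite type: every point has an open neighbourhood on which the subsheaf is generated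
by finitely many of its sections. -/
def IsFiniteType {Y : Scheme.{u}} {G : Y.Modules} (N : Subsheaf G) : Prop :=
  ∀ x : Y, ∃ U : Y.Opens, x ∈ U ∧ ∃ F : Set Γ(G, U), F.Finite ∧ (∀ b ∈ F, b ∈ N.carrier U) ∧
    ∀ V ≤ U, N.carrier V ≤ (span (fromOpen U F)).carrier V

/-- The supremum of a set of subsheaves, that is, the subsheaf generated by their union. -/
noncomputable def sup {Y : Scheme.{u}} {G : Y.Modules} (S : Set (Subsheaf G)) : Subsheaf G :=
  span fun U => {m | ∃ N ∈ S, m ∈ N.carrier U}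

/-- The sum of two subsheaves. -/
noncomputable instance {Y : Scheme.{u}} {G : Y.Modules} : Add (Subsheaf G) :=
  ⟨fun N P => span fun U => {m | m ∈ N.carrier U ∨ m ∈ P.carrier U}⟩

/-- The zero subsheaf. -/
noncomputable instance {Y : Scheme.{u}} {G : Y.Modules} : Zero (Subsheaf G) := ⟨span fun _ => ∅⟩

theorem add_le {Y : Scheme.{u}} {G : Y.Modules} {N P Q : Subsheaf G} :
    N + P ≤ Q ↔ N ≤ Q ∧ P ≤ Q :=
  span_le.trans ⟨fun h => ⟨fun U b hb => h U b (Or.inl hb), fun U b hb => h U b (Or.inr hb)⟩,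
    fun h U _ hb => hb.elim (fun hb => h.1 U hb) fun hb => h.2 U hb⟩

theorem zero_le' {Y : Scheme.{u}} {G : Y.Modules} (N : Subsheaf G) : 0 ≤ N :=
  span_le.2 fun _ _ hb => hb.elim

theorem le_add_left' {Y : Scheme.{u}} {G : Y.Modules} (N P : Subsheaf G) : N ≤ N + P :=
  (add_le.1 le_rfl).1

theorem le_add_right' {Y : Scheme.{u}} {G : Y.Modules} (N P : Subsheaf G) : P ≤ N + P :=
  (add_le.1 le_rfl).2

theorem IsFiniteType.add {Y : Scheme.{u}} {G : Y.Modules} {N P : Subsheaf G}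
    (hN : N.IsFiniteType) (hP : P.IsFiniteType) : (N + P).IsFiniteType := by
  intro x
  obtain ⟨U, hxU, F, hF, hFN, hNF⟩ := hN x
  obtain ⟨V, hxV, E, hE, hEP, hPE⟩ := hP x
  refine ⟨U ⊓ V, ⟨hxU, hxV⟩, res inf_le_left '' F ∪ res inf_le_right '' E,
    (hF.image _).union (hE.image _), ?_, ?_⟩
  · rintro _ (⟨b, hb, rfl⟩ | ⟨b, hb, rfl⟩)
    · exact le_add_left' N P _ (N.res_mem _ (hFN b hb))
    · exact le_add_right' N P _ (P.res_mem _ (hEP b hb))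
  · intro W hW m hm
    refine mem_of_mem_span _ ?_ hm
    rintro W' W'' h k b (hb | hb)
    · refine mem_of_mem_span _ ?_ (hNF W' ((h.trans hW).trans inf_le_left) (N.res_mem k hb))
      rintro A A' hA hA' _ ⟨hA'', b, hb, rfl⟩
      rw [res_res, ← res_res inf_le_left ((hA.trans h).trans hW)]
      exact (span _).res_mem ((hA.trans h).trans hW)
        (subset_span ⟨le_rfl, _, Or.inl ⟨b, hb, rfl⟩, (res_self _ _).symm⟩)
    · refine mem_of_mem_span _ ?_ (hPE W' ((h.trans hW).trans inf_le_right) (P.res_mem k hb))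
      rintro A A' hA hA' _ ⟨hA'', b, hb, rfl⟩
      rw [res_res, ← res_res inf_le_right ((hA.trans h).trans hW)]
      exact (span _).res_mem ((hA.trans h).trans hW)
        (subset_span ⟨le_rfl, _, Or.inr ⟨b, hb, rfl⟩, (res_self _ _).symm⟩)

theorem IsFiniteType.zero {Y : Scheme.{u}} {G : Y.Modules} :
    (0 : Subsheaf G).IsFiniteType := fun _ =>
  ⟨⊤, trivial, ∅, Set.finite_empty, fun _ hb => hb.elim, fun V _ => zero_le' _ V⟩

end Subsheaf

end Subsheaf

/-! ## Fractional submodules -/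

section Fractional

/-- The structure sheaf as a sheaf of modules over itself. -/
noncomputable abbrev strSheaf (X : Scheme.{u}) : X.Modules := SheafOfModules.unit X.ringCatSheaf

/-- The pushforward `j_* M`, whose sections over `U` are those of `M` over `j⁻¹ U`. -/
noncomputable abbrev push {X Y : Scheme.{u}} (j : X ⟶ Y) (M : X.Modules) : Y.Modules :=
  (Scheme.Modules.pushforward j).obj M

/-- The action `j_* 𝒪_X × j_* M → j_* M` on sections over `U`. -/
noncomputable def act {X Y : Scheme.{u}} (j : X ⟶ Y) (M : X.Modules) {U : Y.Opens} :
    Γ(push j (strSheaf X), U) →ₗ[Γ(Y, U)] Γ(push j M, U) →ₗ[Γ(Y, U)] Γ(push j M, U) :=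
  LinearMap.mk₂ _
    (fun s m => HSMul.hSMul (α := Γ(X, j ⁻¹ᵁ U)) (β := Γ(M, j ⁻¹ᵁ U)) s m)
    (fun s t m => add_smul (R := Γ(X, j ⁻¹ᵁ U)) (M := Γ(M, j ⁻¹ᵁ U)) s t m)
    (fun r s m => mul_smul (α := Γ(X, j ⁻¹ᵁ U)) (β := Γ(M, j ⁻¹ᵁ U)) (j.app U r) s m)
    (fun s m n => smul_add (M := Γ(X, j ⁻¹ᵁ U)) (A := Γ(M, j ⁻¹ᵁ U)) s m n)
    (fun r s m => smul_comm (M := Γ(X, j ⁻¹ᵁ U)) (N := Γ(X, j ⁻¹ᵁ U))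
      (α := Γ(M, j ⁻¹ᵁ U)) s (j.app U r) m)

/-- The section `1` of `j_* 𝒪_X`. -/
noncomputable def oneSec {X Y : Scheme.{u}} (j : X ⟶ Y) (U : Y.Opens) :
    Γ(push j (strSheaf X), U) :=
  (1 : Γ(X, j ⁻¹ᵁ U))

theorem res_act {X Y : Scheme.{u}} (j : X ⟶ Y) (M : X.Modules) {U V : Y.Opens} (h : V ≤ U)
    (s : Γ(push j (strSheaf X), U)) (m : Γ(push j M, U)) :
    res h (act j M s m) = act j M (res h s) (res h m) :=
  Scheme.Modules.map_smul M ((Opens.map j.base).map (homOfLE h)) s m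

theorem act_assoc {X Y : Scheme.{u}} (j : X ⟶ Y) (M : X.Modules) {U : Y.Opens}
    (s t : Γ(push j (strSheaf X), U)) (m : Γ(push j M, U)) :
    act j M (act j (strSheaf X) s t) m = act j M s (act j M t m) :=
  mul_smul (α := Γ(X, j ⁻¹ᵁ U)) (β := Γ(M, j ⁻¹ᵁ U)) s t m

theorem act_comm {X Y : Scheme.{u}} (j : X ⟶ Y) {U : Y.Opens}
    (s t : Γ(push j (strSheaf X), U)) :
    act j (strSheaf X) s t = act j (strSheaf X) t s :=
  mul_comm (G := Γ(X, j ⁻¹ᵁ U)) s t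

theorem oneSec_act {X Y : Scheme.{u}} (j : X ⟶ Y) (M : X.Modules) {U : Y.Opens}
    (m : Γ(push j M, U)) : act j M (oneSec j U) m = m :=
  one_smul Γ(X, j ⁻¹ᵁ U) (α := Γ(M, j ⁻¹ᵁ U)) m

theorem res_oneSec {X Y : Scheme.{u}} (j : X ⟶ Y) {U V : Y.Opens} (h : V ≤ U) :
    res h (oneSec j U) = oneSec j V :=
  map_one (X.presheaf.map ((Opens.map j.base).map (homOfLE h)).op).hom

/-- The product `S · N` of subsheaves `S ⊆ j_* 𝒪_X` and `N ⊆ j_* M`, generated by the products of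
sections. -/
noncomputable def prod {X Y : Scheme.{u}} {j : X ⟶ Y} {M : X.Modules}
    (S : Subsheaf (push j (strSheaf X))) (N : Subsheaf (push j M)) : Subsheaf (push j M) :=
  Subsheaf.span fun U => {m | ∃ s ∈ S.carrier U, ∃ n ∈ N.carrier U, m = act j M s n}

/-- The image of `𝒪_Y` in `j_* 𝒪_X`. -/
noncomputable def unitSubsheaf {X Y : Scheme.{u}} (j : X ⟶ Y) : Subsheaf (push j (strSheaf X)) :=
  Subsheaf.span fun U => {oneSec j U}

theorem prod_le {X Y : Scheme.{u}} {j : X ⟶ Y} {M : X.Modules}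
    {S : Subsheaf (push j (strSheaf X))} {N P : Subsheaf (push j M)} :
    prod S N ≤ P ↔ ∀ U, ∀ s ∈ S.carrier U, ∀ n ∈ N.carrier U, act j M s n ∈ P.carrier U :=
  Subsheaf.span_le.trans ⟨fun h U s hs n hn => h U _ ⟨s, hs, n, hn, rfl⟩,
    fun h U _ ⟨s, hs, n, hn, e⟩ => e ▸ h U s hs n hn⟩

theorem act_mem_prod {X Y : Scheme.{u}} {j : X ⟶ Y} {M : X.Modules}
    {S : Subsheaf (push j (strSheaf X))} {N : Subsheaf (push j M)} {U : Y.Opens}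
    {s : Γ(push j (strSheaf X), U)} {n : Γ(push j M, U)} (hs : s ∈ S.carrier U)
    (hn : n ∈ N.carrier U) : act j M s n ∈ (prod S N).carrier U :=
  prod_le.1 le_rfl U s hs n hn

/-- Products of sections of generated subsheaves can be tested on generators. -/
theorem act_mem_of_span {X Y : Scheme.{u}} {j : X ⟶ Y} {M : X.Modules}
    {B : ∀ U : Y.Opens, Set Γ(push j (strSheaf X), U)} {C : ∀ U : Y.Opens, Set Γ(push j M, U)}
    (P : Subsheaf (push j M)) {U : Y.Opens}
    (hP : ∀ (V W W' : Y.Opens) (_ : V ≤ U) (k : V ≤ W) (k' : V ≤ W'), ∀ b ∈ B W, ∀ c ∈ C W',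
      act j M (res k b) (res k' c) ∈ P.carrier V)
    {s : Γ(push j (strSheaf X), U)} {n : Γ(push j M, U)}
    (hs : s ∈ (Subsheaf.span B).carrier U) (hn : n ∈ (Subsheaf.span C).carrier U) :
    act j M s n ∈ P.carrier U := by
  refine P.glue _ fun x hx => ?_
  obtain ⟨V, h, hxV, hV⟩ := hs x hx
  obtain ⟨W, k, hxW, hW⟩ := hn x hx
  have h1 : res (inf_le_left.trans h : V ⊓ W ≤ U) s ∈ Subsheaf.preSpan B (V ⊓ W) := by
    rw [← res_res h inf_le_left]; exact Subsheaf.preSpan_res B _ hV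
  have h2 : res (inf_le_left.trans h : V ⊓ W ≤ U) n ∈ Subsheaf.preSpan C (V ⊓ W) := by
    rw [show res (inf_le_left.trans h : V ⊓ W ≤ U) n = res inf_le_right (res k n) from
      (res_res k inf_le_right n).symm]
    exact Subsheaf.preSpan_res C _ hW
  refine ⟨V ⊓ W, inf_le_left.trans h, ⟨hxV, hxW⟩, ?_⟩
  rw [res_act]
  have key : ∀ c ∈ Subsheaf.preSpan C (V ⊓ W), ∀ b ∈ Subsheaf.preSpan B (V ⊓ W),
      act j M b c ∈ P.carrier (V ⊓ W) := by
    intro c hc b hb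
    refine (Submodule.span_le (p := (P.carrier (V ⊓ W)).comap ((act j M).flip c))).2 ?_ hb
    rintro _ ⟨A, l, b, hb, rfl⟩
    refine (Submodule.span_le (p := (P.carrier (V ⊓ W)).comap (act j M (res l b)))).2 ?_ hc
    rintro _ ⟨A', l', c, hc, rfl⟩
    exact hP _ _ _ (inf_le_left.trans h) l l' b hb c hc
  exact key _ h2 _ h1

theorem span_self {Y : Scheme.{u}} {G : Y.Modules} (N : Subsheaf G) :
    Subsheaf.span (fun U => {m | m ∈ N.carrier U}) = N :=
  le_antisymm (Subsheaf.span_le.2 fun _ _ h => h) fun _ _ h => Subsheaf.subset_span h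

theorem prod_assoc {X Y : Scheme.{u}} {j : X ⟶ Y} {M : X.Modules}
    (S T : Subsheaf (push j (strSheaf X))) (N : Subsheaf (push j M)) :
    prod (prod S T) N = prod S (prod T N) := by
  apply le_antisymm
  · refine prod_le.2 fun U a ha n hn => ?_
    rw [← span_self N] at hn
    refine act_mem_of_span _ ?_ ha hn
    rintro V W W' _ k k' _ ⟨s, hs, t, ht, rfl⟩ c hc
    rw [res_act, act_assoc]
    exact act_mem_prod (S.res_mem k hs) (act_mem_prod (T.res_mem k ht) (N.res_mem k' hc))
  · refine prod_le.2 fun U a ha n hn => ?_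
    rw [← span_self S] at ha
    refine act_mem_of_span _ ?_ ha hn
    rintro V W W' _ k k' b hb _ ⟨t, ht, n, hn, rfl⟩
    rw [res_act, ← act_assoc]
    exact act_mem_prod (act_mem_prod (S.res_mem k hb) (T.res_mem k' ht)) (N.res_mem k' hn)

theorem prod_comm {X Y : Scheme.{u}} {j : X ⟶ Y} (S T : Subsheaf (push j (strSheaf X))) :
    prod S T = prod T S := by
  have : ∀ S T : Subsheaf (push j (strSheaf X)), prod S T ≤ prod T S := fun S T =>
    prod_le.2 fun U s hs t ht => by rw [act_comm]; exact act_mem_prod ht hs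
  exact le_antisymm (this S T) (this T S)

theorem prod_mono {X Y : Scheme.{u}} {j : X ⟶ Y} {M : X.Modules}
    {S S' : Subsheaf (push j (strSheaf X))} {N N' : Subsheaf (push j M)} (h : S ≤ S')
    (k : N ≤ N') : prod S N ≤ prod S' N' :=
  prod_le.2 fun U _ hs _ hn => act_mem_prod (h U hs) (k U hn)

theorem prod_add {X Y : Scheme.{u}} {j : X ⟶ Y} {M : X.Modules}
    (S : Subsheaf (push j (strSheaf X))) (N P : Subsheaf (push j M)) :
    prod S (N + P) = prod S N + prod S P := by
  apply le_antisymm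
  · refine prod_le.2 fun U s hs n hn => ?_
    rw [← span_self S] at hs
    refine act_mem_of_span _ ?_ hs hn
    rintro V W W' _ k k' b hb c (hc | hc)
    · exact Subsheaf.le_add_left' _ _ _ (act_mem_prod (S.res_mem k hb) (N.res_mem k' hc))
    · exact Subsheaf.le_add_right' _ _ _ (act_mem_prod (S.res_mem k hb) (P.res_mem k' hc))
  · exact Subsheaf.add_le.2 ⟨prod_mono le_rfl (Subsheaf.le_add_left' N P),
      prod_mono le_rfl (Subsheaf.le_add_right' N P)⟩

theorem add_prod {X Y : Scheme.{u}} {j : X ⟶ Y} {M : X.Modules}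
    (S T : Subsheaf (push j (strSheaf X))) (N : Subsheaf (push j M)) :
    prod (S + T) N = prod S N + prod T N := by
  apply le_antisymm
  · refine prod_le.2 fun U s hs n hn => ?_
    rw [← span_self N] at hn
    refine act_mem_of_span _ ?_ hs hn
    rintro V W W' _ k k' b (hb | hb) c hc
    · exact Subsheaf.le_add_left' _ _ _ (act_mem_prod (S.res_mem k hb) (N.res_mem k' hc))
    · exact Subsheaf.le_add_right' _ _ _ (act_mem_prod (T.res_mem k hb) (N.res_mem k' hc))
  · exact Subsheaf.add_le.2 ⟨prod_mono (Subsheaf.le_add_left' S T) le_rfl,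
      prod_mono (Subsheaf.le_add_right' S T) le_rfl⟩

theorem prod_zero {X Y : Scheme.{u}} {j : X ⟶ Y} {M : X.Modules}
    (S : Subsheaf (push j (strSheaf X))) : prod S (0 : Subsheaf (push j M)) = 0 := by
  refine le_antisymm (prod_le.2 fun U s hs n hn => ?_) (Subsheaf.zero_le' _)
  rw [← span_self S] at hs
  exact act_mem_of_span _ (fun _ _ _ _ _ _ _ _ _ hc => hc.elim) hs hn

theorem zero_prod {X Y : Scheme.{u}} {j : X ⟶ Y} {M : X.Modules}
    (N : Subsheaf (push j M)) : prod (0 : Subsheaf (push j (strSheaf X))) N = 0 := by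
  refine le_antisymm (prod_le.2 fun U s hs n hn => ?_) (Subsheaf.zero_le' _)
  rw [← span_self N] at hn
  exact act_mem_of_span _ (fun _ _ _ _ _ _ _ hb => hb.elim) hs hn

theorem one_prod {X Y : Scheme.{u}} {j : X ⟶ Y} {M : X.Modules}
    (N : Subsheaf (push j M)) : prod (unitSubsheaf j) N = N := by
  apply le_antisymm
  · refine prod_le.2 fun U s hs n hn => ?_
    rw [← span_self N] at hn
    refine act_mem_of_span _ ?_ hs hn
    rintro V W W' _ k k' _ rfl c hc
    rw [res_oneSec, oneSec_act]
    exact N.res_mem k' hc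
  · intro U n hn
    rw [← oneSec_act j M n]
    exact act_mem_prod (Subsheaf.subset_span rfl) hn

theorem isFiniteType_prod {X Y : Scheme.{u}} {j : X ⟶ Y} {M : X.Modules}
    {S : Subsheaf (push j (strSheaf X))} {N : Subsheaf (push j M)}
    (hS : S.IsFiniteType) (hN : N.IsFiniteType) : (prod S N).IsFiniteType := by
  intro x
  obtain ⟨U, hxU, F, hF, hFS, hSF⟩ := hS x
  obtain ⟨V, hxV, E, hE, hEN, hNE⟩ := hN x
  refine ⟨U ⊓ V, ⟨hxU, hxV⟩,
    Set.image2 (fun s n => act j M (res inf_le_left s) (res inf_le_right n)) F E,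
    hF.image2 _ hE, ?_, ?_⟩
  · rintro _ ⟨s, hs, n, hn, rfl⟩
    exact act_mem_prod (S.res_mem _ (hFS s hs)) (N.res_mem _ (hEN n hn))
  · intro W hW m hm
    refine Subsheaf.mem_of_mem_span _ ?_ hm
    rintro W' W'' h k _ ⟨s, hs, n, hn, rfl⟩
    rw [res_act]
    refine act_mem_of_span _ ?_
      (hSF W' ((h.trans hW).trans inf_le_left) (S.res_mem k hs))
      (hNE W' ((h.trans hW).trans inf_le_right) (N.res_mem k hn))
    rintro A A₁ A₂ hA k₁ k₂ _ ⟨h₁, b, hb, rfl⟩ _ ⟨h₂, c, hc, rfl⟩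
    have hAUV : A ≤ U ⊓ V := (hA.trans h).trans hW
    rw [res_res, res_res, ← res_res inf_le_left hAUV b, ← res_res inf_le_right hAUV c,
      ← res_act]
    exact (Subsheaf.span _).res_mem hAUV
      (Subsheaf.subset_span ⟨le_rfl, _, ⟨b, hb, c, hc, rfl⟩, (res_self _ _).symm⟩)

theorem isFiniteType_unit {X Y : Scheme.{u}} (j : X ⟶ Y) : (unitSubsheaf j).IsFiniteType := by
  refine fun _ => ⟨⊤, trivial, {oneSec j ⊤}, Set.finite_singleton _, ?_, fun V _ => ?_⟩
  · rintro _ rfl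
    exact Subsheaf.subset_span rfl
  · refine (Subsheaf.span_le.2 ?_ : unitSubsheaf j ≤ _) V
    rintro U _ rfl
    exact Subsheaf.subset_span ⟨le_top, _, rfl, (res_oneSec j le_top).symm⟩

/-- The fractional submodules of `M`: the locally finite type `𝒪_Y`-subsheaves of `j_* M`. -/
def Frac {X Y : Scheme.{u}} (j : X ⟶ Y) (M : X.Modules) : Type u :=
  {N : Subsheaf (push j M) // N.IsFiniteType}

/-- Fractional submodules are ordered by inclusion. -/
instance {X Y : Scheme.{u}} (j : X ⟶ Y) (M : X.Modules) : PartialOrder (Frac j M) :=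
  inferInstanceAs (PartialOrder {N : Subsheaf (push j M) // N.IsFiniteType})

/-- The sum of fractional submodules. -/
noncomputable instance {X Y : Scheme.{u}} (j : X ⟶ Y) (M : X.Modules) : Add (Frac j M) :=
  ⟨fun N P => ⟨N.1 + P.1, N.2.add P.2⟩⟩

/-- The zero submodule. -/
noncomputable instance {X Y : Scheme.{u}} (j : X ⟶ Y) (M : X.Modules) : Zero (Frac j M) :=
  ⟨⟨0, Subsheaf.IsFiniteType.zero⟩⟩

/-- Fractional submodules form a monoid under the sum of submodules. -/
noncomputable instance {X Y : Scheme.{u}} (j : X ⟶ Y) (M : X.Modules) :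
    AddCommMonoid (Frac j M) where
  nsmul := nsmulRec
  add_assoc N P Q := Subtype.ext <| by
    change N.1 + P.1 + Q.1 = N.1 + (P.1 + Q.1)
    refine eq_of_forall_ge_iff fun R => ?_
    simp only [Subsheaf.add_le, and_assoc]
  zero_add N := Subtype.ext <| by
    change 0 + N.1 = N.1
    refine eq_of_forall_ge_iff fun R => ?_
    simp only [Subsheaf.add_le, Subsheaf.zero_le', true_and]
  add_zero N := Subtype.ext <| by
    change N.1 + 0 = N.1
    refine eq_of_forall_ge_iff fun R => ?_
    simp only [Subsheaf.add_le, Subsheaf.zero_le', and_true]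
  add_comm N P := Subtype.ext <| by
    change N.1 + P.1 = P.1 + N.1
    refine eq_of_forall_ge_iff fun R => ?_
    simp only [Subsheaf.add_le, and_comm]

/-- Fractional ideals, that is, fractional submodules of `𝒪_X`, form an idempotent semiring under
sum (as the join) and product of submodules. -/
noncomputable instance {X Y : Scheme.{u}} (j : X ⟶ Y) :
    IdemCommSemiring (Frac j (strSheaf X)) where
  __ := (inferInstance : AddCommMonoid (Frac j (strSheaf X)))
  __ := (inferInstance : PartialOrder (Frac j (strSheaf X)))
  mul S T := ⟨prod S.1 T.1, isFiniteType_prod S.2 T.2⟩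
  one := ⟨unitSubsheaf j, isFiniteType_unit j⟩
  mul_assoc S T R := Subtype.ext (prod_assoc S.1 T.1 R.1)
  mul_comm S T := Subtype.ext (prod_comm S.1 T.1)
  one_mul S := Subtype.ext (one_prod S.1)
  mul_one S := Subtype.ext ((prod_comm _ _).trans (one_prod S.1))
  left_distrib S T R := Subtype.ext (prod_add S.1 T.1 R.1)
  right_distrib S T R := Subtype.ext (add_prod S.1 T.1 R.1)
  zero_mul S := Subtype.ext (zero_prod S.1)
  mul_zero S := Subtype.ext (prod_zero S.1)
  sup S T := S + T
  le_sup_left S T := Subsheaf.le_add_left' S.1 T.1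
  le_sup_right S T := Subsheaf.le_add_right' S.1 T.1
  sup_le _ _ _ h k := Subsheaf.add_le.2 ⟨h, k⟩
  add_eq_sup _ _ := rfl
  bot := 0
  bot_le S := Subsheaf.zero_le' S.1

/-- Fractional ideals act on fractional submodules by multiplication. -/
noncomputable instance {X Y : Scheme.{u}} (j : X ⟶ Y) (M : X.Modules) :
    Module (Frac j (strSheaf X)) (Frac j M) where
  smul S N := ⟨prod S.1 N.1, isFiniteType_prod S.2 N.2⟩
  one_smul N := Subtype.ext (one_prod N.1)
  mul_smul S T N := Subtype.ext (prod_assoc S.1 T.1 N.1)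
  smul_add S N P := Subtype.ext (prod_add S.1 N.1 P.1)
  smul_zero S := Subtype.ext (prod_zero S.1)
  add_smul S T N := Subtype.ext (add_prod S.1 T.1 N.1)
  zero_smul N := Subtype.ext (zero_prod N.1)

end Fractional

/-! ## Modifications and integral closure -/

section Modification

/-- An ideal sheaf is the ideal of an effective Cartier divisor if it is locally generated by one
non-zero-divisor. -/
def IsEffectiveCartier {Y : Scheme.{u}} (I : Y.IdealSheafData) : Prop :=
  ∀ y : Y, ∃ U : Y.affineOpens, y ∈ U.1 ∧ ∃ t ∈ nonZeroDivisors Γ(Y, U), I.ideal U = Ideal.span {t}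

/-- `j : X ⟶ Y` exhibits `X` as the complement in `Y` of the supports of the members of `Z`: it is
universal among morphisms whose image misses these supports.  For finite `Z` this is the open
complement, in general the limit of the complements of finite subcollections. -/
structure IsComplement {X Y : Scheme.{u}} (Z : Set Y.IdealSheafData) (j : X ⟶ Y) : Prop where
  notMem : ∀ x : X, ∀ D ∈ Z, j x ∉ D.support
  lift : ∀ (W : Scheme.{u}) (g : W ⟶ Y), (∀ w : W, ∀ D ∈ Z, g w ∉ D.support) →
    ∃! h : W ⟶ X, h ≫ j = g

/-- `f : Y' ⟶ Y` is the blow-up of `Y` along the ideal sheaf `T`: it is universal among morphisms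
under which the inverse image ideal of `T` becomes invertible. -/
structure IsBlowUp {Y Y' : Scheme.{u}} (T : Y.IdealSheafData) (f : Y' ⟶ Y) : Prop where
  cartier : IsEffectiveCartier (T.comap f)
  lift : ∀ (W : Scheme.{u}) (g : W ⟶ Y), IsEffectiveCartier (T.comap g) →
    ∃! h : W ⟶ Y', h ≫ f = g

/-- The inverse image `f⁻¹ N` of `N ⊆ j_* M` under `f : Y' ⟶ Y`, when `j` lifts to `j' : X ⟶ Y'`:
the `𝒪_{Y'}`-subsheaf of `j'_* M` generated by the sections of `N`, in other words the image of
`f^* N → j'_* M`. -/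
noncomputable def inverseImage {X Y Y' : Scheme.{u}} {j : X ⟶ Y} {M : X.Modules} (f : Y' ⟶ Y)
    (j' : X ⟶ Y') (hj : j' ≫ f = j) (N : Subsheaf (push j M)) : Subsheaf (push j' M) :=
  Subsheaf.span fun V => {m | ∃ (U : Y.Opens) (h : V ≤ f ⁻¹ᵁ U), ∃ n ∈ N.carrier U,
    m = res (G := M) (U := j ⁻¹ᵁ U) (V := j' ⁻¹ᵁ V)
      (by subst hj; exact fun _ hx => h hx) n}

/-- `N₁ ⊆ N₂` is an integral extension relative to `Z`: there is a blow-up `f : Y' ⟶ Y` along a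
finite type ideal sheaf cosupported set-theoretically in `Z` such that `f⁻¹ N₁ = f⁻¹ N₂`.  Such an
`f` is an isomorphism over `X`, so that `X` lifts uniquely to `Y'`, and the pullback of `M` is `M`
itself, viewed on `Y'`. -/
def IsIntegralExt {X Y : Scheme.{u}} (Z : Set Y.IdealSheafData) {j : X ⟶ Y} {M : X.Modules}
    (N₁ N₂ : Frac j M) : Prop :=
  N₁ ≤ N₂ ∧ ∃ T : Y.IdealSheafData, (∀ U : Y.affineOpens, (T.ideal U).FG) ∧
    (∀ y ∈ T.support, ∃ D ∈ Z, y ∈ D.support) ∧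
    ∃ (Y' : Scheme.{u}) (f : Y' ⟶ Y) (j' : X ⟶ Y') (hj : j' ≫ f = j), IsBlowUp T f ∧
      inverseImage f j' hj N₁.1 = inverseImage f j' hj N₂.1

/-- The integral closure of `N` in `M`: the union of all integral extensions of `N`. -/
noncomputable def closure {X Y : Scheme.{u}} (Z : Set Y.IdealSheafData) {j : X ⟶ Y} {M : X.Modules}
    (N : Frac j M) : Subsheaf (push j M) :=
  Subsheaf.sup {P | ∃ N' : Frac j M, IsIntegralExt Z N N' ∧ P = N'.1}

/-- The integrally closed fractional submodules of `M`: the integral closures of fractional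
submodules. -/
def ClosedFrac {X Y : Scheme.{u}} (Z : Set Y.IdealSheafData) (j : X ⟶ Y) (M : X.Modules) :
    Type u :=
  {P : Subsheaf (push j M) // ∃ N : Frac j M, P = closure Z N}

/-- Integrally closed fractional submodules are ordered by inclusion. -/
instance {X Y : Scheme.{u}} (Z : Set Y.IdealSheafData) (j : X ⟶ Y) (M : X.Modules) :
    PartialOrder (ClosedFrac Z j M) :=
  inferInstanceAs (PartialOrder {P : Subsheaf (push j M) // ∃ N : Frac j M, P = closure Z N})

/-- The map sending a fractional submodule to its integral closure. -/
noncomputable def toClosed {X Y : Scheme.{u}} (Z : Set Y.IdealSheafData) (j : X ⟶ Y) (M : X.Modules)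
    (N : Frac j M) : ClosedFrac Z j M :=
  ⟨closure Z N, N, rfl⟩

end Modification

end IntegralClosure

/-! The geometric and the algebraic notion of integrality agree: the closure of `N` lies in the
closure of `N'` exactly when `s • N ≤ s • N'` for some bounded fractional ideal `s`
(`IsComplement.closure_le_closure_iff`). Given this, the theorem is formal. Bounded factors cancel
in normal modules (`IsNormalModule.cancel`), so a surjection of a module onto a partially ordered
set whose order is comparison up to bounded factors is a normalisation (`exists_isNormalisation`).

From blow-ups to bounded factors (`IsComplement.exists_bounded_of_isIntegralExt`): let `f` be the
blow-up along `T`, with `f⁻¹ N = f⁻¹ N'`. Over an affine open with ring `A`, and for `t ∈ T`, a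
section `n` of `N'` is, where `t` is invertible on `X`, a combination of generators of `N` with
coefficients in `A[T/t]`. Clearing denominators, and using that `M` is quasi-coherent and that
preimages of affine opens in `X` are quasi-compact, one finds `t ^ k • n ∈ T ^ k N`. A pigeonhole
argument on the generators of `T` gives `T ^ m N' ⊆ T ^ m N` for large `m`. The ideal `T` is bounded
because it contains a product of ideals of divisors in `Z`, and these are invertible fractional
ideals.

From bounded factors to blow-ups (`IsComplement.isIntegralExt_of_bounded`): a bounded `s` can be
scaled by a unit to lie in `1`, and then it is a finite type ideal sheaf `T`, since functions on `Y`
embed into functions on `X`. As `T` contains a unit it is trivial on `X`, so it is cosupported in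
`Z`. On the blow-up along `T`, glued here from the charts `Spec A[T/t]`, the ideal has a local
generator that can be cancelled, and `s • N' ≤ s • N` becomes `f⁻¹ N' ≤ f⁻¹ N`.

Finally, the integral extensions of a fixed module are directed and `N` is of finite type on a
quasi-compact scheme, so an `N` inside the closure of `N'` already lies in one integral extension of
`N'`. -/

namespace IntegralClosure

/-! ### Normalisation of modules over an idempotent semiring. -/

section Semiring

variable {α : Type*} [IdemCommSemiring α]

theorem IsBoundedElement.one : IsBoundedElement (1 : α) := ⟨1, 1, le_rfl, le_rfl⟩

theorem IsBoundedElement.mul {s t : α} (hs : IsBoundedElement s) (ht : IsBoundedElement t) :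
    IsBoundedElement (s * t) := by
  obtain ⟨a, b, h1, h2⟩ := hs
  obtain ⟨c, d, h3, h4⟩ := ht
  refine ⟨a * c, b * d, ?_, ?_⟩
  · rw [Units.val_mul]; exact mul_le_mul' h1 h3
  · rw [Units.val_mul]; exact mul_le_mul' h2 h4

theorem IsBoundedElement.pow {s : α} (hs : IsBoundedElement s) (n : ℕ) :
    IsBoundedElement (s ^ n) := by
  induction n with
  | zero => rw [pow_zero]; exact .one
  | succ n ih => rw [pow_succ]; exact ih.mul hs

variable {μ : Type*} [AddCommMonoid μ] [Module α μ]

theorem JoinLE.smul {x y : μ} (s : α) (h : JoinLE x y) : JoinLE (s • x) (s • y) := by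
  unfold JoinLE at *; rw [← smul_add, h]

theorem JoinLE.trans {x y z : μ} (h : JoinLE x y) (k : JoinLE y z) : JoinLE x z := by
  unfold JoinLE at *; rw [← k, ← add_assoc, h]

theorem JoinLE.add {x y z : μ} (h : JoinLE x z) (k : JoinLE y z) : JoinLE (x + y) z := by
  unfold JoinLE at *; rw [add_assoc, k, h]

theorem JoinLE.antisymm {x y : μ} (h : JoinLE x y) (k : JoinLE y x) : x = y := by
  unfold JoinLE at *; rw [← k, add_comm, h]

theorem add_self_of_module (α : Type*) [IdemCommSemiring α] {μ : Type*} [AddCommMonoid μ] [Module α μ]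
    (x : μ) : x + x = x := by
  have := add_smul (1 : α) 1 x
  rwa [add_idem, one_smul, eq_comm] at this

theorem JoinLE.refl (α : Type*) [IdemCommSemiring α] {μ : Type*} [AddCommMonoid μ] [Module α μ]
    (x : μ) : JoinLE x x := add_self_of_module α x

theorem joinLE_add_left (α : Type*) [IdemCommSemiring α] {μ : Type*} [AddCommMonoid μ] [Module α μ]
    (x y : μ) : JoinLE x (x + y) := by
  unfold JoinLE; rw [← add_assoc, add_self_of_module α]

theorem joinLE_add_right (α : Type*) [IdemCommSemiring α] {μ : Type*} [AddCommMonoid μ] [Module α μ]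
    (x y : μ) : JoinLE y (x + y) := by
  rw [add_comm]; exact joinLE_add_left α y x

theorem isOrderIdeal_principal (α : Type*) [IdemCommSemiring α] {μ : Type*} [AddCommMonoid μ] [Module α μ]
    (x : μ) : IsOrderIdeal (principal x) where
  zero_mem := zero_add x
  add_mem _ h _ k := JoinLE.add h k
  lower _ _ h k := JoinLE.trans h k

/-- In a normal module, bounded elements can be cancelled. -/
theorem IsNormalModule.cancel (h : IsNormalModule α μ) {x y : μ} {s : α}
    (hs : IsBoundedElement s) (hxy : JoinLE (s • x) (s • y)) : JoinLE x y := by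
  -- Normality at `y` is applied to the ideal below `x + y`: it contains `x`, and the one factor `s`
  -- makes it integral over the ideal below `y`.
  refine h y (principal (x + y)) (isOrderIdeal_principal α _)
    ⟨fun z hz => JoinLE.trans hz (joinLE_add_right α _ _), fun z hz =>
      ⟨s, hs, y, JoinLE.refl α y, ?_⟩⟩ (joinLE_add_left α x y)
  refine (hz.smul s).trans ?_
  rw [smul_add]
  exact hxy.add (JoinLE.refl α _)

variable {ν : Type*} [PartialOrder ν] {c : μ → ν}

/-- If a surjection `c` from a module onto a partially ordered set identifies exactly the elements
which agree up to a bounded factor, then it is a normalisation. -/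
theorem exists_isNormalisation (hc : Function.Surjective c)
    (hle : ∀ x y, c x ≤ c y ↔ ∃ s : α, IsBoundedElement s ∧ JoinLE (s • x) (s • y)) :
    ∃ (_ : AddCommMonoid ν) (_ : Module α ν), (∀ p q : ν, IsLUB {p, q} (p + q)) ∧
      ∃ φ : μ →ₗ[α] ν, (∀ x, φ x = c x) ∧ IsNormalisation.{w} φ := by
  have mono : ∀ x y, JoinLE x y → c x ≤ c y := fun x y h =>
    (hle x y).2 ⟨1, .one, h.smul 1⟩
  have hadd_le : ∀ x y z, c (x + y) ≤ c z ↔ c x ≤ c z ∧ c y ≤ c z := by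
    refine fun x y z => ⟨fun h => ⟨(mono _ _ (joinLE_add_left α x y)).trans h,
      (mono _ _ (joinLE_add_right α x y)).trans h⟩, fun ⟨h, k⟩ => ?_⟩
    obtain ⟨s, hs, h⟩ := (hle _ _).1 h
    obtain ⟨t, ht, k⟩ := (hle _ _).1 k
    refine (hle _ _).2 ⟨s * t, hs.mul ht, ?_⟩
    rw [smul_add]
    refine JoinLE.add ?_ ?_
    · rw [mul_comm, mul_smul, mul_smul]; exact h.smul t
    · rw [mul_smul, mul_smul]; exact k.smul s
  have hsmul_le : ∀ (a : α) x y, c x ≤ c y → c (a • x) ≤ c (a • y) := by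
    intro a x y h
    obtain ⟨s, hs, h⟩ := (hle _ _).1 h
    refine (hle _ _).2 ⟨s, hs, ?_⟩
    rw [smul_comm s a, smul_comm s a]
    exact h.smul a
  have hadd : ∀ x x' y y', c x = c x' → c y = c y' → c (x + y) = c (x' + y') := by
    have : ∀ x x' y y', c x = c x' → c y = c y' → c (x + y) ≤ c (x' + y') := by
      refine fun x x' y y' h k => (hadd_le _ _ _).2 ⟨?_, ?_⟩
      · rw [h]; exact mono _ _ (joinLE_add_left α _ _)
      · rw [k]; exact mono _ _ (joinLE_add_right α _ _)
    exact fun x x' y y' h k => (this x x' y y' h k).antisymm (this x' x y' y h.symm k.symm)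
  have hsmul : ∀ (a : α) x y, c x = c y → c (a • x) = c (a • y) := fun a x y h =>
    (hsmul_le a x y h.le).antisymm (hsmul_le a y x h.ge)
  -- Operations on `ν` are defined through chosen representatives `g p`; `hadd` and `hsmul` make `c`
  -- compatible with them. Natural multiples are included because they are part of the monoid
  -- structure being transported.
  obtain ⟨g, hg⟩ := hc.hasRightInverse
  let : Add ν := ⟨fun p q => c (g p + g q)⟩
  let : Zero ν := ⟨c 0⟩
  let : SMul α ν := ⟨fun a p => c (a • g p)⟩
  let : SMul ℕ ν := ⟨fun n p => c (n • g p)⟩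
  have cadd : ∀ x y, c (x + y) = c x + c y := fun x y =>
    hadd _ _ _ _ (hg (c x)).symm (hg (c y)).symm
  have csmul : ∀ (a : α) x, c (a • x) = a • c x := fun a x => hsmul a _ _ (hg (c x)).symm
  have cnsmul : ∀ (x : μ) (n : ℕ), c (n • x) = n • c x := by
    intro x n
    change _ = c (n • g (c x))
    induction n with
    | zero => rw [zero_smul, zero_smul]
    | succ n ih => rw [succ_nsmul, succ_nsmul]; exact hadd _ _ _ _ ih (hg _).symm
  let instM : AddCommMonoid ν := hc.addCommMonoid c rfl cadd cnsmul
  let : Module α ν := hc.module α ⟨⟨c, rfl⟩, cadd⟩ csmul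
  let φ : μ →ₗ[α] ν := ⟨⟨c, cadd⟩, csmul⟩
  have hjoin : ∀ p q : ν, JoinLE p q ↔ p ≤ q := by
    intro p q
    obtain ⟨x, rfl⟩ := hc p
    obtain ⟨y, rfl⟩ := hc q
    unfold JoinLE
    rw [← cadd]
    refine ⟨fun h => h ▸ mono _ _ (joinLE_add_left α x y), fun h => le_antisymm ?_
      (mono _ _ (joinLE_add_right α x y))⟩
    exact (hadd_le _ _ _).2 ⟨h, le_rfl⟩
  refine ⟨instM, inferInstance, ?_, φ, fun _ => rfl, ?_, ?_⟩
  · intro p q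
    obtain ⟨x, rfl⟩ := hc p
    obtain ⟨y, rfl⟩ := hc q
    rw [← cadd]
    refine ⟨?_, fun r hr => ?_⟩
    · rintro _ (rfl | rfl)
      exacts [mono _ _ (joinLE_add_left α x y), mono _ _ (joinLE_add_right α x y)]
    · obtain ⟨z, rfl⟩ := hc r
      exact (hadd_le _ _ _).2 ⟨hr (Or.inl rfl), hr (Or.inr rfl)⟩
  · intro n ι' _ hι p hp
    obtain ⟨s, hs, q, hq, hpq⟩ := hι.2 p hp
    replace hpq := hpq.trans (JoinLE.smul s hq)
    change JoinLE p n
    obtain ⟨x, rfl⟩ := hc p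
    obtain ⟨y, rfl⟩ := hc n
    rw [hjoin, ← csmul, ← csmul] at hpq
    -- The inequality between `c (s • x)` and `c (s • y)` is itself witnessed by a bounded `t`, so
    -- `t * s` compares `x` with `y`.
    obtain ⟨t, ht, h⟩ := (hle _ _).1 hpq
    rw [hjoin]
    exact (hle _ _).2 ⟨t * s, ht.mul hs, by rwa [mul_smul, mul_smul]⟩
  · intro κ _ _ hκ ψ
    -- A normal target cancels the bounded factor, so `ψ` depends only on the class under `c`.
    have hψ : ∀ x y, c x ≤ c y → JoinLE (ψ x) (ψ y) := by
      intro x y h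
      obtain ⟨s, hs, h⟩ := (hle _ _).1 h
      refine hκ.cancel hs ?_
      unfold JoinLE at h ⊢
      rw [← map_smul, ← map_smul, ← map_add, h]
    have hψ' : ∀ x, ψ (g (c x)) = ψ x := fun x =>
      (hψ _ _ (hg (c x)).le).antisymm (hψ _ _ (hg (c x)).ge)
    refine ⟨⟨⟨fun p => ψ (g p), fun p q => ?_⟩, fun a p => ?_⟩, ?_, ?_⟩
    · rw [← map_add]; exact hψ' _
    · rw [RingHom.id_apply, ← map_smul]; exact hψ' _
    · ext x; exact hψ' x
    · intro χ hχ
      ext p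
      have := congr($hχ (g p))
      rw [← hg p]
      exact this.trans (hψ' (g p)).symm

end Semiring

/-! ### Inverse images of ideal sheaves on affine opens. -/

section IdealSheaf

open Scheme

/-- An affine scheme as an affine open subset of itself. -/
abbrev affineTop (X : Scheme.{u}) [IsAffine X] : X.affineOpens := ⟨⊤, isAffineOpen_top X⟩

/-- Inverse image is left adjoint to direct image, and direct image between affine schemes is
contraction of ideals of global sections; the left adjoint of contraction is extension. -/
theorem comap_ideal_top {W Y : Scheme.{u}} [IsAffine W] [IsAffine Y] (I : Y.IdealSheafData)
    (f : W ⟶ Y) :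
    (I.comap f).ideal (affineTop W) =
      (I.ideal (affineTop Y)).map (f.app ⊤).hom := by
  refine eq_of_forall_ge_iff fun J => ?_
  obtain ⟨K, rfl⟩ : ∃ K : W.IdealSheafData, K.ideal (affineTop W) = J :=
    (IdealSheafData.equivOfIsAffine (X := W)).surjective J
  have h1 : (I.comap f).ideal (affineTop W) ≤ K.ideal (affineTop W) ↔
      I.comap f ≤ K := ⟨IdealSheafData.le_of_isAffine, fun h => h _⟩
  have h2 : I ≤ K.map f ↔ I.ideal (affineTop Y) ≤
      (K.map f).ideal (affineTop Y) := ⟨fun h => h _, IdealSheafData.le_of_isAffine⟩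
  rw [h1, ← IdealSheafData.le_map_iff_comap_le, h2,
    IdealSheafData.ideal_map_of_isAffineHom]
  exact (Ideal.map_le_iff_le_comap (f := (f.app ⊤).hom) (I := I.ideal (affineTop Y))
    (K := K.ideal (affineTop W))).symm

theorem comap_ideal_of_isOpenImmersion {O Y : Scheme.{u}} [IsAffine O] (I : Y.IdealSheafData)
    (i : O ⟶ Y) [IsOpenImmersion i] (U : Y.affineOpens) (h : ⊤ ≤ i ⁻¹ᵁ U.1) :
    (I.comap i).ideal (affineTop O) = (I.ideal U).map (i.appLE U ⊤ h).hom := by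
  have hle : i ''ᵁ ⊤ ≤ U.1 := by
    rintro _ ⟨x, hx, rfl⟩; exact h hx
  rw [IdealSheafData.ideal_comap_of_isOpenImmersion,
    ← IdealSheafData.map_ideal I (V := U) hle]
  have e := Ideal.map_symm (I := (Ideal.map (Y.presheaf.map (homOfLE hle).op).hom (I.ideal U)))
    (f := (i.appIso ⊤).commRingCatIsoToRingEquiv.symm)
  refine e.symm.trans ?_
  rw [RingEquiv.symm_symm]
  change Ideal.map (i.appIso ⊤).hom.hom _ = _
  rw [Ideal.map_map, ← CommRingCat.hom_comp, Hom.appIso_hom', Hom.map_appLE]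

/-- The sections of an inverse image ideal sheaf. -/
theorem comap_ideal {W Y : Scheme.{u}} (I : Y.IdealSheafData) (f : W ⟶ Y) (U : Y.affineOpens)
    (V : W.affineOpens) (h : V.1 ≤ f ⁻¹ᵁ U.1) :
    (I.comap f).ideal V = (I.ideal U).map (f.appLE U V h).hom := by
  have : IsAffine V.1.toScheme := V.2
  have : IsAffine U.1.toScheme := U.2
  have e : (I.comap f).comap V.1.ι = (I.comap U.1.ι).comap (f.resLE U V h) := by
    rw [← IdealSheafData.comap_comp, ← IdealSheafData.comap_comp, Hom.resLE_comp_ι]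
  have e' := congrArg (fun J : IdealSheafData _ => J.ideal (affineTop _)) e
  dsimp only at e'
  rw [comap_ideal_of_isOpenImmersion _ _ V (by simp), comap_ideal_top,
    comap_ideal_of_isOpenImmersion _ _ U (by simp), Ideal.map_map, ← CommRingCat.hom_comp] at e'
  -- Both sides have been compared after extension to the scheme `V`. That extension is along a
  -- bijection, hence injective on ideals.
  have hb : Function.Bijective (V.1.ι.appLE V ⊤ (by simp)).hom := by
    have : IsIso (V.1.ι.appLE V ⊤ (by simp)) := by
      have : V.1.ι.appLE V ⊤ (by simp) = V.1.topIso.inv := by simp [Scheme.Opens.ι_appLE]; rfl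
      rw [this]
      infer_instance
    exact ConcreteCategory.bijective_of_isIso _
  have hcomp : U.1.ι.appLE U ⊤ (by simp) ≫ (f.resLE U V h).app ⊤ =
      f.appLE U V h ≫ V.1.ι.appLE V ⊤ (by simp) := by
    rw [← Hom.appLE_eq_app, Hom.appLE_comp_appLE, Hom.appLE_comp_appLE]
    congr 1
    rw [Hom.resLE_comp_ι]
  rw [hcomp] at e'
  have e'' := e'.trans (Ideal.map_map (I := I.ideal U) (f.appLE U V h).hom
    (V.1.ι.appLE V ⊤ (by simp)).hom).symm
  have inj : Function.Injective (Ideal.map (V.1.ι.appLE V ⊤ (by simp)).hom) := by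
    intro A B hAB
    have := congrArg (Ideal.comap (V.1.ι.appLE V ⊤ (by simp)).hom) hAB
    rwa [Ideal.comap_map_of_bijective _ hb, Ideal.comap_map_of_bijective _ hb] at this
  exact inj e''

/-- A quasi-coherent ideal is finitely generated over every affine open if this holds locally. -/
theorem ideal_fg_of_local {Y : Scheme.{u}} (I : Y.IdealSheafData)
    (h : ∀ y : Y, ∃ U : Y.affineOpens, y ∈ U.1 ∧ (I.ideal U).FG) (U : Y.affineOpens) :
    (I.ideal U).FG := by
  choose V hV hI using h
  refine of_affine_open_cover (P := fun U => (I.ideal U).FG) V ?_ U ?_ ?_ hI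
  · exact top_le_iff.1 fun y _ => Opens.mem_iSup.2 ⟨y, hV y⟩
  · intro U f hU
    rw [← I.map_ideal (Y.affineBasicOpen_le f)]
    exact hU.map _
  · intro U s hs hf
    refine Ideal.fg_of_localizationSpan (s : Set Γ(Y, U)) hs fun g => ?_
    have := U.2.isLocalization_basicOpen g.1
    have h1 := hf g
    rw [← I.map_ideal (Y.affineBasicOpen_le g.1)] at h1
    let e := IsLocalization.algEquiv (.powers g.1) Γ(Y, Y.basicOpen g.1) (Localization.Away g.1)
    have h2 := h1.map e.toRingEquiv.toRingHom
    replace h2 := (Ideal.map_map (I := I.ideal U) (Y.presheaf.map (homOfLE _).op).hom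
      e.toRingEquiv.toRingHom) ▸ h2
    convert h2
    ext x
    exact (e.commutes x).symm

end IdealSheaf

/-! ### Pullback, gluing and regularity of functions. -/

section Sections

/-- The pullback of functions along a morphism of schemes. -/
noncomputable def pull {W Y : Scheme.{u}} (g : W ⟶ Y) {U : Y.Opens} {N : W.Opens}
    (h : N ≤ g ⁻¹ᵁ U) : Γ(Y, U) →+* Γ(W, N) :=
  (g.appLE U N h).hom

theorem resFun_resFun {Y : Scheme.{u}} {U V W : Y.Opens} (h : V ≤ U) (k : W ≤ V)
    (a : Γ(Y, U)) : resFun k (resFun h a) = resFun (k.trans h) a := by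
  have := Y.presheaf.map_comp (homOfLE h).op (homOfLE k).op
  exact (congr($this a)).symm

theorem resFun_self {Y : Scheme.{u}} {U : Y.Opens} (h : U ≤ U) (a : Γ(Y, U)) :
    resFun h a = a := by
  have := Y.presheaf.map_id (Opposite.op U)
  exact congr($this a)

theorem resFun_pull {W Y : Scheme.{u}} (g : W ⟶ Y) {U : Y.Opens} {N N' : W.Opens}
    (h : N ≤ g ⁻¹ᵁ U) (k : N' ≤ N) (a : Γ(Y, U)) :
    resFun k (pull g h a) = pull g (k.trans h) a := by
  have := Scheme.Hom.appLE_map g h (homOfLE k).op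
  exact congr($this a)

theorem pull_resFun {W Y : Scheme.{u}} (g : W ⟶ Y) {U U' : Y.Opens} {N : W.Opens}
    (h : N ≤ g ⁻¹ᵁ U) (k : U ≤ U') (a : Γ(Y, U')) :
    pull g h (resFun k a) = pull g (fun _ hx => k (h hx)) a := by
  have := Scheme.Hom.map_appLE g h (homOfLE k).op
  exact congr($this a)

theorem pull_pull {W V Y : Scheme.{u}} (g : W ⟶ V) (f : V ⟶ Y) {U : Y.Opens} {N : V.Opens}
    {P : W.Opens} (h : N ≤ f ⁻¹ᵁ U) (k : P ≤ g ⁻¹ᵁ N) (a : Γ(Y, U)) :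
    pull g k (pull f h a) = pull (g ≫ f) (fun _ hx => h (k hx)) a := by
  have := Scheme.Hom.appLE_comp_appLE g f U N P h k
  exact congr($this a)

theorem pull_congr {W Y : Scheme.{u}} {f g : W ⟶ Y} (e : f = g) {U : Y.Opens} {N : W.Opens}
    (h : N ≤ f ⁻¹ᵁ U) (a : Γ(Y, U)) : pull f h a = pull g (e ▸ h) a := by
  subst e; rfl

theorem pull_image_bijective {O W : Scheme.{u}} (o : O ⟶ W) [IsOpenImmersion o] (N : O.Opens)
    (h : N ≤ o ⁻¹ᵁ (o ''ᵁ N)) : Function.Bijective (pull o h) := by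
  have : pull o h = (o.appIso N).hom.hom := by rw [Scheme.Hom.appIso_hom']; rfl
  rw [this]
  exact ConcreteCategory.bijective_of_isIso _

theorem eq_of_locally_eq {Y : Scheme.{u}} {U : Y.Opens} (a b : Γ(Y, U))
    (h : ∀ x ∈ U, ∃ (V : Y.Opens) (k : V ≤ U), x ∈ V ∧ resFun k a = resFun k b) : a = b := by
  choose! V hV hx hab using h
  refine Y.sheaf.eq_of_locally_eq' (fun x : U => V x) U (fun x => homOfLE (hV x x.2))
    (fun x hxU => Opens.mem_iSup.2 ⟨⟨x, hxU⟩, hx x hxU⟩) a b fun x => hab x x.2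

/-- Sections defined uniquely by a condition of local nature exist globally if they exist
locally. -/
theorem exists_glue {Y : Scheme.{u}} {U : Y.Opens} (P : ∀ V : Y.Opens, V ≤ U → Γ(Y, V) → Prop)
    (hres : ∀ (V W : Y.Opens) (h : V ≤ U) (k : W ≤ V) (a : Γ(Y, V)), P V h a →
      P W (k.trans h) (resFun k a))
    (huniq : ∀ (V : Y.Opens) (h : V ≤ U) (a b : Γ(Y, V)), P V h a → P V h b → a = b)
    (hloc : ∀ x ∈ U, ∃ (V : Y.Opens) (h : V ≤ U) (a : Γ(Y, V)), x ∈ V ∧ P V h a) :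
    ∃ a : Γ(Y, U), ∀ x ∈ U, ∃ (V : Y.Opens) (h : V ≤ U), x ∈ V ∧ P V h (resFun h a) := by
  choose! V hV a hx hP using hloc
  obtain ⟨s, hs, -⟩ := Y.sheaf.existsUnique_gluing' (fun x : U => V x) U
    (fun x => homOfLE (hV x x.2)) (fun x hxU => Opens.mem_iSup.2 ⟨⟨x, hxU⟩, hx x hxU⟩)
    (fun x => a x) (by
      intro x y
      exact huniq _ (inf_le_left.trans (hV x x.2)) _ _
        (hres _ _ _ inf_le_left _ (hP x x.2)) (hres _ _ _ inf_le_right _ (hP y y.2)))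
  refine ⟨s, fun x hxU => ⟨V x, hV x hxU, hx x hxU, ?_⟩⟩
  have : resFun (hV x hxU) s = a x := hs ⟨x, hxU⟩
  rw [this]
  exact hP x hxU

/-- A function is regular if its restrictions to all open subsets are non-zero-divisors. -/
def IsReg {Y : Scheme.{u}} {U : Y.Opens} (a : Γ(Y, U)) : Prop :=
  ∀ (V : Y.Opens) (h : V ≤ U), resFun h a ∈ nonZeroDivisors Γ(Y, V)

theorem IsReg.mem {Y : Scheme.{u}} {U : Y.Opens} {a : Γ(Y, U)} (h : IsReg a) :
    a ∈ nonZeroDivisors Γ(Y, U) := by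
  simpa [resFun_self] using h U le_rfl

theorem IsReg.res {Y : Scheme.{u}} {U V : Y.Opens} {a : Γ(Y, U)} (ha : IsReg a) (h : V ≤ U) :
    IsReg (resFun h a) := fun W k => by rw [resFun_resFun]; exact ha _ _

theorem IsReg.of_local {Y : Scheme.{u}} {U : Y.Opens} {a : Γ(Y, U)}
    (h : ∀ x ∈ U, ∃ (V : Y.Opens) (k : V ≤ U), x ∈ V ∧ IsReg (resFun k a)) : IsReg a := by
  intro W hW
  rw [mem_nonZeroDivisors_iff_right]
  intro b hb
  refine eq_of_locally_eq _ _ fun x hx => ?_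
  obtain ⟨V, k, hxV, hV⟩ := h x (hW hx)
  refine ⟨V ⊓ W, inf_le_right, ⟨hxV, hx⟩, ?_⟩
  rw [map_zero]
  have h1 := congrArg (resFun (inf_le_right : V ⊓ W ≤ W)) hb
  rw [map_mul, map_zero, resFun_resFun] at h1
  have h2 := hV (V ⊓ W) inf_le_left
  rw [resFun_resFun] at h2
  exact (mem_nonZeroDivisors_iff_right.1 h2) _ h1

theorem IsReg.of_dvd {Y : Scheme.{u}} {U : Y.Opens} {a b : Γ(Y, U)} (hb : IsReg b) (h : a ∣ b) :
    IsReg a := by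
  obtain ⟨c, rfl⟩ := h
  intro V k
  have := hb V k
  rw [map_mul] at this
  exact (mul_mem_nonZeroDivisors.1 this).1

/-- Non-zero-divisors stay so under localisation, hence on basic opens, and these cover every
smaller open set. -/
theorem isReg_of_isAffineOpen {Y : Scheme.{u}} {U : Y.Opens} (hU : IsAffineOpen U) {a : Γ(Y, U)}
    (ha : a ∈ nonZeroDivisors Γ(Y, U)) : IsReg a := by
  intro V h
  rw [mem_nonZeroDivisors_iff_right]
  intro b hb
  refine eq_of_locally_eq _ _ fun x hx => ?_
  obtain ⟨f, hf, hxf⟩ := hU.exists_basicOpen_le ⟨x, hx⟩ (h hx)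
  refine ⟨Y.basicOpen f, hf, hxf, ?_⟩
  have hloc := hU.isLocalization_basicOpen f
  have h1 := congrArg (resFun hf) hb
  rw [map_mul, map_zero, resFun_resFun] at h1
  have h2 : resFun (hf.trans h) a ∈ nonZeroDivisors Γ(Y, Y.basicOpen f) :=
    IsLocalization.map_nonZeroDivisors_le (.powers f) _ ⟨a, ha, rfl⟩
  rw [map_zero]
  exact (mem_nonZeroDivisors_iff_right.1 h2) _ h1

theorem isReg_pull_image {O W : Scheme.{u}} (o : O ⟶ W) [IsOpenImmersion o] {N : O.Opens}
    {M : W.Opens} (h : N ≤ o ⁻¹ᵁ M) (h' : o ''ᵁ N ≤ M) {a : Γ(W, M)} :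
    IsReg (pull o h a) ↔ IsReg (resFun h' a) := by
  have key : ∀ (V : O.Opens) (hV : V ≤ N) (hV' : o ''ᵁ V ≤ M),
      pull o (hV.trans h) a ∈ nonZeroDivisors Γ(O, V) ↔
        resFun hV' a ∈ nonZeroDivisors Γ(W, o ''ᵁ V) := by
    intro V hV hV'
    have hle : V ≤ o ⁻¹ᵁ (o ''ᵁ V) := fun x hx => ⟨x, hx, rfl⟩
    let e := RingEquiv.ofBijective (pull o hle) (pull_image_bijective o V hle)
    have := MulEquivClass.map_nonZeroDivisors e
    rw [← this]
    have e1 : pull o (hV.trans h) a = e (resFun hV' a) := (pull_resFun o hle hV' a).symm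
    rw [e1]
    exact ⟨fun ⟨b, hb, hbe⟩ => e.injective hbe ▸ hb, fun hb => ⟨_, hb, rfl⟩⟩
  constructor
  · intro hr V hV
    obtain ⟨V', rfl⟩ : ∃ V' : O.Opens, V = o ''ᵁ V' := by
      refine ⟨o ⁻¹ᵁ V, Opens.ext (Set.ext fun x => ⟨fun hx => ?_, ?_⟩)⟩
      · obtain ⟨y, hy, rfl⟩ := hV hx
        exact ⟨y, hx, rfl⟩
      · rintro ⟨y, hy, rfl⟩; exact hy
    have hV' : V' ≤ N := fun x hx => by
      obtain ⟨y, hy, hyx⟩ := hV ⟨x, hx, rfl⟩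
      rwa [← o.injective hyx]
    have := hr V' hV'
    rw [resFun_pull] at this
    rw [resFun_resFun]
    exact (key V' hV' _).1 this
  · intro hr V hV
    rw [resFun_pull]
    have := hr (o ''ᵁ V) (by rintro _ ⟨y, hy, rfl⟩; exact ⟨y, hV hy, rfl⟩)
    rw [resFun_resFun] at this
    exact (key V hV _).2 this

end Sections

/-! ### Local generators of an invertible inverse image ideal. -/

section Generators

variable {W Y : Scheme.{u}} {T : Y.IdealSheafData} {g : W ⟶ Y} {U : Y.affineOpens}
  {t : Γ(Y, U)} {N : W.Opens}

/-- Over the open set `N`, the inverse image of the ideal `T` under `g` is generated by the pullback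
of the section `t` of `T`, which is regular. -/
structure GenOver (T : Y.IdealSheafData) (g : W ⟶ Y) (U : Y.affineOpens) (t : Γ(Y, U))
    (N : W.Opens) : Prop where
  le : N ≤ g ⁻¹ᵁ U.1
  mem : t ∈ T.ideal U
  reg : IsReg (pull g le t)
  dvd : ∀ x ∈ T.ideal U, pull g le t ∣ pull g le x

/-- The inverse image of the ideal `T` under `g` is invertible. -/
def IsInv (T : Y.IdealSheafData) (g : W ⟶ Y) : Prop :=
  ∀ w : W, ∃ (U : Y.affineOpens) (t : Γ(Y, U)) (N : W.Opens), w ∈ N ∧ GenOver T g U t N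

theorem GenOver.mono (h : GenOver T g U t N) {N' : W.Opens} (k : N' ≤ N) :
    GenOver T g U t N' where
  le := k.trans h.le
  mem := h.mem
  reg := by rw [← resFun_pull g h.le k]; exact h.reg.res k
  dvd x hx := by
    rw [← resFun_pull g h.le k, ← resFun_pull g h.le k]; exact map_dvd _ (h.dvd x hx)

/-- A quotient of `x` by `t` is unique because `t` is regular, so local quotients glue
(`exists_glue`). -/
theorem GenOver.of_local (ht : t ∈ T.ideal U)
    (h : ∀ w ∈ N, ∃ N' : W.Opens, w ∈ N' ∧ GenOver T g U t N') : GenOver T g U t N where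
  le w hw := by
    obtain ⟨N', hw', h'⟩ := h w hw
    exact h'.le hw'
  mem := ht
  reg := by
    refine IsReg.of_local fun w hw => ?_
    obtain ⟨N', hw', h'⟩ := h w hw
    refine ⟨N' ⊓ N, inf_le_right, ⟨hw', hw⟩, ?_⟩
    rw [resFun_pull]
    exact (h'.mono inf_le_left).reg
  dvd x hx := by
    have le : N ≤ g ⁻¹ᵁ U.1 := fun w hw => by
      obtain ⟨N', hw', h'⟩ := h w hw
      exact h'.le hw'
    have reg : IsReg (pull g le t) := by
      refine IsReg.of_local fun w hw => ?_
      obtain ⟨N', hw', h'⟩ := h w hw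
      refine ⟨N' ⊓ N, inf_le_right, ⟨hw', hw⟩, ?_⟩
      rw [resFun_pull]
      exact (h'.mono inf_le_left).reg
    have key : ∃ a : Γ(W, N), ∀ w ∈ N, ∃ (V : W.Opens) (hV : V ≤ N), w ∈ V ∧
        resFun hV (pull g le x) = resFun hV (pull g le t) * resFun hV a := by
      refine exists_glue
        (fun V hV q => resFun hV (pull g le x) = resFun hV (pull g le t) * q) ?_ ?_ ?_
      · intro V V' hV k a e
        rw [← resFun_resFun hV k, e, map_mul, resFun_resFun]
      · intro V hV a b e e'
        exact (mul_cancel_left_mem_nonZeroDivisors (reg V hV)).1 (e.symm.trans e')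
      · intro w hw
        obtain ⟨N', hw', h'⟩ := h w hw
        obtain ⟨q, hq⟩ := (h'.mono inf_le_left : GenOver T g U t (N' ⊓ N)).dvd x hx
        refine ⟨N' ⊓ N, inf_le_right, q, ⟨hw', hw⟩, ?_⟩
        rw [resFun_pull, resFun_pull, hq]
    obtain ⟨a, ha⟩ := key
    refine ⟨a, eq_of_locally_eq _ _ fun w hw => ?_⟩
    obtain ⟨V, hV, hwV, e⟩ := ha w hw
    exact ⟨V, hV, hwV, by rw [e, map_mul]⟩

/-- The generator can be chosen among the pullbacks of sections of `T`. Write these as multiples `e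
* d'` of a local generator `d'`. If every `e` vanished at `w`, then `d' ∈ p * (d')` for the ideal
`p` of functions vanishing at `w`, and cancelling the regular `d'` would give `1 ∈ p`. So some `e`
is invertible near `w`. -/
theorem exists_genOver_of_isEffectiveCartier (h : IsEffectiveCartier (T.comap g))
    (U : Y.affineOpens) (w : W) (hw : g w ∈ U.1) :
    ∃ (t : Γ(Y, U)) (N : W.Opens), w ∈ N ∧ GenOver T g U t N := by
  obtain ⟨N₀, hwN₀, d, hd, hI⟩ := h w
  obtain ⟨N, hN, hwN, hle⟩ := exists_isAffineOpen_mem_and_subset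
    (x := w) (U := N₀.1 ⊓ g ⁻¹ᵁ U.1) ⟨hwN₀, hw⟩
  have hN0 : N ≤ N₀.1 := hle.trans inf_le_left
  have hNU : N ≤ g ⁻¹ᵁ U.1 := hle.trans inf_le_right
  let d' : Γ(W, N) := resFun hN0 d
  have hd' : IsReg d' := (isReg_of_isAffineOpen N₀.2 hd).res hN0
  have hJ : (T.ideal U).map (pull g hNU) = Ideal.span {d'} := by
    have h1 := comap_ideal T g U ⟨N, hN⟩ hNU
    have h2 := (T.comap g).map_ideal (U := ⟨N, hN⟩) (V := N₀) hN0
    rw [hI, Ideal.map_span, Set.image_singleton] at h2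
    exact h1.symm.trans h2.symm
  let p : Ideal Γ(W, N) :=
    (IsLocalRing.maximalIdeal _).comap (W.presheaf.germ N w hwN).hom
  have hp : ∀ e, e ∉ p → w ∈ W.basicOpen e := by
    intro e he
    rw [Scheme.mem_basicOpen _ _ _ hwN]
    by_contra hu
    exact he hu
  have hdiv : ∀ x ∈ T.ideal U, ∃ e, pull g hNU x = e * d' := fun x hx => by
    have : pull g hNU x ∈ Ideal.span {d'} := hJ ▸ Ideal.mem_map_of_mem _ hx
    exact (Ideal.mem_span_singleton'.1 this).imp fun _ h => h.symm
  obtain ⟨t, ht, e, he, hte⟩ : ∃ t ∈ T.ideal U, ∃ e ∉ p, pull g hNU t = e * d' := by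
    by_contra! hcon
    have h1 : (T.ideal U).map (pull g hNU) ≤ p * Ideal.span {d'} := by
      rw [Ideal.map_le_iff_le_comap]
      intro x hx
      obtain ⟨e, he⟩ := hdiv x hx
      rw [Ideal.mem_comap, he]
      refine Ideal.mul_mem_mul ?_ (Ideal.mem_span_singleton_self _)
      by_contra hep
      exact hcon x hx e hep he
    have h2 : d' ∈ p * Ideal.span {d'} := h1 (hJ ▸ Ideal.mem_span_singleton_self d')
    obtain ⟨z, hz, hzd⟩ := Ideal.mem_mul_span_singleton.1 h2
    have h3 : z = 1 := (mul_cancel_right_mem_nonZeroDivisors hd'.mem).1 (hzd.trans (one_mul _).symm)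
    have : p ≠ ⊤ := Ideal.comap_ne_top _ (IsLocalRing.maximalIdeal.isMaximal _).ne_top
    exact this ((Ideal.eq_top_iff_one _).2 (h3 ▸ hz))
  refine ⟨t, W.basicOpen e, hp e he, (W.basicOpen_le e).trans hNU, ht, ?_, ?_⟩
  · rw [← resFun_pull g hNU (W.basicOpen_le e), hte, map_mul]
    have hu : IsUnit (resFun (W.basicOpen_le e) e) := W.toRingedSpace.isUnit_res_basicOpen e
    exact (hd'.res _).of_dvd (hu.mul_left_dvd.2 dvd_rfl)
  · intro x hx
    have hu : IsUnit (resFun (W.basicOpen_le e) e) := W.toRingedSpace.isUnit_res_basicOpen e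
    obtain ⟨e', he'⟩ := hdiv x hx
    rw [← resFun_pull g hNU (W.basicOpen_le e), ← resFun_pull g hNU (W.basicOpen_le e), hte, he',
      map_mul, map_mul]
    exact hu.mul_left_dvd.2 (Dvd.intro_left _ rfl)

theorem isEffectiveCartier_comap_iff : IsEffectiveCartier (T.comap g) ↔ IsInv T g := by
  constructor
  · intro h w
    obtain ⟨U, hU, hgU, -⟩ := exists_isAffineOpen_mem_and_subset (x := g w) (U := ⊤) trivial
    obtain ⟨t, N, hw, hN⟩ := exists_genOver_of_isEffectiveCartier h ⟨U, hU⟩ w hgU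
    exact ⟨_, t, N, hw, hN⟩
  · intro h w
    obtain ⟨U, t, N, hw, hN⟩ := h w
    obtain ⟨N', hN', hwN', hle⟩ := exists_isAffineOpen_mem_and_subset hw
    have h' := hN.mono hle
    refine ⟨⟨N', hN'⟩, hwN', pull g h'.le t, h'.reg.mem, ?_⟩
    rw [comap_ideal T g U ⟨N', hN'⟩ h'.le]
    apply le_antisymm
    · rw [Ideal.map_le_iff_le_comap]
      intro x hx
      exact Ideal.mem_span_singleton.2 (h'.dvd x hx)
    · rw [Ideal.span_singleton_le_iff_mem]
      exact Ideal.mem_map_of_mem _ h'.mem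

theorem IsInv.exists_genOver (h : IsInv T g) (U : Y.affineOpens) (w : W) (hw : g w ∈ U.1) :
    ∃ (t : Γ(Y, U)) (N : W.Opens), w ∈ N ∧ GenOver T g U t N :=
  exists_genOver_of_isEffectiveCartier (isEffectiveCartier_comap_iff.2 h) U w hw

/-- Regularity comes for free: `t` divides the regular generators that exist locally. -/
theorem IsInv.genOver_of_dvd (h : IsInv T g) (le : N ≤ g ⁻¹ᵁ U.1) (ht : t ∈ T.ideal U)
    (dvd : ∀ x ∈ T.ideal U, pull g le t ∣ pull g le x) : GenOver T g U t N where
  le := le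
  mem := ht
  reg := by
    refine IsReg.of_local fun w hw => ?_
    obtain ⟨t', N', hw', h'⟩ := h.exists_genOver U w (le hw)
    have h'' := h'.mono (inf_le_left : N' ⊓ N ≤ N')
    refine ⟨N' ⊓ N, inf_le_right, ⟨hw', hw⟩, h''.reg.of_dvd ?_⟩
    rw [← resFun_pull g le inf_le_right]
    exact map_dvd _ (dvd t' h'.mem)
  dvd := dvd

/-- Divisibility survives pullback along any morphism. Regularity need not, and is recovered from
`hf`. -/
theorem GenOver.comp (h : GenOver T g U t N) {W' : Scheme.{u}} (f : W' ⟶ W)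
    (hf : IsInv T (f ≫ g)) {N' : W'.Opens} (k : N' ≤ f ⁻¹ᵁ N) : GenOver T (f ≫ g) U t N' :=
  hf.genOver_of_dvd (fun _ hx => h.le (k hx)) h.mem fun x hx => by
    rw [← pull_pull f g h.le k, ← pull_pull f g h.le k]
    exact map_dvd _ (h.dvd x hx)

theorem GenOver.comp_isOpenImmersion (h : GenOver T g U t N) {O : Scheme.{u}} (o : O ⟶ W)
    [IsOpenImmersion o] {N' : O.Opens} (k : N' ≤ o ⁻¹ᵁ N) : GenOver T (o ≫ g) U t N' where
  le := fun _ hx => h.le (k hx)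
  mem := h.mem
  reg := by
    rw [← pull_pull o g h.le k,
      isReg_pull_image o k (by rintro _ ⟨x, hx, rfl⟩; exact k hx)]
    exact h.reg.res _
  dvd x hx := by
    rw [← pull_pull o g h.le k, ← pull_pull o g h.le k]
    exact map_dvd _ (h.dvd x hx)

theorem GenOver.of_comp_isOpenImmersion {O : Scheme.{u}} (o : O ⟶ W) [IsOpenImmersion o]
    {N' : O.Opens} (h : GenOver T (o ≫ g) U t N') : GenOver T g U t (o ''ᵁ N') := by
  have le : o ''ᵁ N' ≤ g ⁻¹ᵁ U.1 := by rintro _ ⟨x, hx, rfl⟩; exact h.le hx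
  have k : N' ≤ o ⁻¹ᵁ (o ''ᵁ N') := fun x hx => ⟨x, hx, rfl⟩
  refine ⟨le, h.mem, ?_, fun x hx => ?_⟩
  · have := h.reg
    rw [← pull_pull o g le k, isReg_pull_image o k le_rfl, resFun_self] at this
    exact this
  · have := h.dvd x hx
    rw [← pull_pull o g le k, ← pull_pull o g le k] at this
    let e := RingEquiv.ofBijective (pull o k) (pull_image_bijective o N' k)
    exact (map_dvd_iff e).1 this

theorem IsInv.comp_isOpenImmersion (h : IsInv T g) {O : Scheme.{u}} (o : O ⟶ W)
    [IsOpenImmersion o] : IsInv T (o ≫ g) := fun w => by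
  obtain ⟨U, t, N, hw, hN⟩ := h (o w)
  exact ⟨U, t, o ⁻¹ᵁ N, hw, hN.comp_isOpenImmersion o le_rfl⟩

/-- If the pullback of `t` generates the inverse image of `T` after further pullback to `w'`, then
it does so near the image of `w'`. -/
theorem GenOver.exists_of_comp (h : IsInv T g) {W' : Scheme.{u}} (f : W' ⟶ W)
    (hf : IsInv T (f ≫ g)) {N' : W'.Opens} (ht : GenOver T (f ≫ g) U t N') {w' : W'}
    (hw' : w' ∈ N') : ∃ N : W.Opens, f w' ∈ N ∧ GenOver T g U t N := by
  -- Near `f w'` the ideal has a generator `s`, and `t = e * s`. After pullback `t` generates too,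
  -- so cancelling `s` shows that `e` becomes a unit. Hence `e` does not vanish at `f w'`, and `t`
  -- generates on the open set where `e` is invertible.
  obtain ⟨s, N, hwN, hN⟩ := h.exists_genOver U (f w') (ht.le hw')
  obtain ⟨e, he⟩ := hN.dvd t ht.mem
  let P : W'.Opens := N' ⊓ f ⁻¹ᵁ N
  have hs : GenOver T (f ≫ g) U s P := hN.comp f hf inf_le_right
  have ht' : GenOver T (f ≫ g) U t P := ht.mono inf_le_left
  obtain ⟨c, hc⟩ := ht'.dvd s hN.mem
  have h1 : pull (f ≫ g) ht'.le t = pull (f ≫ g) hs.le s * pull f (inf_le_right : P ≤ _) e := by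
    rw [← pull_pull f g hN.le inf_le_right, he, map_mul, pull_pull]
  rw [h1, mul_assoc] at hc
  have h2 : 1 = pull f (inf_le_right : P ≤ f ⁻¹ᵁ N) e * c :=
    (mul_cancel_left_mem_nonZeroDivisors hs.reg.mem).1 ((mul_one _).trans hc)
  have hu : IsUnit (pull f (inf_le_right : P ≤ f ⁻¹ᵁ N) e) := IsUnit.of_mul_eq_one _ h2.symm
  have hmem : f w' ∈ W.basicOpen e := by
    have h3 : w' ∈ W'.basicOpen (pull f (inf_le_right : P ≤ f ⁻¹ᵁ N) e) := by
      rw [Scheme.basicOpen_of_isUnit _ hu]; exact ⟨hw', hwN⟩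
    have h4 : pull f (inf_le_right : P ≤ f ⁻¹ᵁ N) e = resFun inf_le_right ((f.app N).hom e) := rfl
    rw [h4] at h3
    have h5 := (Scheme.basicOpen_res W' ((f.app N).hom e) (homOfLE _).op).le h3
    have h6 := h5.2
    rwa [← Scheme.preimage_basicOpen] at h6
  refine ⟨W.basicOpen e, hmem, (W.basicOpen_le e).trans hN.le, ht.mem, ?_, fun x hx => ?_⟩ <;>
    have hu : IsUnit (resFun (W.basicOpen_le e) e) := W.toRingedSpace.isUnit_res_basicOpen e
  · rw [← resFun_pull g hN.le (W.basicOpen_le e), he, map_mul]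
    exact (hN.reg.res _).of_dvd (hu.mul_right_dvd.2 dvd_rfl)
  · rw [← resFun_pull g hN.le (W.basicOpen_le e), ← resFun_pull g hN.le (W.basicOpen_le e), he,
      map_mul]
    exact hu.mul_right_dvd.2 (map_dvd _ (hN.dvd x hx))

end Generators

/-! ### The affine blow-up algebra. -/

section ChartAlgebra

variable {A : Type u} [CommRing A] (I : Ideal A) (t : A)

/-- The affine blow-up algebra `A[I/t]`. -/
noncomputable def chartAlg : Subalgebra A (Localization.Away t) :=
  Algebra.adjoin A {z | ∃ x ∈ I, algebraMap A _ t * z = algebraMap A _ x}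

theorem chartAlg_isUnit : IsUnit (algebraMap A (Localization.Away t) t) :=
  IsLocalization.Away.algebraMap_isUnit t

theorem chartAlg_dvd {x : A} (hx : x ∈ I) :
    algebraMap A (chartAlg I t) t ∣ algebraMap A (chartAlg I t) x := by
  obtain ⟨v, hv⟩ := (chartAlg_isUnit t).exists_right_inv
  have : algebraMap A _ t * (v * algebraMap A (Localization.Away t) x) = algebraMap A _ x := by
    rw [← mul_assoc, hv, one_mul]
  exact ⟨⟨_, Algebra.subset_adjoin ⟨x, hx, this⟩⟩, Subtype.ext this.symm⟩

theorem chartAlg_mem_nonZeroDivisors :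
    algebraMap A (chartAlg I t) t ∈ nonZeroDivisors (chartAlg I t) := by
  rw [mem_nonZeroDivisors_iff_right]
  intro b hb
  apply Subtype.ext
  have := congrArg Subtype.val hb
  exact (chartAlg_isUnit t).mul_left_eq_zero.1 this

variable {I t}

/-- Elements of `A[I/t]` are fractions `a / t ^ n` with `a ∈ I ^ n`; sums can be brought to a common
denominator of this shape because `t ∈ I`. -/
theorem chartAlg_exists_pow_mul (ht : t ∈ I) (b : chartAlg I t) :
    ∃ n : ℕ, ∃ a ∈ I ^ n, algebraMap A (chartAlg I t) t ^ n * b = algebraMap A _ a := by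
  suffices h : ∀ b ∈ chartAlg I t,
      ∃ n : ℕ, ∃ a ∈ I ^ n, algebraMap A (Localization.Away t) t ^ n * b = algebraMap A _ a by
    obtain ⟨n, a, ha, e⟩ := h b.1 b.2
    exact ⟨n, a, ha, Subtype.ext e⟩
  intro b hb
  induction hb using Algebra.adjoin_induction with
  | mem z hz =>
    obtain ⟨x, hx, e⟩ := hz
    exact ⟨1, x, by simpa using hx, by simpa using e⟩
  | algebraMap r => exact ⟨0, r, by simp, by simp⟩
  | add y z _ _ hy hz =>
    obtain ⟨n, a, ha, e⟩ := hy
    obtain ⟨m, c, hc, e'⟩ := hz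
    refine ⟨n + m, t ^ m * a + t ^ n * c, add_mem ?_ ?_, ?_⟩
    · rw [add_comm, pow_add]; exact Ideal.mul_mem_mul (Ideal.pow_mem_pow ht m) ha
    · rw [pow_add]; exact Ideal.mul_mem_mul (Ideal.pow_mem_pow ht n) hc
    · rw [map_add, map_mul, map_mul, map_pow, map_pow, ← e, ← e']; ring
  | mul y z _ _ hy hz =>
    obtain ⟨n, a, ha, e⟩ := hy
    obtain ⟨m, c, hc, e'⟩ := hz
    refine ⟨n + m, a * c, by rw [pow_add]; exact Ideal.mul_mem_mul ha hc, ?_⟩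
    rw [map_mul, ← e, ← e']; ring

/-- Since `φ t` is a non-zero-divisor, `R` embeds into its localisation at `φ t`. There the
generators `x / t` of the blow-up algebra go to the quotients given by `hd`, which lie in `R`. -/
theorem chartAlg_exists_lift {R : Type u} [CommRing R] (φ : A →+* R)
    (ht : φ t ∈ nonZeroDivisors R) (hd : ∀ x ∈ I, φ t ∣ φ x) :
    ∃ ψ : chartAlg I t →+* R, ψ.comp (algebraMap A _) = φ := by
  let R' := Localization.Away (φ t)
  let Λ : Localization.Away t →+* R' := Localization.awayMap φ t
  have hΛ : ∀ a, Λ (algebraMap A _ a) = algebraMap R R' (φ a) := fun a =>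
    IsLocalization.map_eq _ _
  have inj : Function.Injective (algebraMap R R') :=
    IsLocalization.injective (M := .powers (φ t)) R' (Submonoid.powers_le.2 ht)
  have hu : IsUnit (algebraMap R R' (φ t)) := IsLocalization.Away.algebraMap_isUnit _
  have key : ∀ b ∈ chartAlg I t, Λ b ∈ (algebraMap R R').range := by
    intro b hb
    induction hb using Algebra.adjoin_induction with
    | mem z hz =>
      obtain ⟨x, hx, e⟩ := hz
      obtain ⟨q, hq⟩ := hd x hx
      refine ⟨q, hu.mul_left_cancel ?_⟩
      rw [← map_mul, ← hq, ← hΛ, ← hΛ, ← map_mul, e]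
    | algebraMap r => exact ⟨φ r, (hΛ r).symm⟩
    | add y z _ _ hy hz => rw [map_add]; exact add_mem hy hz
    | mul y z _ _ hy hz => rw [map_mul]; exact mul_mem hy hz
  let e : R ≃+* (algebraMap R R').range :=
    RingEquiv.ofBijective (algebraMap R R').rangeRestrict
      ⟨fun a b h => inj (congrArg Subtype.val h), (algebraMap R R').rangeRestrict_surjective⟩
  refine ⟨e.symm.toRingHom.comp
    ((Λ.comp (chartAlg I t).val.toRingHom).codRestrict _ fun b => key b.1 b.2), ?_⟩
  ext a
  refine e.symm_apply_eq.2 (Subtype.ext ?_)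
  exact hΛ a

end ChartAlgebra

/-! ### The affine charts of a blow-up and their universal property. -/

section Chart

theorem top_le_preimage_top {W Y : Scheme.{u}} (g : W ⟶ Y) : (⊤ : W.Opens) ≤ g ⁻¹ᵁ ⊤ := le_rfl

theorem appLE_top {W Y : Scheme.{u}} (g : W ⟶ Y) (h : (⊤ : W.Opens) ≤ g ⁻¹ᵁ ⊤) :
    g.appLE ⊤ ⊤ h = g.appTop := by
  rw [Scheme.Hom.appTop, Scheme.Hom.app_eq_appLE]
  rfl

theorem pull_top {W Y : Scheme.{u}} (g : W ⟶ Y) (h : (⊤ : W.Opens) ≤ g ⁻¹ᵁ ⊤) :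
    pull g h = g.appTop.hom := congrArg CommRingCat.Hom.hom (appLE_top g h)

theorem toSpecΓ_map_appLE_fromSpec {W Y : Scheme.{u}} (g : W ⟶ Y) {U : Y.Opens}
    (hU : IsAffineOpen U) (h : ⊤ ≤ g ⁻¹ᵁ U) :
    W.toSpecΓ ≫ Spec.map (g.appLE U ⊤ h) ≫ hU.fromSpec = g := by
  let g' : W ⟶ U.toScheme := IsOpenImmersion.lift U.ι g (by
    rintro _ ⟨w, rfl⟩
    rw [Scheme.Opens.range_ι]
    exact h (Set.mem_univ w))
  have hg' : g' ≫ U.ι = g := IsOpenImmersion.lift_fac _ _ _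
  have e : g.appLE U ⊤ h = U.topIso.inv ≫ g'.appTop := by
    have h1 : U.topIso.inv = U.ι.appLE U ⊤ (by simp) := by simp [Scheme.Opens.ι_appLE]; rfl
    rw [h1, ← appLE_top g' (top_le_preimage_top g'), Scheme.Hom.appLE_comp_appLE]
    congr 1
    exact hg'.symm
  rw [e, Spec.map_comp, Category.assoc, ← Scheme.toSpecΓ_naturality_assoc]
  have := hU.toSpecΓ_fromSpec
  unfold Scheme.Opens.toSpecΓ at this
  rw [Category.assoc] at this
  rw [this, hg']

theorem top_le_preimage_fromSpec {Y : Scheme.{u}} (U : Y.affineOpens) :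
    ⊤ ≤ U.2.fromSpec ⁻¹ᵁ U.1 := by
  have : U.2.fromSpec ⁻¹ᵁ U.1 = ⊤ := U.2.fromSpec_preimage_self
  rw [this]

theorem pull_fromSpec {Y : Scheme.{u}} (U : Y.affineOpens) (h : ⊤ ≤ U.2.fromSpec ⁻¹ᵁ U.1)
    (a : Γ(Y, U)) : pull U.2.fromSpec h a = (Scheme.ΓSpecIso Γ(Y, U)).inv.hom a := by
  have e : U.2.fromSpec.app U.1 = _ := U.2.fromSpec_app_self
  have : U.2.fromSpec.appLE U.1 ⊤ h = (Scheme.ΓSpecIso Γ(Y, U)).inv := by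
    rw [Scheme.Hom.appLE, e, Category.assoc, ← Functor.map_comp]
    exact (congrArg _ ((Spec Γ(Y, U)).presheaf.map_id _)).trans (Category.comp_id _)
  exact congr($this a)

theorem pull_specMap {R S : CommRingCat.{u}} (φ : R ⟶ S)
    (h : (⊤ : (Spec S).Opens) ≤ Spec.map φ ⁻¹ᵁ ⊤) (a : R) :
    pull (Spec.map φ) h ((Scheme.ΓSpecIso R).inv.hom a) = (Scheme.ΓSpecIso S).inv.hom (φ.hom a) := by
  rw [pull_top]
  exact congr($(Scheme.ΓSpecIso_inv_naturality φ) a).symm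

theorem pull_specMap_fromSpec {Y : Scheme.{u}} (U : Y.affineOpens) {S : CommRingCat.{u}}
    (φ : Γ(Y, U) ⟶ S) (h : ⊤ ≤ (Spec.map φ ≫ U.2.fromSpec) ⁻¹ᵁ U.1) (a : Γ(Y, U)) :
    pull (Spec.map φ ≫ U.2.fromSpec) h a = (Scheme.ΓSpecIso S).inv.hom (φ.hom a) := by
  have := pull_pull (Spec.map φ) U.2.fromSpec (top_le_preimage_fromSpec U)
    (top_le_preimage_top _) a
  rw [pull_fromSpec, pull_specMap] at this
  exact this.symm

variable {Y : Scheme.{u}} (T : Y.IdealSheafData) (U : Y.affineOpens) (t : Γ(Y, U))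

/-- The ring `A[T/t]` of an affine chart of the blow-up along `T`. -/
noncomputable def chartRing : CommRingCat.{u} := .of (chartAlg (T.ideal U) t)

/-- The structure map of `A[T/t]`. -/
noncomputable def chartRingMap : Γ(Y, U) ⟶ chartRing T U t :=
  CommRingCat.ofHom (algebraMap Γ(Y, U) (chartAlg (T.ideal U) t))

theorem chartRingMap_dvd {x : Γ(Y, U)} (hx : x ∈ T.ideal U) :
    (chartRingMap T U t).hom t ∣ (chartRingMap T U t).hom x :=
  chartAlg_dvd (T.ideal U) t hx

theorem chartRingMap_mem_nonZeroDivisors :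
    (chartRingMap T U t).hom t ∈ nonZeroDivisors (chartRing T U t) :=
  chartAlg_mem_nonZeroDivisors (T.ideal U) t

variable {t} in
theorem chartRing_exists_pow_mul (ht : t ∈ T.ideal U) (b : chartRing T U t) :
    ∃ n : ℕ, ∃ a ∈ T.ideal U ^ n,
      (chartRingMap T U t).hom t ^ n * b = (chartRingMap T U t).hom a :=
  chartAlg_exists_pow_mul ht b

theorem chartRing_exists_lift {R : CommRingCat.{u}} (φ : Γ(Y, U) ⟶ R)
    (ht : φ.hom t ∈ nonZeroDivisors R) (hd : ∀ x ∈ T.ideal U, φ.hom t ∣ φ.hom x) :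
    ∃ ψ : chartRing T U t ⟶ R, chartRingMap T U t ≫ ψ = φ := by
  obtain ⟨ψ, hψ⟩ := chartAlg_exists_lift (I := T.ideal U) φ.hom ht hd
  exact ⟨CommRingCat.ofHom ψ, CommRingCat.hom_ext hψ⟩

/-- The affine chart `Spec A[T/t]` of the blow-up along `T`. -/
noncomputable abbrev chart : Scheme.{u} := Spec (chartRing T U t)

/-- The structure morphism of a chart of the blow-up. -/
noncomputable def chartMap : chart T U t ⟶ Y := Spec.map (chartRingMap T U t) ≫ U.2.fromSpec

theorem chartMap_le : ⊤ ≤ chartMap T U t ⁻¹ᵁ U.1 :=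
  fun _ _ => top_le_preimage_fromSpec U trivial

theorem pull_chartMap (h : ⊤ ≤ chartMap T U t ⁻¹ᵁ U.1) (a : Γ(Y, U)) :
    pull (chartMap T U t) h a =
      (Scheme.ΓSpecIso (chartRing T U t)).inv.hom ((chartRingMap T U t).hom a) :=
  pull_specMap_fromSpec U (chartRingMap T U t) h a

variable {t}

theorem genOver_chartMap (ht : t ∈ T.ideal U) : GenOver T (chartMap T U t) U t ⊤ where
  le := chartMap_le T U t
  mem := ht
  reg := by
    refine isReg_of_isAffineOpen (isAffineOpen_top _) ?_
    rw [pull_chartMap]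
    let e := (Scheme.ΓSpecIso (chartRing T U t)).symm.commRingCatIsoToRingEquiv
    exact (MulEquivClass.map_nonZeroDivisors e).le
      ⟨_, chartRingMap_mem_nonZeroDivisors T U t, rfl⟩
  dvd x hx := by
    rw [pull_chartMap, pull_chartMap]
    exact map_dvd _ (chartRingMap_dvd T U t hx)

theorem isInv_chartMap (ht : t ∈ T.ideal U) : IsInv T (chartMap T U t) :=
  fun _ => ⟨U, t, ⊤, trivial, genOver_chartMap T U ht⟩

theorem exists_lift_chartMap {W : Scheme.{u}} {g : W ⟶ Y} (h : GenOver T g U t ⊤) :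
    ∃ f : W ⟶ chart T U t, f ≫ chartMap T U t = g := by
  obtain ⟨ψ, hψ⟩ := chartRing_exists_lift T U t (g.appLE U ⊤ h.le) h.reg.mem h.dvd
  refine ⟨W.toSpecΓ ≫ Spec.map ψ, ?_⟩
  unfold chartMap
  rw [Category.assoc, ← Spec.map_comp_assoc, hψ]
  exact toSpecΓ_map_appLE_fromSpec g U.2 h.le

/-- A function `b` on the chart satisfies `t ^ n * b = a` with `a` coming from `Y`. As the pullback
of `t` to `W` is regular, the pullback of `b` is determined by those of `t` and `a`. -/
theorem chartMap_hom_ext (ht : t ∈ T.ideal U) {W : Scheme.{u}} {f₁ f₂ : W ⟶ chart T U t}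
    (h : IsInv T (f₁ ≫ chartMap T U t)) (e : f₁ ≫ chartMap T U t = f₂ ≫ chartMap T U t) :
    f₁ = f₂ := by
  apply ext_of_isAffine
  have hg : GenOver T (f₁ ≫ chartMap T U t) U t ⊤ :=
    (genOver_chartMap T U ht).comp f₁ h (top_le_preimage_top f₁)
  let e := (Scheme.ΓSpecIso (chartRing T U t)).symm.commRingCatIsoToRingEquiv
  have hA : ∀ a, f₁.appTop.hom (e ((chartRingMap T U t).hom a)) =
      pull (f₁ ≫ chartMap T U t) hg.le a := fun a => by
    rw [← pull_pull f₁ (chartMap T U t) (chartMap_le T U t) (top_le_preimage_top f₁), pull_top,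
      pull_chartMap]
    rfl
  have hA' : ∀ a, f₂.appTop.hom (e ((chartRingMap T U t).hom a)) =
      pull (f₁ ≫ chartMap T U t) hg.le a := fun a => by
    rw [pull_congr ‹_›, ← pull_pull f₂ (chartMap T U t) (chartMap_le T U t)
      (top_le_preimage_top f₂), pull_top, pull_chartMap]
    rfl
  ext b
  obtain ⟨b, rfl⟩ := e.surjective b
  obtain ⟨n, a, -, hn⟩ := chartRing_exists_pow_mul T U ht b
  have h1 := congrArg e hn
  rw [map_mul, map_pow] at h1
  have h2 := congrArg f₁.appTop.hom h1
  have h3 := congrArg f₂.appTop.hom h1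
  rw [map_mul, map_pow, hA, hA] at h2
  rw [map_mul, map_pow, hA', hA', ← h2] at h3
  exact ((mul_cancel_left_mem_nonZeroDivisors (pow_mem hg.reg.mem n)).1 h3).symm

end Chart

/-! ### Construction of the blow-up by gluing charts. -/

section BlowUp

open Limits

variable {Y : Scheme.{u}} (T : Y.IdealSheafData)

/-- The index set of the charts of the blow-up. -/
abbrev ChartIndex : Type u := Σ U : Y.affineOpens, T.ideal U

variable {T}

namespace ChartIndex

variable (i j k : ChartIndex T)

/-- The chart belonging to an index. -/
noncomputable abbrev obj : Scheme.{u} := chart T i.1 i.2.1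

/-- The structure morphism of a chart. -/
noncomputable abbrev map : i.obj ⟶ Y := chartMap T i.1 i.2.1

theorem isInv_map : IsInv T i.map := isInv_chartMap T i.1 i.2.2

theorem hom_ext {W : Scheme.{u}} {f₁ f₂ : W ⟶ i.obj} (h : IsInv T (f₁ ≫ i.map))
    (e : f₁ ≫ i.map = f₂ ≫ i.map) : f₁ = f₂ :=
  chartMap_hom_ext T i.1 i.2.2 h e

/-- The part of the chart `i` which also lies in the chart `j`. -/
noncomputable def overlap : i.obj.Opens :=
  sSup {N | GenOver T i.map j.1 j.2.1 N}

theorem genOver_overlap : GenOver T i.map j.1 j.2.1 (overlap i j) := by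
  refine GenOver.of_local j.2.2 fun w hw => ?_
  obtain ⟨N, hN, hwN⟩ := Opens.mem_sSup.1 hw
  exact ⟨N, hwN, hN⟩

theorem overlap_self : overlap i i = ⊤ :=
  top_le_iff.1 (le_sSup (genOver_chartMap T i.1 i.2.2))

theorem isIso_ι_overlap_self : IsIso (overlap i i).ι :=
  have : Epi (overlap i i).ι.base := by
    refine (TopCat.epi_iff_surjective _).2 fun x => ⟨⟨x, ?_⟩, rfl⟩
    rw [overlap_self]
    trivial
  IsOpenImmersion.isIso _

variable {i j}

theorem exists_lift_of_mem {W : Scheme.{u}} {f : W ⟶ i.obj} (h : IsInv T (f ≫ i.map))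
    (hf : ∀ w, f w ∈ overlap i j) : ∃ f' : W ⟶ j.obj, f' ≫ j.map = f ≫ i.map :=
  exists_lift_chartMap T j.1 ((genOver_overlap i j).comp f h (N' := ⊤) fun w _ => hf w)

/-- Over the chart `j` its own section generates the inverse image of `T`, and
`GenOver.exists_of_comp` carries this to a neighbourhood of `f w` in the chart `i`. With
`exists_lift_of_mem` this characterises the overlap by morphisms on whose source `T` is invertible,
which is all that the gluing needs. -/
theorem mem_overlap {W : Scheme.{u}} {f : W ⟶ i.obj} (h : IsInv T (f ≫ i.map))
    (f' : W ⟶ j.obj) (e : f' ≫ j.map = f ≫ i.map) (w : W) : f w ∈ overlap i j := by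
  have h' : GenOver T (f ≫ i.map) j.1 j.2.1 ⊤ := by
    rw [← e] at h ⊢
    exact (genOver_chartMap T j.1 j.2.2).comp f' h (top_le_preimage_top f')
  obtain ⟨N, hw, hN⟩ := GenOver.exists_of_comp i.isInv_map f h h' (w' := w) trivial
  exact (le_sSup (α := i.obj.Opens) hN : N ≤ _) hw

variable (i j)

theorem isInv_overlap : IsInv T ((overlap i j).ι ≫ i.map) :=
  i.isInv_map.comp_isOpenImmersion _

theorem exists_transition : ∃ f : (overlap i j).toScheme ⟶ (overlap j i).toScheme,
    f ≫ (overlap j i).ι ≫ j.map = (overlap i j).ι ≫ i.map := by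
  obtain ⟨f, hf⟩ := exists_lift_of_mem (isInv_overlap i j) fun w => w.2
  have hmem := mem_overlap (j := i) (f := f) (hf ▸ isInv_overlap i j) _ hf.symm
  refine ⟨IsOpenImmersion.lift (overlap j i).ι f ?_, ?_⟩
  · rw [Scheme.Opens.range_ι]
    rintro _ ⟨w, rfl⟩
    exact hmem w
  · rw [IsOpenImmersion.lift_fac_assoc, hf]

/-- The transition map between charts. -/
noncomputable def transition : (overlap i j).toScheme ⟶ (overlap j i).toScheme :=
  (exists_transition i j).choose

theorem transition_map :
    transition i j ≫ (overlap j i).ι ≫ j.map = (overlap i j).ι ≫ i.map :=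
  (exists_transition i j).choose_spec

/-- Like the cocycle condition below, this is an instance of `hom_ext`: both sides agree over `Y`,
and `T` is invertible on the source. -/
theorem transition_self : transition i i = 𝟙 _ := by
  rw [← cancel_mono (overlap i i).ι]
  refine i.hom_ext ?_ ?_
  · rw [Category.assoc, transition_map]; exact isInv_overlap i i
  · rw [Category.assoc, transition_map, Category.id_comp]

/-- The triple overlap seen in the chart `i`. -/
noncomputable abbrev triple : Scheme.{u} := pullback (overlap i j).ι (overlap i k).ι

theorem isInv_triple : IsInv T (pullback.fst (overlap i j).ι (overlap i k).ι ≫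
    (overlap i j).ι ≫ i.map) :=
  (isInv_overlap i j).comp_isOpenImmersion _

theorem exists_tripleTransition : ∃ f : triple i j k ⟶ triple j k i,
    f ≫ pullback.snd _ _ = pullback.fst _ _ ≫ transition i j := by
  have hP := isInv_triple i j k
  have e1 : (pullback.fst (overlap i j).ι (overlap i k).ι ≫ transition i j ≫
      (overlap j i).ι) ≫ j.map = pullback.fst _ _ ≫ (overlap i j).ι ≫ i.map := by
    simp only [Category.assoc, transition_map]
  have e2 : (pullback.snd (overlap i j).ι (overlap i k).ι ≫ transition i k ≫
      (overlap k i).ι) ≫ k.map = pullback.fst _ _ ≫ (overlap i j).ι ≫ i.map := by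
    simp only [Category.assoc, transition_map]
    rw [← pullback.condition_assoc]
  have hmem := mem_overlap (j := k) (f := pullback.fst (overlap i j).ι (overlap i k).ι ≫
    transition i j ≫ (overlap j i).ι) (e1 ▸ hP) _ (e2.trans e1.symm)
  refine ⟨pullback.lift (IsOpenImmersion.lift (overlap j k).ι (pullback.fst _ _ ≫
    transition i j ≫ (overlap j i).ι) ?_) (pullback.fst _ _ ≫ transition i j) ?_, ?_⟩
  · rw [Scheme.Opens.range_ι]
    rintro _ ⟨w, rfl⟩
    exact hmem w
  · rw [IsOpenImmersion.lift_fac, Category.assoc]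
  · rw [pullback.lift_snd]

/-- The transition map between triple overlaps. -/
noncomputable def tripleTransition : triple i j k ⟶ triple j k i :=
  (exists_tripleTransition i j k).choose

theorem tripleTransition_snd :
    tripleTransition i j k ≫ pullback.snd _ _ = pullback.fst _ _ ≫ transition i j :=
  (exists_tripleTransition i j k).choose_spec

theorem tripleTransition_map :
    tripleTransition i j k ≫ pullback.fst _ _ ≫ (overlap j k).ι ≫ j.map =
      pullback.fst _ _ ≫ (overlap i j).ι ≫ i.map := by
  rw [pullback.condition_assoc, ← Category.assoc, tripleTransition_snd, Category.assoc,
    transition_map]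

theorem tripleTransition_cocycle :
    tripleTransition i j k ≫ tripleTransition j k i ≫ tripleTransition k i j = 𝟙 _ := by
  rw [← cancel_mono (pullback.fst _ _), ← cancel_mono (overlap i j).ι]
  refine i.hom_ext ?_ ?_
  · simp only [Category.assoc, tripleTransition_map]
    exact isInv_triple i j k
  · simp only [Category.assoc, tripleTransition_map, Category.id_comp]

end ChartIndex

variable (T)

open ChartIndex

/-- The gluing data for the blow-up along `T`. -/
noncomputable def blowUpGlueData : Scheme.GlueData.{u} where
  J := ChartIndex T
  U i := i.obj
  V p := (overlap p.1 p.2).toScheme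
  f i j := (overlap i j).ι
  f_id i := isIso_ι_overlap_self i
  t i j := transition i j
  t_id i := transition_self i
  t' i j k := tripleTransition i j k
  t_fac i j k := tripleTransition_snd i j k
  cocycle i j k := tripleTransition_cocycle i j k
  f_open i j := inferInstanceAs (IsOpenImmersion (overlap i j).ι)

/-- The blow-up along `T`. -/
noncomputable def blowUp : Scheme.{u} := (blowUpGlueData T).glued

variable {T} in
/-- The inclusion of a chart into the blow-up. -/
noncomputable def ChartIndex.incl (i : ChartIndex T) : i.obj ⟶ blowUp T := (blowUpGlueData T).ι i

instance (i : ChartIndex T) : IsOpenImmersion i.incl :=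
  Scheme.GlueData.ι_isOpenImmersion (blowUpGlueData T) i

variable {T} in
theorem ChartIndex.exists_incl_eq (x : blowUp T) : ∃ (i : ChartIndex T) (y : i.obj), i.incl y = x :=
  (blowUpGlueData T).ι_jointly_surjective x

variable {T} in
theorem ChartIndex.glue_condition (i j : ChartIndex T) :
    transition i j ≫ (overlap j i).ι ≫ j.incl = (overlap i j).ι ≫ i.incl :=
  (blowUpGlueData T).glue_condition i j

/-- The structure morphism of the blow-up. -/
noncomputable def blowUpMap : blowUp T ⟶ Y :=
  Multicoequalizer.desc (blowUpGlueData T).diagram Y (fun i => ChartIndex.map i) (by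
    rintro ⟨i, j⟩
    refine (transition_map i j).symm.trans ?_
    rw [← Category.assoc]
    rfl)

variable {T} in
theorem ChartIndex.incl_blowUpMap (i : ChartIndex T) : i.incl ≫ blowUpMap T = i.map :=
  Multicoequalizer.π_desc _ _ _ _ _

theorem isInv_blowUpMap : IsInv T (blowUpMap T) := by
  intro x
  obtain ⟨i, y, rfl⟩ := exists_incl_eq x
  refine ⟨i.1, i.2.1, i.incl ''ᵁ ⊤, ⟨y, trivial, rfl⟩, GenOver.of_comp_isOpenImmersion i.incl ?_⟩
  rw [incl_blowUpMap]
  exact genOver_chartMap T i.1 i.2.2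

variable {T}

/-- A morphism which has a unique lift over every open subset exists globally if it exists
locally. -/
theorem exists_unique_lift_of_local {E W : Scheme.{u}} (f : E ⟶ Y) (g : W ⟶ Y)
    (uniq : ∀ (O : Scheme.{u}) (o : O ⟶ W) [IsOpenImmersion o] (a b : O ⟶ E),
      a ≫ f = o ≫ g → b ≫ f = o ≫ g → a = b)
    (loc : ∀ w : W, ∃ N : W.Opens, w ∈ N ∧ ∃ a : N.toScheme ⟶ E, a ≫ f = N.ι ≫ g) :
    ∃! a : W ⟶ E, a ≫ f = g := by
  choose N hN a ha using loc
  let 𝒰 := W.openCoverOfIsOpenCover N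
    (Opens.ext (Set.eq_univ_of_forall fun w => Opens.mem_iSup.2 ⟨w, hN w⟩))
  let a' : ∀ x : 𝒰.I₀, 𝒰.X x ⟶ E := a
  have ha' : ∀ x : 𝒰.I₀, a' x ≫ f = 𝒰.f x ≫ g := ha
  have hf : ∀ x y, pullback.fst (𝒰.f x) (𝒰.f y) ≫ a' x = pullback.snd (𝒰.f x) (𝒰.f y) ≫ a' y := by
    intro x y
    refine uniq _ (pullback.fst (𝒰.f x) (𝒰.f y) ≫ 𝒰.f x) _ _ ?_ ?_
    · rw [Category.assoc, ha', Category.assoc]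
    · rw [Category.assoc, ha', pullback.condition, Category.assoc]
  refine ⟨Scheme.Cover.glueMorphisms 𝒰 a' hf, ?_, fun b hb => ?_⟩
  · refine Scheme.Cover.hom_ext 𝒰 _ _ fun x => ?_
    rw [Scheme.Cover.ι_glueMorphisms_assoc]
    exact ha' x
  · refine Scheme.Cover.hom_ext 𝒰 _ _ fun x => ?_
    rw [Scheme.Cover.ι_glueMorphisms]
    refine uniq _ (𝒰.f x) _ _ ?_ (ha' x)
    rw [Category.assoc, hb]

/-- Locally `f₁` factors through a chart `i` as `a`, and `f₂` through a chart `j` as `b`. Since `b`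
agrees with `a` over `Y`, the map `a` lands in the overlap with `j`; its transition to `j` equals
`b` by uniqueness in a chart, and the gluing condition identifies the two in the blow-up. -/
theorem blowUp_hom_ext {W : Scheme.{u}} {f₁ f₂ : W ⟶ blowUp T} (h : IsInv T (f₁ ≫ blowUpMap T))
    (e : f₁ ≫ blowUpMap T = f₂ ≫ blowUpMap T) : f₁ = f₂ := by
  have key : ∀ w : W, ∃ N : W.Opens, w ∈ N ∧ N.ι ≫ f₁ = N.ι ≫ f₂ := by
    intro w
    obtain ⟨i, y, hy⟩ := exists_incl_eq (f₁ w)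
    obtain ⟨j, z, hz⟩ := exists_incl_eq (f₂ w)
    let N : W.Opens := f₁ ⁻¹ᵁ i.incl.opensRange ⊓ f₂ ⁻¹ᵁ j.incl.opensRange
    refine ⟨N, ⟨⟨y, hy⟩, ⟨z, hz⟩⟩, ?_⟩
    let a : N.toScheme ⟶ i.obj := IsOpenImmersion.lift i.incl (N.ι ≫ f₁) (by
      rintro _ ⟨x, rfl⟩; exact x.2.1)
    let b : N.toScheme ⟶ j.obj := IsOpenImmersion.lift j.incl (N.ι ≫ f₂) (by
      rintro _ ⟨x, rfl⟩; exact x.2.2)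
    have ha : a ≫ i.incl = N.ι ≫ f₁ := IsOpenImmersion.lift_fac _ _ _
    have hb : b ≫ j.incl = N.ι ≫ f₂ := IsOpenImmersion.lift_fac _ _ _
    have ha' : a ≫ i.map = N.ι ≫ f₁ ≫ blowUpMap T := by
      rw [← incl_blowUpMap, ← Category.assoc, ha, Category.assoc]
    have hb' : b ≫ j.map = N.ι ≫ f₁ ≫ blowUpMap T := by
      rw [← incl_blowUpMap, ← Category.assoc, hb, Category.assoc, e]
    have hinv : IsInv T (N.ι ≫ f₁ ≫ blowUpMap T) := h.comp_isOpenImmersion _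
    have hmem := mem_overlap (j := j) (f := a) (ha'.symm ▸ hinv) b (hb'.trans ha'.symm)
    let c : N.toScheme ⟶ (overlap i j).toScheme := IsOpenImmersion.lift (overlap i j).ι a (by
      rw [Scheme.Opens.range_ι]
      rintro _ ⟨w, rfl⟩
      exact hmem w)
    have hc : c ≫ (overlap i j).ι = a := IsOpenImmersion.lift_fac _ _ _
    have hcb : c ≫ transition i j ≫ (overlap j i).ι = b := by
      have e1 : (c ≫ transition i j ≫ (overlap j i).ι) ≫ j.map = N.ι ≫ f₁ ≫ blowUpMap T := by
        rw [Category.assoc, Category.assoc, transition_map, ← Category.assoc, hc, ha']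
      exact j.hom_ext (e1.symm ▸ hinv) (e1.trans hb'.symm)
    rw [← ha, ← hb, ← hc, ← hcb]
    simp only [Category.assoc, glue_condition]
  choose N hN hf using key
  exact Scheme.Cover.hom_ext (W.openCoverOfIsOpenCover N
    (Opens.ext (Set.eq_univ_of_forall fun w => Opens.mem_iSup.2 ⟨w, hN w⟩))) _ _ hf

variable (T) in
/-- Blow-ups exist. -/
theorem isBlowUp_blowUpMap : IsBlowUp T (blowUpMap T) where
  cartier := isEffectiveCartier_comap_iff.2 (isInv_blowUpMap T)
  lift W g hg := by
    rw [isEffectiveCartier_comap_iff] at hg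
    refine exists_unique_lift_of_local _ _ (fun O o _ a b ha hb => ?_) fun w => ?_
    · exact blowUp_hom_ext (ha.symm ▸ hg.comp_isOpenImmersion o) (ha.trans hb.symm)
    · obtain ⟨U, t, N, hw, hN⟩ := hg w
      have h' : GenOver T (N.ι ≫ g) U t ⊤ := hN.comp_isOpenImmersion N.ι (by simp)
      obtain ⟨a, ha⟩ := exists_lift_chartMap T U h'
      let i : ChartIndex T := ⟨U, t, hN.mem⟩
      refine ⟨N, hw, a ≫ i.incl, ?_⟩
      rw [Category.assoc, incl_blowUpMap]
      exact ha

end BlowUp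

theorem exists_affineOpens_le {Y : Scheme.{u}} {U : Y.Opens} {y : Y} (hy : y ∈ U) :
    ∃ V : Y.affineOpens, y ∈ V.1 ∧ V.1 ≤ U := by
  obtain ⟨V, hV, hyV, hVU⟩ := Opens.isBasis_iff_nbhd.1 Y.isBasis_affineOpens hy
  exact ⟨⟨V, hV⟩, hyV, hVU⟩

theorem isAffineOpen_coe {Y : Scheme.{u}} (U : Y.affineOpens) : IsAffineOpen U.1 := U.2

/-! ### Sections of quasi-coherent modules killed by powers of a function. -/

section Quasicoherent

theorem eq_zero_of_locally {X : Scheme.{u}} {M : X.Modules} {U : X.Opens} (m : Γ(M, U))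
    (h : ∀ x ∈ U, ∃ (V : X.Opens) (k : V ≤ U), x ∈ V ∧ res k m = 0) : m = 0 := by
  choose! V hV hx hm using h
  refine TopCat.Sheaf.eq_of_locally_eq' ⟨M.presheaf, M.isSheaf⟩ (fun x : U => V x) U
    (fun x => homOfLE (hV x x.2))
    (fun x hxU => Opens.mem_iSup.2 ⟨⟨x, hxU⟩, hx x hxU⟩) m 0 fun x => ?_
  exact (hm x x.2).trans (map_zero (res (hV x x.2))).symm

/-- A section of a quasi-coherent sheaf over an affine open which vanishes where `f` is invertible
is killed by a power of `f`. -/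
theorem exists_pow_smul_eq_zero_of_isAffineOpen {X : Scheme.{u}} (M : X.Modules)
    [M.IsQuasicoherent] {V : X.Opens} (hV : IsAffineOpen V) (f : Γ(X, V)) (m : Γ(M, V))
    (hm : res (X.basicOpen_le f) m = 0) : ∃ k : ℕ, f ^ k • m = 0 := by
  -- Moved to `Spec Γ(X, V)`, the sheaf is associated with its module of global sections, so
  -- restriction to the locus of `f` is localisation at the powers of `f`.
  let M' : (Spec Γ(X, V)).Modules := (Scheme.Modules.restrictFunctor hV.fromSpec).obj M
  have : M'.IsQuasicoherent := Scheme.Modules.isQuasicoherent_restrictFunctor hV.fromSpec M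
  have hiso : IsIso M'.fromTildeΓ := Scheme.Modules.isIso_fromTildeΓ_of_isQuasicoherent M'
  have hloc := (isIso_fromTildeΓ_iff_isLocalizing M').1 hiso f
  have htop : hV.fromSpec ''ᵁ ⊤ = V := by
    rw [Scheme.Hom.image_top_eq_opensRange]
    exact hV.opensRange_fromSpec
  have hle : hV.fromSpec ''ᵁ ⊤ ≤ V := htop.le
  have hle' : V ≤ hV.fromSpec ''ᵁ ⊤ := htop.ge
  let m' : Γ(M', ⊤) := res (G := M) hle m
  have hD : hV.fromSpec ''ᵁ (PrimeSpectrum.basicOpen f) ≤ X.basicOpen f :=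
    (hV.fromSpec_image_basicOpen f).le
  have h0 : ((modulesSpecToSheaf.obj M').obj.map (PrimeSpectrum.basicOpen f).leTop.op).hom m' =
      ((modulesSpecToSheaf.obj M').obj.map (PrimeSpectrum.basicOpen f).leTop.op).hom 0 := by
    rw [map_zero]
    change res (G := M) (Scheme.Hom.image_mono hV.fromSpec le_top) (res (G := M) hle m) = 0
    rw [res_res, ← res_res (X.basicOpen_le f) hD, hm, map_zero]
  obtain ⟨⟨_, k, rfl⟩, hk⟩ := hloc.exists_of_eq h0
  refine ⟨k, ?_⟩
  have h1 : (f ^ k) • m' = 0 := hk.trans (smul_zero _)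
  -- The scalars of `Γ(X, V)` act on `M'` through the identification with global functions on the
  -- spectrum; this is matched with the action on `M` itself.
  have h2 : (f ^ k) • m' = res (G := M) hle ((f ^ k) • m) := by
    rw [res_smul, Scheme.Modules.smul_Spec_def]
    have e : ∀ a : Γ(X, V), resFun hle a = (hV.fromSpec.appIso ⊤).inv.hom
        (((Spec Γ(X, V)).presheaf.map (Opens.leTop ⊤).op).hom
          ((Scheme.ΓSpecIso Γ(X, V)).inv.hom a)) := by
      intro a
      have e1 : resFun hle a = (hV.fromSpec.appIso ⊤).inv.hom
          (pull hV.fromSpec (top_le_preimage_fromSpec ⟨V, hV⟩) a) :=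
        congr($(Scheme.Hom.appLE_appIso_inv hV.fromSpec (top_le_preimage_fromSpec ⟨V, hV⟩)) a).symm
      rw [e1]
      refine congrArg _ ?_
      refine (pull_fromSpec ⟨V, hV⟩ _ a).trans ?_
      exact (resFun_self le_top _).symm
    rw [e]
    rfl
  rw [h2] at h1
  have h3 := congrArg (res (G := M) hle') h1
  rw [res_res, res_self] at h3
  exact h3.trans (map_zero (res hle'))

/-- A section of a quasi-coherent sheaf over a quasi-compact open which vanishes where `f` is
invertible is killed by a power of `f`. -/
theorem exists_pow_smul_eq_zero {X : Scheme.{u}} (M : X.Modules)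
    [M.IsQuasicoherent] {V : X.Opens} (hV : IsCompact (V : Set X)) (f : Γ(X, V)) (m : Γ(M, V))
    (hm : res (X.basicOpen_le f) m = 0) : ∃ k : ℕ, f ^ k • m = 0 := by
  have key : ∀ x ∈ V, ∃ (W : X.Opens) (h : W ≤ V) (k : ℕ), x ∈ W ∧ res h (f ^ k • m) = 0 := by
    intro x hx
    obtain ⟨W, hxW, hWV⟩ := exists_affineOpens_le hx
    have hle : X.basicOpen (resFun hWV f) ≤ X.basicOpen f := by
      have : X.basicOpen (resFun hWV f) = _ := X.basicOpen_res f (homOfLE hWV).op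
      rw [this]; exact inf_le_right
    obtain ⟨k, hk⟩ := exists_pow_smul_eq_zero_of_isAffineOpen M (isAffineOpen_coe W) (resFun hWV f)
      (res hWV m) (by
        rw [res_res, ← res_res (X.basicOpen_le f) hle, hm, map_zero])
    exact ⟨W.1, hWV, k, hxW, by rw [res_smul, map_pow, hk]⟩
  choose! W hW k hx hk using key
  obtain ⟨t, ht⟩ := hV.elim_finite_subcover (fun x : V => (W x : Set X)) (fun x => (W x).2)
    fun x hxV => Set.mem_iUnion.2 ⟨⟨x, hxV⟩, hx x hxV⟩
  refine ⟨t.sup fun x => k x, eq_zero_of_locally _ fun x hxV => ?_⟩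
  obtain ⟨y, hyt, hxy⟩ := Set.mem_iUnion₂.1 (ht hxV)
  refine ⟨W y, hW y y.2, hxy, ?_⟩
  obtain ⟨c, hc⟩ := Nat.exists_eq_add_of_le (Finset.le_sup (f := fun x : V => k x) hyt)
  rw [hc, add_comm, pow_add, mul_smul, res_smul, hk y y.2, smul_zero]

end Quasicoherent

/-! ### The complement of a family of effective Cartier divisors. -/

section Complement

/-- The spectrum of a ring over an affine open misses a closed subscheme if its ideal becomes the
unit ideal. -/
theorem notMem_support_of_map_eq_top {Y : Scheme.{u}} (D : Y.IdealSheafData) (U : Y.affineOpens)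
    {R : CommRingCat.{u}} (φ : Γ(Y, U) ⟶ R) (h : (D.ideal U).map φ.hom = ⊤) (w : Spec R) :
    (Spec.map φ ≫ U.2.fromSpec) w ∉ D.support := by
  intro hw
  have hle : ⊤ ≤ (Spec.map φ ≫ U.2.fromSpec) ⁻¹ᵁ U.1 := fun _ _ =>
    top_le_preimage_fromSpec U trivial
  have hwU : (Spec.map φ ≫ U.2.fromSpec) w ∈ U.1 := hle trivial
  rw [Scheme.IdealSheafData.mem_support_iff_of_mem hwU] at hw
  have : (D.ideal U).map φ.hom ≤ w.asIdeal := by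
    refine Ideal.map_le_iff_le_comap.2 fun a ha => ?_
    have h1 := (Scheme.mem_zeroLocus_iff _ _ _).1 hw a ha
    by_contra h2
    refine h1 ?_
    have h3 : (isAffineOpen_coe U).fromSpec ⁻¹ᵁ Y.basicOpen a = PrimeSpectrum.basicOpen a :=
      (isAffineOpen_coe U).fromSpec_preimage_basicOpen a
    have h4 : Spec.map φ w ∈ (isAffineOpen_coe U).fromSpec ⁻¹ᵁ Y.basicOpen a := h3 ▸ h2
    exact h4
  rw [h] at this
  exact w.isPrime.ne_top (top_le_iff.1 this)

variable {X Y : Scheme.{u}} {Z : Set Y.IdealSheafData} {j : X ⟶ Y}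

theorem IsComplement.mono (hj : IsComplement Z j) : Mono j where
  right_cancellation g h e := by
    obtain ⟨_, _, hu⟩ := hj.lift _ (g ≫ j) fun w D hD => by
      rw [Scheme.Hom.comp_apply]; exact hj.notMem _ D hD
    rw [hu g rfl, hu h e.symm]

theorem IsEffectiveCartier.fg {D : Y.IdealSheafData} (hD : IsEffectiveCartier D)
    (U : Y.affineOpens) : (D.ideal U).FG := by
  refine ideal_fg_of_local D (fun y => ?_) U
  obtain ⟨V, hy, t, -, hV⟩ := hD y
  exact ⟨V, hy, {t}, by rw [hV]; simp⟩

/-- The ideal of an effective Cartier divisor near a point, in the stalk. -/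
theorem IsEffectiveCartier.exists_germ {D : Y.IdealSheafData} (hD : IsEffectiveCartier D)
    (y : Y) : ∃ (U : Y.affineOpens) (hy : y ∈ U.1) (t : Γ(Y, U)), t ∈ D.ideal U ∧
      Y.presheaf.germ U.1 y hy t ∈ nonZeroDivisors (Y.presheaf.stalk y) := by
  obtain ⟨U, hy, t, ht, hU⟩ := hD y
  refine ⟨U, hy, t, hU ▸ Ideal.mem_span_singleton_self t, ?_⟩
  let := TopCat.Presheaf.algebra_section_stalk Y.presheaf (⟨y, hy⟩ : U.1)
  have := U.2.isLocalization_stalk ⟨y, hy⟩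
  exact IsLocalization.map_nonZeroDivisors_le (U.2.primeIdealOf ⟨y, hy⟩).asIdeal.primeCompl _
    ⟨t, ht, rfl⟩

theorem specMap_germ_fromSpec {y : Y} {Q : CommRingCat.{u}} (q : Y.presheaf.stalk y ⟶ Q)
    (V : Y.affineOpens) (hyV : y ∈ V.1) :
    Spec.map (Y.presheaf.germ V.1 y hyV ≫ q) ≫ (isAffineOpen_coe V).fromSpec =
      Spec.map q ≫ Y.fromSpecStalk y := by
  rw [← (isAffineOpen_coe V).fromSpecStalk_eq_fromSpecStalk hyV, Spec.map_comp, Category.assoc]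
  rfl

/-- Local equations of Cartier divisors become units in the total ring of fractions of a stalk, so
its spectrum misses `Z`. Since the stalk embeds in this ring, a function that vanishes on `X` has
zero germs on `Y`. -/
theorem IsComplement.exists_lift_totalFractions (hj : IsComplement Z j)
    (hZ : ∀ D ∈ Z, IsEffectiveCartier D) (y : Y) :
    ∃ h : Spec (.of (Localization (nonZeroDivisors (Y.presheaf.stalk y)))) ⟶ X,
      h ≫ j = Spec.map (CommRingCat.ofHom (algebraMap (Y.presheaf.stalk y)
        (Localization (nonZeroDivisors (Y.presheaf.stalk y))))) ≫ Y.fromSpecStalk y := by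
  refine (hj.lift _ _ fun w D hD => ?_).exists
  obtain ⟨V, hyV, t, ht, htn⟩ := (hZ D hD).exists_germ y
  rw [← specMap_germ_fromSpec _ V hyV]
  refine notMem_support_of_map_eq_top D V _ ?_ w
  refine Ideal.eq_top_of_isUnit_mem _ (Ideal.mem_map_of_mem _ ht) ?_
  exact IsLocalization.map_units (Localization (nonZeroDivisors (Y.presheaf.stalk y))) ⟨_, htn⟩

theorem germ_eq_zero_of_specMap {y : Y} {Q : CommRingCat.{u}} (q : Y.presheaf.stalk y ⟶ Q)
    (hq : Function.Injective q.hom) (V : Y.affineOpens) (hyV : y ∈ V.1) (h : Spec Q ⟶ X)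
    (hh : h ≫ j = Spec.map q ≫ Y.fromSpecStalk y) (s : Γ(Y, V))
    (hs : pull j (le_refl (j ⁻¹ᵁ V.1)) s = 0) : (Y.presheaf.germ V.1 y hyV).hom s = 0 := by
  have e := hh.trans (specMap_germ_fromSpec q V hyV).symm
  have hle : ⊤ ≤ (Spec.map (Y.presheaf.germ V.1 y hyV ≫ q) ≫ (isAffineOpen_coe V).fromSpec) ⁻¹ᵁ
    V.1 := fun _ _ => top_le_preimage_fromSpec V trivial
  have hle' : ⊤ ≤ h ⁻¹ᵁ j ⁻¹ᵁ V.1 := by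
    have : ⊤ ≤ (h ≫ j) ⁻¹ᵁ V.1 := e ▸ hle
    exact this
  have h1 := pull_specMap_fromSpec V (Y.presheaf.germ V.1 y hyV ≫ q) hle s
  have h3 : pull (Spec.map (Y.presheaf.germ V.1 y hyV ≫ q) ≫ (isAffineOpen_coe V).fromSpec) hle s
      = 0 := by
    rw [pull_congr e.symm hle, ← pull_pull h j le_rfl hle', hs, map_zero]
  have h4 : (Scheme.ΓSpecIso Q).inv.hom ((Y.presheaf.germ V.1 y hyV ≫ q).hom s) = 0 :=
    h1.symm.trans h3
  refine hq ?_
  rw [map_zero]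
  refine (ConcreteCategory.bijective_of_isIso (Scheme.ΓSpecIso Q).inv).1 ?_
  exact h4.trans (map_zero (Scheme.ΓSpecIso Q).inv.hom).symm

/-- Functions on `Y` are determined by their restrictions to the complement of effective Cartier
divisors. -/
theorem IsComplement.pull_injective (hj : IsComplement Z j) (hZ : ∀ D ∈ Z, IsEffectiveCartier D)
    (U : Y.Opens) : Function.Injective (pull j (le_refl (j ⁻¹ᵁ U))) := by
  rw [injective_iff_map_eq_zero]
  intro s hs
  refine eq_of_locally_eq _ _ fun y hy => ?_
  obtain ⟨h, hh⟩ := hj.exists_lift_totalFractions hZ y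
  obtain ⟨V, hyV, hVU⟩ := exists_affineOpens_le hy
  have hlej : j ⁻¹ᵁ V.1 ≤ j ⁻¹ᵁ U := fun x hx => hVU hx
  have h5 := germ_eq_zero_of_specMap _
    (IsLocalization.injective (Localization (nonZeroDivisors (Y.presheaf.stalk y))) le_rfl)
    V hyV h hh (resFun hVU s) (by
      rw [pull_resFun, ← resFun_pull j le_rfl hlej, hs, map_zero])
  rw [← map_zero (Y.presheaf.germ V.1 y hyV).hom] at h5
  obtain ⟨W, hyW, i₁, i₂, hW⟩ := TopCat.Presheaf.germ_eq Y.presheaf y hyV hyV _ _ h5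
  refine ⟨W, i₁.le.trans hVU, hyW, ?_⟩
  have hW' : resFun i₁.le (resFun hVU s) = resFun i₂.le 0 := hW
  rw [← resFun_resFun hVU i₁.le, hW', map_zero, map_zero]

/-- In each component `u b` is `1` where `φ b` is non-zero and `0` elsewhere, so the product of the
`1 - u b` over the generators vanishes. Modulo the extended ideal that product is `1`. Finite
generation is what allows the product to be formed. -/
theorem map_eq_top_of_forall_ne_zero {A : Type*} [CommRing A] {ι : Type*} {K : ι → Type*}
    [∀ i, Field (K i)] {I : Ideal A} (hI : I.FG) (φ : A →+* ∀ i, K i)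
    (h : ∀ i, ∃ a ∈ I, φ a i ≠ 0) : I.map φ = ⊤ := by
  obtain ⟨s, rfl⟩ := hI
  rw [Ideal.eq_top_iff_one]
  let u : A → ∀ i, K i := fun b => φ b * fun i => (φ b i)⁻¹
  have hu : ∀ b ∈ s, u b ∈ (Ideal.span (s : Set A)).map φ := fun b hb =>
    Ideal.mul_mem_right _ _ (Ideal.mem_map_of_mem _ (Ideal.subset_span hb))
  have h0 : ∏ b ∈ s, (1 - u b) = 0 := by
    funext i
    rw [Finset.prod_apply]
    obtain ⟨b, hb, hbi⟩ : ∃ b ∈ s, φ b i ≠ 0 := by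
      by_contra! hs
      obtain ⟨a, ha, hai⟩ := h i
      have : Ideal.span (s : Set A) ≤ RingHom.ker ((Pi.evalRingHom K i).comp φ) :=
        Ideal.span_le.2 fun b hb => hs b hb
      exact hai (this ha)
    exact Finset.prod_eq_zero hb (by simp [u, mul_inv_cancel₀ hbi])
  rw [← Ideal.Quotient.eq_zero_iff_mem, ← map_zero (Ideal.Quotient.mk _), ← h0, map_prod, map_one]
  refine (Finset.prod_eq_one fun b hb => ?_).symm
  rw [map_sub, Ideal.Quotient.eq_zero_iff_mem.2 (hu b hb), map_one, sub_zero]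

/-- The preimage of an affine open in the complement is quasi-compact. -/
theorem IsComplement.isCompact_preimage (hj : IsComplement Z j)
    (hZ : ∀ D ∈ Z, IsEffectiveCartier D) (U : Y.affineOpens) :
    IsCompact ((j ⁻¹ᵁ U.1 : X.Opens) : Set X) := by
  have hxU : ∀ x : (j ⁻¹ᵁ U.1 : X.Opens), j x.1 ∈ U.1 := fun x => x.2
  let κ : (j ⁻¹ᵁ U.1 : X.Opens) → Type u := fun x => X.residueField x.1
  -- The spectrum of the product of the residue fields at all points of `j⁻¹ U` misses `Z`, because
  -- the ideals of the divisors are finitely generated and non-zero in each factor. It therefore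
  -- lifts to `X`. The image of this affine scheme is all of `j⁻¹ U`, which is thus quasi-compact.
  let R : CommRingCat.{u} := .of (∀ x, κ x)
  let q : ∀ x : (j ⁻¹ᵁ U.1 : X.Opens), Y.presheaf.stalk (j x.1) ⟶ X.residueField x.1 := fun x =>
    j.stalkMap x.1 ≫ X.residue x.1
  let φ : Γ(Y, U) ⟶ R := CommRingCat.ofHom
    (RingHom.pi fun x => (Y.presheaf.germ U.1 (j x.1) (hxU x) ≫ q x).hom)
  let p : ∀ x : (j ⁻¹ᵁ U.1 : X.Opens), R ⟶ X.residueField x.1 := fun x =>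
    CommRingCat.ofHom (Pi.evalRingHom κ x)
  have hp : ∀ x, φ ≫ p x = Y.presheaf.germ U.1 (j x.1) (hxU x) ≫ q x := fun x => rfl
  have hmap : ∀ D ∈ Z, (D.ideal U).map φ.hom = ⊤ := by
    intro D hD
    refine map_eq_top_of_forall_ne_zero ((hZ D hD).fg U) φ.hom fun x => ?_
    have hx := hj.notMem x.1 D hD
    rw [Scheme.IdealSheafData.mem_support_iff_of_mem (U := U) x.2, Scheme.mem_zeroLocus_iff] at hx
    push Not at hx
    obtain ⟨a, ha, hxa⟩ := hx
    refine ⟨a, ha, ?_⟩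
    have h1 : x.1 ∈ X.basicOpen (j.app U.1 a) := by
      rw [← Scheme.preimage_basicOpen]; exact hxa
    have h2 := (X.evaluation_ne_zero_iff_mem_basicOpen x.1 x.2 _).2 h1
    have h3 : Y.presheaf.germ U.1 (j x.1) (hxU x) ≫ q x = j.app U.1 ≫ X.evaluation _ x.1 x.2 := by
      rw [← X.germ_residue, ← Category.assoc, ← Category.assoc, Scheme.Hom.germ_stalkMap]
    have h4 : φ.hom a x = X.evaluation (j ⁻¹ᵁ U.1) x.1 x.2 (j.app U.1 a) :=
      congr($h3 a)
    rw [h4]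
    exact h2
  obtain ⟨h, hh, -⟩ := hj.lift (Spec R) (Spec.map φ ≫ (isAffineOpen_coe U).fromSpec)
    fun w D hD => notMem_support_of_map_eq_top D U _ (hmap D hD) w
  have hx : ∀ x, Spec.map (p x) ≫ h = X.fromSpecResidueField x.1 := by
    intro x
    have := hj.mono
    rw [← cancel_mono j, Category.assoc, hh, ← Category.assoc, ← Spec.map_comp, hp,
      specMap_germ_fromSpec, Spec.map_comp, Category.assoc, Scheme.SpecMap_stalkMap_fromSpecStalk,
      Scheme.fromSpecResidueField, Category.assoc]
  have hr : ((j ⁻¹ᵁ U.1 : X.Opens) : Set X) = Set.range h := by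
    refine Set.Subset.antisymm (fun x hxU => ?_) ?_
    · obtain ⟨z⟩ : Nonempty (Spec (X.residueField x)) := inferInstance
      refine ⟨Spec.map (p ⟨x, hxU⟩) z, ?_⟩
      rw [← Scheme.Hom.comp_apply, hx]
      exact X.fromSpecResidueField_apply x z
    · rintro _ ⟨w, rfl⟩
      have : (h ≫ j) w ∈ U.1 := by
        rw [hh]
        have hle : ⊤ ≤ (Spec.map φ ≫ (isAffineOpen_coe U).fromSpec) ⁻¹ᵁ U.1 := fun _ _ =>
          top_le_preimage_fromSpec U trivial
        exact hle trivial
      exact this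
  rw [hr]
  exact isCompact_range h.continuous

end Complement

/-! ### Generators of a subsheaf over an open set. -/

section GeneratedOn

variable {Y : Scheme.{u}} {G : Y.Modules}

/-- A subsheaf is generated over `U` by a set of sections over `U`. -/
structure GeneratedOn (N : Subsheaf G) (U : Y.Opens) (F : Set Γ(G, U)) : Prop where
  subset : ∀ b ∈ F, b ∈ N.carrier U
  le : ∀ V ≤ U, N.carrier V ≤ (Subsheaf.span (Subsheaf.fromOpen U F)).carrier V

variable {N P : Subsheaf G} {U V : Y.Opens} {F : Set Γ(G, U)}

theorem Subsheaf.IsFiniteType.exists_generatedOn (hN : N.IsFiniteType) (x : Y) :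
    ∃ U : Y.Opens, x ∈ U ∧ ∃ F : Set Γ(G, U), F.Finite ∧ GeneratedOn N U F := by
  obtain ⟨U, hx, F, hF, h1, h2⟩ := hN x
  exact ⟨U, hx, F, hF, h1, h2⟩

theorem Subsheaf.le_of_locally
    (h : ∀ y : Y, ∃ U : Y.Opens, y ∈ U ∧ ∀ V ≤ U, N.carrier V ≤ P.carrier V) : N ≤ P := by
  intro V m hm
  refine P.glue m fun x hx => ?_
  obtain ⟨U, hxU, hU⟩ := h x
  exact ⟨V ⊓ U, inf_le_left, ⟨hx, hxU⟩, hU _ inf_le_right (N.res_mem _ hm)⟩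

theorem span_fromOpen_le (hF : ∀ b ∈ F, b ∈ P.carrier U) :
    Subsheaf.span (Subsheaf.fromOpen U F) ≤ P := by
  refine Subsheaf.span_le.2 ?_
  rintro V _ ⟨h, b, hb, rfl⟩
  exact P.res_mem h (hF b hb)

theorem GeneratedOn.carrier_le (h : GeneratedOn N U F) (hF : ∀ b ∈ F, b ∈ P.carrier U)
    (hV : V ≤ U) : N.carrier V ≤ P.carrier V :=
  (h.le V hV).trans (span_fromOpen_le hF V)

theorem GeneratedOn.res (h : GeneratedOn N U F) (hV : V ≤ U) :
    GeneratedOn N V (IntegralClosure.res hV '' F) where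
  subset := by
    rintro _ ⟨b, hb, rfl⟩
    exact N.res_mem hV (h.subset b hb)
  le W hW m hm := by
    refine Subsheaf.mem_of_mem_span _ ?_ (h.le W (hW.trans hV) hm)
    rintro A A' hA k _ ⟨hA', b, hb, rfl⟩
    rw [res_res, ← res_res hV (hA.trans hW)]
    exact Subsheaf.res_mem _ _ (Subsheaf.subset_span ⟨le_rfl, _, ⟨b, hb, rfl⟩, (res_self _ _).symm⟩)

theorem GeneratedOn.mono (h : GeneratedOn N U F) {F' : Set Γ(G, U)} (hF : F ⊆ F')
    (hF' : ∀ b ∈ F', b ∈ N.carrier U) : GeneratedOn N U F' where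
  subset := hF'
  le _ hW := h.carrier_le (fun b hb => Subsheaf.subset_span
    ⟨le_rfl, b, hF hb, (res_self _ _).symm⟩) hW

theorem preSpan_fromOpen_le (hV : V ≤ U) :
    Subsheaf.preSpan (Subsheaf.fromOpen U F) V ≤ Submodule.span _ (res hV '' F) := by
  refine Submodule.span_le.2 ?_
  rintro _ ⟨W, k, _, ⟨h, b, hb, rfl⟩, rfl⟩
  rw [res_res]
  exact Submodule.subset_span ⟨b, hb, rfl⟩

theorem GeneratedOn.exists_mem_span (h : GeneratedOn N U F) (hV : V ≤ U) {m : Γ(G, V)}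
    (hm : m ∈ N.carrier V) {x : Y} (hx : x ∈ V) : ∃ (W : Y.Opens) (k : W ≤ V), x ∈ W ∧
      IntegralClosure.res k m ∈ Submodule.span Γ(Y, W) (IntegralClosure.res (k.trans hV) '' F) := by
  obtain ⟨W, k, hxW, hW⟩ := h.le V hV hm x hx
  exact ⟨W, k, hxW, preSpan_fromOpen_le _ hW⟩

theorem res_mem_span {W : Y.Opens} (hV : V ≤ U) (hW : W ≤ V) {m : Γ(G, V)}
    (hm : m ∈ Submodule.span Γ(Y, V) (res hV '' F)) :
    res hW m ∈ Submodule.span Γ(Y, W) (res (hW.trans hV) '' F) := by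
  induction hm using Submodule.span_induction with
  | mem x hx =>
    obtain ⟨b, hb, rfl⟩ := hx
    rw [res_res]
    exact Submodule.subset_span ⟨b, hb, rfl⟩
  | zero => rw [map_zero]; exact zero_mem _
  | add x y _ _ hx hy => rw [map_add]; exact add_mem hx hy
  | smul a x _ hx => rw [res_smul]; exact Submodule.smul_mem _ _ hx

end GeneratedOn

/-! ### Fractional ideals given by ideals of functions. -/

section Ideals

variable {X Y : Scheme.{u}} {j : X ⟶ Y} {M : X.Modules} {U V : Y.Opens}

theorem act_smul_oneSec (r : Γ(Y, U)) (m : Γ(push j M, U)) :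
    act j M (r • oneSec j U) m = r • m := by
  rw [map_smul, LinearMap.smul_apply, oneSec_act]

theorem res_smul_oneSec (h : V ≤ U) (r : Γ(Y, U)) :
    res h (r • oneSec j U) = resFun h r • oneSec j V := by
  rw [res_smul, res_oneSec]

theorem GeneratedOn.prod {S : Subsheaf (push j (strSheaf X))} {N : Subsheaf (push j M)}
    {A : Set Γ(push j (strSheaf X), U)} {B : Set Γ(push j M, U)} (hS : GeneratedOn S U A)
    (hN : GeneratedOn N U B) :
    GeneratedOn (prod S N) U (Set.image2 (fun s n => act j M s n) A B) where
  subset := by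
    rintro _ ⟨s, hs, n, hn, rfl⟩
    exact act_mem_prod (hS.subset s hs) (hN.subset n hn)
  le W hW m hm := by
    refine Subsheaf.mem_of_mem_span _ ?_ hm
    rintro W' W'' h k _ ⟨s, hs, n, hn, rfl⟩
    rw [res_act]
    refine act_mem_of_span _ ?_ (hS.le W' (h.trans hW) (S.res_mem k hs))
      (hN.le W' (h.trans hW) (N.res_mem k hn))
    rintro A A₁ A₂ hA k₁ k₂ _ ⟨h₁, b, hb, rfl⟩ _ ⟨h₂, c, hc, rfl⟩
    have hAU : A ≤ U := (hA.trans h).trans hW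
    rw [res_res, res_res, ← res_act]
    exact Subsheaf.res_mem _ hAU
      (Subsheaf.subset_span ⟨le_rfl, _, ⟨b, hb, c, hc, rfl⟩, (res_self _ _).symm⟩)

/-- A fractional ideal is given over `U` by an ideal of functions. -/
def IsIdealOn (S : Subsheaf (push j (strSheaf X))) (U : Y.Opens) (I : Ideal Γ(Y, U)) : Prop :=
  GeneratedOn S U {m | ∃ a ∈ I, m = a • oneSec j U}

theorem IsIdealOn.prod {S S' : Subsheaf (push j (strSheaf X))} {I I' : Ideal Γ(Y, U)}
    (h : IsIdealOn S U I) (h' : IsIdealOn S' U I') :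
    IsIdealOn (IntegralClosure.prod S S') U (I * I') := by
  refine (GeneratedOn.prod h h').mono ?_ ?_
  · rintro _ ⟨_, ⟨a, ha, rfl⟩, _, ⟨b, hb, rfl⟩, rfl⟩
    exact ⟨a * b, Ideal.mul_mem_mul ha hb, (act_smul_oneSec a _).trans (mul_smul a b _).symm⟩
  · rintro _ ⟨c, hc, rfl⟩
    induction hc using Submodule.mul_induction_on' with
    | mem_mul_mem a ha b hb =>
      rw [mul_smul, ← act_smul_oneSec]
      exact act_mem_prod (h.subset _ ⟨a, ha, rfl⟩) (h'.subset _ ⟨b, hb, rfl⟩)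
    | add x _ y _ hx hy => rw [add_smul]; exact add_mem hx hy

theorem isIdealOn_one (j : X ⟶ Y) (U : Y.Opens) : IsIdealOn (1 : Frac j (strSheaf X)).1 U ⊤ where
  subset := by
    rintro _ ⟨a, -, rfl⟩
    exact Submodule.smul_mem _ _ (Subsheaf.subset_span rfl)
  le V hV := by
    intro m hm
    refine Subsheaf.mem_of_mem_span _ ?_ hm
    rintro V' W h k _ rfl
    rw [res_oneSec, ← res_oneSec j (h.trans hV)]
    exact Subsheaf.res_mem _ _ (Subsheaf.subset_span ⟨le_rfl, oneSec j U, ⟨1, trivial,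
      (one_smul _ _).symm⟩, (res_self _ _).symm⟩)

theorem IsIdealOn.pow {S : Frac j (strSheaf X)} {I : Ideal Γ(Y, U)} (h : IsIdealOn S.1 U I)
    (n : ℕ) : IsIdealOn (S ^ n).1 U (I ^ n) := by
  induction n with
  | zero => rw [pow_zero, pow_zero, Ideal.one_eq_top]; exact isIdealOn_one j U
  | succ n ih => rw [pow_succ, pow_succ]; exact ih.prod h

theorem isIdealOn_multiset_prod {ι : Type*} (S : ι → Frac j (strSheaf X))
    (I : ι → Ideal Γ(Y, U)) (s : Multiset ι) (h : ∀ i ∈ s, IsIdealOn (S i).1 U (I i)) :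
    IsIdealOn (s.map S).prod.1 U (s.map I).prod := by
  induction s using Multiset.induction_on with
  | empty => simpa using isIdealOn_one j U
  | cons a s ih =>
    rw [Multiset.map_cons, Multiset.prod_cons, Multiset.map_cons, Multiset.prod_cons]
    exact (h a (Multiset.mem_cons_self a s)).prod
      (ih fun i hi => h i (Multiset.mem_cons_of_mem hi))

theorem IsIdealOn.carrier_le {S S' : Subsheaf (push j (strSheaf X))} {I I' : Ideal Γ(Y, U)}
    (h : IsIdealOn S U I) (h' : IsIdealOn S' U I') (hI : I ≤ I') (hV : V ≤ U) :
    S.carrier V ≤ S'.carrier V := by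
  refine GeneratedOn.carrier_le h ?_ hV
  rintro _ ⟨a, ha, rfl⟩
  exact h'.subset _ ⟨a, hI ha, rfl⟩

variable (j) in
/-- The subsheaf of `j_* 𝒪_X` generated by an ideal sheaf on `Y`. -/
noncomputable def idealSubsheaf (T : Y.IdealSheafData) : Subsheaf (push j (strSheaf X)) :=
  Subsheaf.span fun U => {m | ∃ (hU : IsAffineOpen U), ∃ a ∈ T.ideal ⟨U, hU⟩, m = a • oneSec j U}

theorem resFun_mem_ideal (T : Y.IdealSheafData) {U V : Y.affineOpens} (h : V.1 ≤ U.1)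
    {a : Γ(Y, U)} (ha : a ∈ T.ideal U) : resFun h a ∈ T.ideal V :=
  T.ideal_le_comap_ideal h ha

theorem isIdealOn_idealSubsheaf (T : Y.IdealSheafData) (U : Y.affineOpens) :
    IsIdealOn (idealSubsheaf j T) U.1 (T.ideal U) where
  subset := by
    rintro _ ⟨a, ha, rfl⟩
    exact Subsheaf.subset_span ⟨U.2, a, ha, rfl⟩
  le V hV m hm := by
    refine Subsheaf.mem_of_mem_span _ ?_ hm
    rintro V' W h k _ ⟨hW, d, hd, rfl⟩
    refine Subsheaf.glue _ _ fun x hx => ?_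
    obtain ⟨B, hxB, hB⟩ := exists_affineOpens_le hx
    refine ⟨B.1, hB, hxB, ?_⟩
    have hBU : B.1 ≤ U.1 := (hB.trans h).trans hV
    rw [res_res, res_smul_oneSec]
    have hd' : resFun (hB.trans k) d ∈ T.ideal B :=
      resFun_mem_ideal T (U := ⟨W, hW⟩) (hB.trans k) hd
    -- On the affine `B` inside both `U` and `W` the ideal is extended from `U`, so a section from
    -- `W` becomes a combination of sections from `U`.
    have e : (T.ideal U).map (resFun hBU) = T.ideal B := T.map_ideal (U := B) (V := U) hBU
    rw [← e] at hd'
    generalize resFun (hB.trans k) d = c at hd'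
    induction hd' using Submodule.span_induction with
    | mem c hc =>
      obtain ⟨a, ha, rfl⟩ := hc
      rw [← res_smul_oneSec]
      exact Subsheaf.res_mem _ _ (Subsheaf.subset_span ⟨le_rfl, _, ⟨a, ha, rfl⟩,
        (res_self _ _).symm⟩)
    | zero => rw [zero_smul]; exact zero_mem _
    | add x y _ _ hx hy => rw [add_smul]; exact add_mem hx hy
    | smul a x _ hx => rw [smul_assoc]; exact Submodule.smul_mem _ _ hx

theorem isFiniteType_idealSubsheaf (j : X ⟶ Y) (T : Y.IdealSheafData)
    (hT : ∀ U : Y.affineOpens, (T.ideal U).FG) :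
    (idealSubsheaf j T).IsFiniteType := by
  intro y
  obtain ⟨U, hy, -⟩ := exists_affineOpens_le (U := (⊤ : Y.Opens)) (y := y) trivial
  obtain ⟨s, hs⟩ := hT U
  have h := isIdealOn_idealSubsheaf (j := j) T U
  refine ⟨U.1, hy, (fun a => a • oneSec j U.1) '' (s : Set Γ(Y, U)), s.finite_toSet.image _, ?_, fun V hV => ?_⟩
  · rintro _ ⟨a, ha, rfl⟩
    exact h.subset _ ⟨a, hs ▸ Ideal.subset_span ha, rfl⟩
  · refine GeneratedOn.carrier_le h ?_ hV
    rintro _ ⟨a, ha, rfl⟩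
    rw [← hs] at ha
    induction ha using Submodule.span_induction with
    | mem c hc => exact Subsheaf.subset_span ⟨le_rfl, _, ⟨c, hc, rfl⟩, (res_self _ _).symm⟩
    | zero => rw [zero_smul]; exact zero_mem _
    | add x y _ _ hx hy => rw [add_smul]; exact add_mem hx hy
    | smul a x _ hx => rw [smul_assoc]; exact Submodule.smul_mem _ _ hx

/-- The fractional ideal generated by a finite type ideal sheaf on `Y`. -/
noncomputable def idealFrac (j : X ⟶ Y) (T : Y.IdealSheafData)
    (hT : ∀ U : Y.affineOpens, (T.ideal U).FG) : Frac j (strSheaf X) :=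
  ⟨idealSubsheaf j T, isFiniteType_idealSubsheaf j T hT⟩

theorem idealFrac_le_one (T : Y.IdealSheafData) (hT : ∀ U : Y.affineOpens, (T.ideal U).FG) :
    idealFrac j T hT ≤ 1 := by
  refine Subsheaf.le_of_locally fun y => ?_
  obtain ⟨U, hy, -⟩ := exists_affineOpens_le (U := (⊤ : Y.Opens)) (y := y) trivial
  exact ⟨U.1, hy, fun V hV => (isIdealOn_idealSubsheaf T U).carrier_le (isIdealOn_one j U.1)
    le_top hV⟩

end Ideals

/-! ### Two lemmas on products of ideals. -/

section Products

variable {A : Type*} [CommRing A]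

/-- Among the ideals that contain no product of the `J i`, a maximal one is prime: if it contained
`a * b` but neither factor, the two enlarged ideals would contain products, and multiplying these
gives a product in the original ideal. Zorn's lemma applies because the products are finitely
generated, so one contained in the union of a chain is contained in a member. -/
theorem exists_multiset_prod_le {ι : Type*} (J : ι → Ideal A) (hJ : ∀ i, (J i).FG) (I : Ideal A)
    (h : ∀ P : Ideal A, P.IsPrime → I ≤ P → ∃ i, J i ≤ P) :
    ∃ s : Multiset ι, (s.map J).prod ≤ I := by
  by_contra hI
  have hfg : ∀ s : Multiset ι, (s.map J).prod.FG := by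
    intro s
    induction s using Multiset.induction_on with
    | empty => simpa using Ideal.fg_top A
    | cons a s ih =>
      rw [Multiset.map_cons, Multiset.prod_cons]
      exact (hJ a).mul ih
  obtain ⟨P, hIP, hP⟩ := zorn_le_nonempty₀ {K : Ideal A | ¬ ∃ s : Multiset ι, (s.map J).prod ≤ K}
    (fun c hc hchain K hK => by
      refine ⟨sSup c, ?_, fun z hz => le_sSup hz⟩
      rintro ⟨s, hs⟩
      have hcomp := (Submodule.fg_iff_compact _).1 (hfg s)
      obtain ⟨L, hL, hsL⟩ := (CompleteLattice.isCompactElement_iff_le_of_directed_sSup_le _ _).1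
        hcomp c ⟨K, hK⟩ hchain.directedOn hs
      exact hc hL ⟨s, hsL⟩) I hI
  have hprime : P.IsPrime := by
    refine ⟨fun htop => hP.1 ⟨0, htop ▸ le_top⟩, fun {a b} hab => ?_⟩
    by_contra! hne
    have key : ∀ a, a ∉ P → ∃ s : Multiset ι, (s.map J).prod ≤ P ⊔ Ideal.span {a} := by
      intro a ha
      by_contra hn
      exact ha (hP.le_of_ge (y := P ⊔ Ideal.span {a}) hn le_sup_left
        (Ideal.mem_sup_right (Ideal.mem_span_singleton_self a)))
    obtain ⟨s, hs⟩ := key a hne.1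
    obtain ⟨t, ht⟩ := key b hne.2
    refine hP.1 ⟨s + t, ?_⟩
    rw [Multiset.map_add, Multiset.prod_add]
    refine (Ideal.mul_mono hs ht).trans ?_
    rw [Ideal.sup_mul, Ideal.mul_sup (Ideal.span {a}), Ideal.span_singleton_mul_span_singleton]
    exact sup_le Ideal.mul_le_left (sup_le Ideal.mul_le_right
      ((Ideal.span_singleton_le_iff_mem P).2 hab))
  obtain ⟨i, hi⟩ := h P hprime hIP
  exact hP.1 ⟨{i}, by simpa using hi⟩

/-- By the pigeonhole principle, a product of more than `s.card * K` generators repeats one of them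
at least `K` times. -/
theorem span_pow_le_of_card_mul_lt {s : Finset A} {K n : ℕ} (hn : s.card * K < n) {I : Ideal A}
    (hI : I = Ideal.span (s : Set A)) :
    I ^ n ≤ Ideal.span {a | ∃ t ∈ s, ∃ b ∈ I ^ (n - K), a = b * t ^ K} := by
  subst hI
  rw [Ideal.span, Submodule.span_pow]
  refine Submodule.span_mono fun a ha => ?_
  obtain ⟨f, hf, rfl⟩ := Set.mem_pow_iff_prod.1 ha
  classical
  obtain ⟨t, ht, hK⟩ := Finset.exists_lt_card_fiber_of_mul_lt_card_of_maps_to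
    (s := (Finset.univ : Finset (Fin n))) (t := s) (f := f) (n := K) (fun i _ => hf i)
    (by simpa using hn)
  obtain ⟨B, hB, hcard⟩ := Finset.exists_subset_card_eq hK.le
  refine ⟨t, ht, ∏ i ∈ Bᶜ, f i, ?_, ?_⟩
  · have h := Ideal.prod_mem_prod (s := Bᶜ) (I := fun _ => Ideal.span (s : Set A)) (x := f)
      fun i _ => Ideal.subset_span (hf i)
    rwa [Finset.prod_const, Finset.card_compl, hcard, Fintype.card_fin] at h
  · rw [← Finset.prod_compl_mul_prod B, ← hcard]
    refine congrArg _ (Finset.prod_eq_pow_card fun i hi => ?_)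
    exact (Finset.mem_filter.1 (hB hi)).2

end Products

/-! ### Scalars on a pushforward and non-vanishing loci. -/

section PushSections

variable {X Y : Scheme.{u}} (j : X ⟶ Y) (M : X.Modules) {U : Y.Opens}

theorem push_smul (r : Γ(Y, U)) (m : Γ(push j M, U)) :
    r • m = HSMul.hSMul (α := Γ(X, j ⁻¹ᵁ U)) (β := Γ(M, j ⁻¹ᵁ U))
      (pull j (le_refl (j ⁻¹ᵁ U)) r) m := by
  have e : pull j (le_refl (j ⁻¹ᵁ U)) r = j.app U r := by
    have : j.appLE U (j ⁻¹ᵁ U) le_rfl = j.app U := Scheme.Hom.app_eq_appLE j |>.symm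
    exact congr($this r)
  rw [e]
  rfl

theorem smul_oneSec_eq (r : Γ(Y, U)) :
    r • oneSec j U = (pull j (le_refl (j ⁻¹ᵁ U)) r : Γ(X, j ⁻¹ᵁ U)) := by
  rw [push_smul]
  exact mul_one (M := Γ(X, j ⁻¹ᵁ U)) _

theorem isUnit_of_forall_mem_basicOpen {X : Scheme.{u}} {V : X.Opens} (f : Γ(X, V))
    (h : V ≤ X.basicOpen f) : IsUnit f := by
  have h1 := X.toRingedSpace.isUnit_res_basicOpen f
  have h2 := h1.map (resFun h)
  have h3 : resFun h (resFun (X.basicOpen_le f) f) = f := by rw [resFun_resFun, resFun_self]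
  rw [← h3]
  exact h2

theorem mem_basicOpen_pull {x : X} {V : X.Opens} (h : V ≤ j ⁻¹ᵁ U) (hx : x ∈ V) (f : Γ(Y, U)) :
    x ∈ X.basicOpen (pull j h f) ↔ j x ∈ Y.basicOpen f := by
  have e : X.basicOpen (pull j h f) = V ⊓ j ⁻¹ᵁ Y.basicOpen f := Scheme.basicOpen_appLE _ _ _ _ _
  rw [e]
  exact ⟨fun h => h.2, fun h => ⟨hx, h⟩⟩

theorem notMem_support_iff {Y : Scheme.{u}} (D : Y.IdealSheafData) {U : Y.affineOpens} {y : Y}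
    (hy : y ∈ U.1) : y ∉ D.support ↔ ∃ a ∈ D.ideal U, y ∈ Y.basicOpen a := by
  rw [Scheme.IdealSheafData.mem_support_iff_of_mem hy, Scheme.mem_zeroLocus_iff]
  push Not
  rfl

end PushSections

/-! ### Divisor ideals are invertible, and ideals cosupported in `Z` are bounded. -/

section Invertible

variable {X Y : Scheme.{u}} {Z : Set Y.IdealSheafData} {j : X ⟶ Y}

/-- The image of `j` misses the divisor, so its local equation vanishes nowhere on `X`. -/
theorem IsComplement.exists_inverse (hj : IsComplement Z j) {D : Y.IdealSheafData} (hD : D ∈ Z)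
    (U : Y.affineOpens) (d : Γ(Y, U)) (h : D.ideal U = Ideal.span {d}) :
    ∃ s : Γ(push j (strSheaf X), U.1), d • s = oneSec j U.1 := by
  have hu : IsUnit (pull j (le_refl (j ⁻¹ᵁ U.1)) d) := by
    refine isUnit_of_forall_mem_basicOpen _ fun x hx => ?_
    rw [mem_basicOpen_pull j _ hx]
    obtain ⟨a, ha, hxa⟩ := (notMem_support_iff D (U := U) hx).1 (hj.notMem x D hD)
    rw [h] at ha
    obtain ⟨c, rfl⟩ := Ideal.mem_span_singleton'.1 ha
    rw [Scheme.basicOpen_mul] at hxa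
    exact hxa.2
  obtain ⟨s, hs⟩ := hu.exists_right_inv
  exact ⟨s, (push_smul j (strSheaf X) d s).trans hs⟩

theorem smul_eq_of_inverse {U : Y.Opens} {d d' v : Γ(Y, U)} {s s' : Γ(push j (strSheaf X), U)}
    (hs : d • s = oneSec j U) (hs' : d' • s' = oneSec j U) (hv : d = v * d') : s' = v • s := by
  rw [← oneSec_act j _ s', ← hs, map_smul, LinearMap.smul_apply, hv, mul_smul, ← map_smul, hs',
    act_comm, oneSec_act]

variable (j) in
/-- The inverse of the ideal of a divisor. -/
noncomputable def inverseSubsheaf (D : Y.IdealSheafData) : Subsheaf (push j (strSheaf X)) :=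
  Subsheaf.span fun U => {s | ∃ (hU : IsAffineOpen U) (d : Γ(Y, U)),
    D.ideal ⟨U, hU⟩ = Ideal.span {d} ∧ d • s = oneSec j U}

theorem generatedOn_inverseSubsheaf (D : Y.IdealSheafData) (U : Y.affineOpens) (d : Γ(Y, U))
    (hd : D.ideal U = Ideal.span {d}) (s : Γ(push j (strSheaf X), U.1)) (hs : d • s = oneSec j U.1) :
    GeneratedOn (inverseSubsheaf j D) U.1 {s} where
  subset := by
    rintro _ rfl
    exact Subsheaf.subset_span ⟨U.2, d, hd, hs⟩
  le V hV m hm := by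
    refine Subsheaf.mem_of_mem_span _ ?_ hm
    rintro V' W h k b ⟨hW, d', hd', hb⟩
    refine Subsheaf.glue _ _ fun x hx => ?_
    obtain ⟨B, hxB, hB⟩ := exists_affineOpens_le hx
    refine ⟨B.1, hB, hxB, ?_⟩
    have hBU : B.1 ≤ U.1 := (hB.trans h).trans hV
    have hBW : B.1 ≤ W := hB.trans k
    have e : (D.ideal ⟨W, hW⟩).map (resFun hBW) = D.ideal B :=
      D.map_ideal (U := B) (V := ⟨W, hW⟩) hBW
    have hmem : resFun hBU d ∈ D.ideal B :=
      resFun_mem_ideal D hBU (hd ▸ Ideal.mem_span_singleton_self d)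
    rw [← e, hd', Ideal.map_span, Set.image_singleton] at hmem
    obtain ⟨v, hv⟩ := Ideal.mem_span_singleton'.1 hmem
    have hs' : resFun hBU d • res hBU s = oneSec j B.1 := by rw [← res_smul, hs, res_oneSec]
    have hb' : resFun hBW d' • res hBW b = oneSec j B.1 := by rw [← res_smul, hb, res_oneSec]
    rw [res_res, smul_eq_of_inverse hs' hb' hv.symm]
    exact Submodule.smul_mem _ _ (Subsheaf.res_mem _ hBU
      (Subsheaf.subset_span ⟨le_rfl, _, rfl, (res_self _ _).symm⟩))

/-- The ideals of the divisors in `Z` are invertible fractional ideals. -/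
theorem IsComplement.isUnit_idealFrac (hj : IsComplement Z j)
    (hZ : ∀ D ∈ Z, IsEffectiveCartier D) {D : Y.IdealSheafData} (hD : D ∈ Z) :
    IsUnit (idealFrac j D (hZ D hD).fg) := by
  have hft : (inverseSubsheaf j D).IsFiniteType := by
    intro y
    obtain ⟨U, hy, d, -, hd⟩ := hZ D hD y
    obtain ⟨s, hs⟩ := hj.exists_inverse hD U d hd
    have h := generatedOn_inverseSubsheaf D U d hd s hs
    exact ⟨U.1, hy, {s}, Set.finite_singleton s, h.subset, h.le⟩
  refine IsUnit.of_mul_eq_one (⟨inverseSubsheaf j D, hft⟩ : Frac j (strSheaf X))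
    (le_antisymm (Subsheaf.le_of_locally fun y => ?_) (Subsheaf.le_of_locally fun y => ?_))
  all_goals
    obtain ⟨U, hy, d, -, hd⟩ := hZ D hD y
    obtain ⟨s, hs⟩ := hj.exists_inverse hD U d hd
    have h := GeneratedOn.prod (isIdealOn_idealSubsheaf (j := j) D U)
      (generatedOn_inverseSubsheaf D U d hd s hs)
    refine ⟨U.1, hy, fun V hV => ?_⟩
  · refine GeneratedOn.carrier_le h ?_ hV
    rintro _ ⟨_, ⟨a, ha, rfl⟩, s', hs', rfl⟩
    rw [Set.mem_singleton_iff.1 hs']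
    rw [hd] at ha
    obtain ⟨c, rfl⟩ := Ideal.mem_span_singleton'.1 ha
    refine (isIdealOn_one j U.1).subset _ ⟨c, trivial, ?_⟩
    exact (act_smul_oneSec (c * d) s).trans (by rw [mul_smul, hs])
  · refine GeneratedOn.carrier_le (isIdealOn_one j U.1) ?_ hV
    rintro _ ⟨a, -, rfl⟩
    refine Submodule.smul_mem _ _ (h.subset _ ⟨d • oneSec j U.1, ⟨d, ?_, rfl⟩, s, rfl, ?_⟩)
    · rw [hd]; exact Ideal.mem_span_singleton_self d
    · exact (act_smul_oneSec d s).trans hs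

/-- A prime containing `T.ideal U` is a point of `U` in the support of `T`, hence in that of some `D
∈ Z`, so it contains `D.ideal U`. This is the hypothesis of `exists_multiset_prod_le`, and needs no
finiteness of `Z`. -/
theorem exists_multiset_prod_le_ideal (hZ : ∀ D ∈ Z, IsEffectiveCartier D) (T : Y.IdealSheafData)
    (hT : ∀ y ∈ T.support, ∃ D ∈ Z, y ∈ D.support) (U : Y.affineOpens) :
    ∃ s : Multiset Z, (s.map fun D : Z => D.1.ideal U).prod ≤ T.ideal U := by
  refine exists_multiset_prod_le (fun D : Z => D.1.ideal U) (fun D => (hZ D.1 D.2).fg U) _ ?_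
  intro P hP hTP
  let p : Spec Γ(Y, U) := ⟨P, hP⟩
  let hU := isAffineOpen_coe U
  have hpU : hU.fromSpec p ∈ U.1 := top_le_preimage_fromSpec U trivial
  have hmem : ∀ a : Γ(Y, U), hU.fromSpec p ∈ Y.basicOpen a ↔ a ∉ P := by
    intro a
    have h3 : hU.fromSpec ⁻¹ᵁ Y.basicOpen a = PrimeSpectrum.basicOpen a :=
      hU.fromSpec_preimage_basicOpen a
    change p ∈ hU.fromSpec ⁻¹ᵁ Y.basicOpen a ↔ _
    rw [h3]
    rfl
  have hsupp : ∀ D : Y.IdealSheafData, hU.fromSpec p ∈ D.support ↔ D.ideal U ≤ P := by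
    intro D
    rw [← not_iff_not, notMem_support_iff D hpU, SetLike.not_le_iff_exists]
    simp only [hmem]
  obtain ⟨D, hD, hDp⟩ := hT _ ((hsupp T).2 hTP)
  exact ⟨⟨D, hD⟩, (hsupp D).1 hDp⟩

/-- A finite type ideal sheaf cosupported in `Z` is a bounded fractional ideal. -/
theorem IsComplement.isBoundedElement_idealFrac [CompactSpace Y] (hj : IsComplement Z j)
    (hZ : ∀ D ∈ Z, IsEffectiveCartier D) (T : Y.IdealSheafData)
    (hfg : ∀ U : Y.affineOpens, (T.ideal U).FG)
    (hT : ∀ y ∈ T.support, ∃ D ∈ Z, y ∈ D.support) : IsBoundedElement (idealFrac j T hfg) := by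
  have haff : ∀ y : Y, ∃ U : Y.affineOpens, y ∈ U.1 := fun y => by
    obtain ⟨U, hy, -⟩ := exists_affineOpens_le (U := (⊤ : Y.Opens)) (y := y) trivial
    exact ⟨U, hy⟩
  choose U hU using haff
  choose s hs using exists_multiset_prod_le_ideal hZ T hT
  obtain ⟨t, ht⟩ := isCompact_univ.elim_finite_subcover (fun y => ((U y).1 : Set Y))
    (fun y => (U y).1.2) fun y _ => Set.mem_iUnion.2 ⟨y, hU y⟩
  -- Adding the multisets of a finite affine cover gives one product of divisor ideals contained in
  -- `T` on every member of the cover, since extra factors only shrink it. This product is the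
  -- invertible lower bound; the upper bound is `1`.
  let m : Multiset Z := ∑ y ∈ t, s (U y)
  let I : Z → Frac j (strSheaf X) := fun D => idealFrac j D.1 (hZ D.1 D.2).fg
  have hunit : IsUnit (m.map I).prod := by
    refine Multiset.prod_induction IsUnit _ (fun _ _ => IsUnit.mul) isUnit_one fun x hx => ?_
    obtain ⟨D, -, rfl⟩ := Multiset.mem_map.1 hx
    exact hj.isUnit_idealFrac hZ D.2
  refine ⟨hunit.unit, 1, ?_, idealFrac_le_one T hfg⟩
  refine Subsheaf.le_of_locally fun y => ?_
  obtain ⟨y', hy't, hy'⟩ := Set.mem_iUnion₂.1 (ht (Set.mem_univ y))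
  refine ⟨(U y').1, hy', fun V hV => ?_⟩
  have h1 : IsIdealOn (m.map I).prod.1 (U y').1 (m.map fun D : Z => D.1.ideal (U y')).prod :=
    isIdealOn_multiset_prod I _ m fun D _ => isIdealOn_idealSubsheaf D.1 (U y')
  refine h1.carrier_le (isIdealOn_idealSubsheaf T (U y')) ?_ hV
  refine le_trans ?_ (hs (U y'))
  obtain ⟨r, hr⟩ := Multiset.le_iff_exists_add.1
    (Finset.single_le_sum (f := fun y => s (U y)) (fun _ _ => Multiset.zero_le _) hy't)
  have hr' : m = s (U y') + r := hr
  rw [hr', Multiset.map_add, Multiset.prod_add]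
  exact Ideal.mul_le_left

end Invertible

/-! ### Linear dependence with coefficients on an affine scheme. -/

section AffineTest

variable {X : Scheme.{u}} {O : X.Opens}

theorem pull_ι_bijective {N : O.toScheme.Opens} {P : X.Opens} (h : N ≤ O.ι ⁻¹ᵁ P)
    (e : O.ι ''ᵁ N = P) : Function.Bijective (pull O.ι h) := by
  subst e
  exact pull_image_bijective O.ι N h

theorem image_ι_preimage {P : X.Opens} (hP : P ≤ O) : O.ι ''ᵁ (O.ι ⁻¹ᵁ P) = P := by
  ext x
  exact ⟨fun ⟨y, hy, e⟩ => e ▸ hy, fun hx => ⟨⟨x, hP hx⟩, hx, rfl⟩⟩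

theorem top_le_preimage_ι (O : X.Opens) : ⊤ ≤ O.ι ⁻¹ᵁ O := fun x _ => x.2

theorem exists_ringHom_of_hom {W : Scheme.{u}} (e : O.toScheme ⟶ W) :
    ∃ ψ : Γ(W, ⊤) →+* Γ(X, O), ∀ a, pull O.ι (top_le_preimage_ι O) (ψ a) =
      pull e (top_le_preimage_top e) a := by
  have hb : Function.Bijective (pull O.ι (top_le_preimage_ι O)) := by
    refine pull_ι_bijective _ ?_
    rw [Scheme.Hom.image_top_eq_opensRange, Scheme.Opens.opensRange_ι]
  let E := RingEquiv.ofBijective _ hb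
  exact ⟨E.symm.toRingHom.comp (pull e (top_le_preimage_top e)), fun a => E.apply_symm_apply _⟩

/-- A linear dependence of sections with coefficients on an affine scheme `W` can be tested locally
on any scheme under `W`. -/
theorem exists_eq_sum_of_locally {W Y' : Scheme.{u}} [IsAffine W] (M : X.Modules)
    [M.IsQuasicoherent] (hO : IsCompact (O : Set X)) (e : O.toScheme ⟶ W) (h : W ⟶ Y')
    (j' : X ⟶ Y') (comm : e ≫ h = O.ι ≫ j') (ψ : Γ(W, ⊤) →+* Γ(X, O))
    (hψ : ∀ a, pull O.ι (top_le_preimage_ι O) (ψ a) = pull e (top_le_preimage_top e) a)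
    {ι : Type*} [Finite ι] (n : Γ(M, O)) (v : ι → Γ(M, O)) (s : Finset ι)
    (hloc : ∀ w : W, ∃ V : Y'.Opens, h w ∈ V ∧ ∃ c : ι → Γ(Y', V),
      ∀ (P : X.Opens) (hPO : P ≤ O) (hPV : P ≤ j' ⁻¹ᵁ V),
        res hPO n = ∑ a ∈ s, pull j' hPV (c a) • res hPO (v a)) :
    ∃ b : ι → Γ(W, ⊤), n = ∑ a ∈ s, ψ (b a) • v a := by
  -- The functions `x` on `W` for which `x • n` is a combination of the `v a` form an ideal. It is
  -- the unit ideal if, for each point of `W`, it contains a function not vanishing there; powers of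
  -- the `g` found below serve.
  let I : Ideal Γ(W, ⊤) :=
    { carrier := {x | ∃ b : ι → Γ(W, ⊤), ψ x • n = ∑ a ∈ s, ψ (b a) • v a}
      zero_mem' := ⟨0, by simp⟩
      add_mem' := by
        rintro x y ⟨b, hb⟩ ⟨b', hb'⟩
        refine ⟨b + b', ?_⟩
        simp only [map_add, add_smul, hb, hb', Pi.add_apply, Finset.sum_add_distrib]
      smul_mem' := by
        rintro r x ⟨b, hb⟩
        refine ⟨fun a => r * b a, ?_⟩
        simp only [smul_eq_mul, map_mul, mul_smul, hb, Finset.smul_sum] }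
  suffices hI : I = ⊤ by
    obtain ⟨b, hb⟩ : (1 : Γ(W, ⊤)) ∈ I := hI ▸ trivial
    exact ⟨b, by rw [← hb, map_one, one_smul]⟩
  have hWaff : IsAffineOpen (⊤ : W.Opens) := isAffineOpen_top W
  rw [← Ideal.span_eq I, ← hWaff.self_le_iSup_basicOpen_iff]
  intro w _
  obtain ⟨V, hwV, c, hc⟩ := hloc w
  obtain ⟨g, hg, hwg⟩ := hWaff.exists_basicOpen_le (V := h ⁻¹ᵁ V) ⟨w, hwV⟩ trivial
  have hPO : X.basicOpen (ψ g) ≤ O := X.basicOpen_le _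
  have hmem : ∀ z : O.toScheme, O.ι z ∈ X.basicOpen (ψ g) → e z ∈ W.basicOpen g := by
    intro z hz
    rw [← mem_basicOpen_pull e (top_le_preimage_top e) (x := z) trivial, ← hψ,
      mem_basicOpen_pull O.ι (top_le_preimage_ι O) (x := z) trivial]
    exact hz
  have hPV : X.basicOpen (ψ g) ≤ j' ⁻¹ᵁ V := by
    intro x hx
    have h1 : (e ≫ h) ⟨x, hPO hx⟩ ∈ V := hg (hmem ⟨x, hPO hx⟩ hx)
    rw [comm] at h1
    exact h1
  have hloc' := hWaff.isLocalization_basicOpen g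
  -- A common power of `g` extends the finitely many local coefficients to all of `W`.
  obtain ⟨⟨_, k, rfl⟩, hk⟩ := IsLocalization.exist_integer_multiples_of_finite
    (Submonoid.powers g) fun a => pull h hg (c a)
  choose b hb using hk
  have hb' : ∀ a, resFun (W.basicOpen_le g) (b a) =
      resFun (W.basicOpen_le g) g ^ k * pull h hg (c a) := by
    intro a
    refine (hb a).trans ?_
    rw [← map_pow]
    exact Algebra.smul_def (A := Γ(W, W.basicOpen g)) (g ^ k) (pull h hg (c a))
  have hN : O.ι ⁻¹ᵁ X.basicOpen (ψ g) ≤ e ⁻¹ᵁ W.basicOpen g := fun z hz => hmem z hz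
  have hinj := (pull_ι_bijective (le_refl (O.ι ⁻¹ᵁ X.basicOpen (ψ g)))
    (image_ι_preimage hPO)).1
  have hψ' : ∀ a, pull O.ι (le_refl (O.ι ⁻¹ᵁ X.basicOpen (ψ g))) (resFun hPO (ψ a)) =
      pull e hN (resFun (W.basicOpen_le g) a) := by
    intro a
    rw [pull_resFun, pull_resFun]
    have := congrArg (resFun (le_top : O.ι ⁻¹ᵁ X.basicOpen (ψ g) ≤ ⊤)) (hψ a)
    rwa [resFun_pull, resFun_pull] at this
  have key : ∀ a, resFun hPO (ψ (b a)) = resFun hPO (ψ g) ^ k * pull j' hPV (c a) := by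
    intro a
    refine hinj ?_
    rw [map_mul, map_pow, hψ', hψ', hb', map_mul, map_pow, pull_pull, pull_pull]
    exact congrArg _ (pull_congr comm _ _)
  -- The relation multiplied by `g ^ k` now has global coefficients but is only known where `g` is
  -- invertible. Quasi-coherence and compactness of `O` make it hold after multiplication by a
  -- further power of `g`.
  obtain ⟨l, hl⟩ := exists_pow_smul_eq_zero M hO (ψ g)
    (ψ g ^ k • n - ∑ a ∈ s, ψ (b a) • v a) (by
      rw [map_sub, map_sum, res_smul, hc _ hPO hPV, Finset.smul_sum, sub_eq_zero, map_pow]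
      refine Finset.sum_congr rfl fun a _ => ?_
      rw [res_smul, smul_smul]
      refine congrArg (· • res hPO (v a)) (key a).symm)
  rw [Opens.mem_iSup]
  refine ⟨⟨g ^ (l + k), fun a => g ^ l * b a, ?_⟩, ?_⟩
  · rw [smul_sub, sub_eq_zero, smul_smul, ← pow_add, Finset.smul_sum] at hl
    rw [map_pow, hl]
    refine Finset.sum_congr rfl fun a _ => ?_
    rw [map_mul, map_pow, mul_smul]
  -- The non-vanishing locus of a power agrees with that of `g` only for positive exponents;
  -- exponent zero gives the function `1`.
  · by_cases h0 : 0 < l + k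
    · rw [Scheme.basicOpen_pow _ _ h0]; exact hwg
    · have : g ^ (l + k) = 1 := by rw [Nat.eq_zero_of_not_pos h0, pow_zero]
      simp only [this, Scheme.basicOpen_one]
      trivial

end AffineTest

/-! ### Pullback of sections and generators of inverse images. -/

section InverseImage

variable {X Y Y' : Scheme.{u}} {j : X ⟶ Y} {M : X.Modules} (f : Y' ⟶ Y) (j' : X ⟶ Y')

theorem preimage_le_of_comp (hj : j' ≫ f = j) {U : Y.Opens} {V : Y'.Opens} (h : V ≤ f ⁻¹ᵁ U) :
    j' ⁻¹ᵁ V ≤ j ⁻¹ᵁ U := by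
  subst hj; exact fun _ hx => h hx

/-- The pullback of sections of `j_* M` to sections of `j'_* M`. -/
noncomputable def pullSec (hj : j' ≫ f = j) {U : Y.Opens} {V : Y'.Opens} (h : V ≤ f ⁻¹ᵁ U) :
    Γ(push j M, U) →+ Γ(push j' M, V) :=
  res (G := M) (preimage_le_of_comp f j' hj h)

variable (hj : j' ≫ f = j) {U : Y.Opens} {V : Y'.Opens}

theorem pullSec_smul (h : V ≤ f ⁻¹ᵁ U) (r : Γ(Y, U)) (n : Γ(push j M, U)) :
    pullSec f j' hj h (r • n) = pull f h r • pullSec f j' hj h n := by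
  rw [push_smul, push_smul]
  refine (res_smul (G := M) _ _ _).trans ?_
  refine congrArg (fun c : Γ(X, j' ⁻¹ᵁ V) => HSMul.hSMul (β := Γ(M, j' ⁻¹ᵁ V)) c
    (pullSec f j' hj h n)) ?_
  rw [resFun_pull, pull_pull]
  exact pull_congr hj.symm _ r

theorem res_pullSec (h : V ≤ f ⁻¹ᵁ U) {V' : Y'.Opens} (k : V' ≤ V) (n : Γ(push j M, U)) :
    res k (pullSec f j' hj h n) = pullSec f j' hj (k.trans h) n :=
  res_res (G := M) (preimage_le_of_comp f j' hj h) (fun _ hx => k hx) n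

theorem pullSec_res {U' : Y.Opens} (h : V ≤ f ⁻¹ᵁ U) (k : U ≤ U') (n : Γ(push j M, U')) :
    pullSec f j' hj h (res k n) = pullSec f j' hj (fun _ hx => k (h hx)) n :=
  res_res (G := M) (fun _ hx => k hx) (preimage_le_of_comp f j' hj h) n

theorem pullSec_mem_inverseImage {N : Subsheaf (push j M)} (h : V ≤ f ⁻¹ᵁ U)
    {n : Γ(push j M, U)} (hn : n ∈ N.carrier U) :
    pullSec f j' hj h n ∈ (inverseImage f j' hj N).carrier V :=
  Subsheaf.subset_span ⟨U, h, n, hn, rfl⟩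

theorem pullSec_mem_span {F : Set Γ(push j M, U)} {U' : Y.Opens} (k : U' ≤ U) (h : V ≤ f ⁻¹ᵁ U')
    {m : Γ(push j M, U')} (hm : m ∈ Submodule.span Γ(Y, U') (res k '' F)) :
    pullSec f j' hj h m ∈ Submodule.span Γ(Y', V)
      (pullSec f j' hj (fun _ hx => k (h hx)) '' F) := by
  induction hm using Submodule.span_induction with
  | mem x hx =>
    obtain ⟨b, hb, rfl⟩ := hx
    rw [pullSec_res]
    exact Submodule.subset_span ⟨b, hb, rfl⟩
  | zero => rw [map_zero]; exact zero_mem _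
  | add x y _ _ hx hy => rw [map_add]; exact add_mem hx hy
  | smul a x _ hx => rw [pullSec_smul]; exact Submodule.smul_mem _ _ hx

theorem GeneratedOn.inverseImage {N : Subsheaf (push j M)} {F : Set Γ(push j M, U)}
    (hN : GeneratedOn N U F) : GeneratedOn (inverseImage f j' hj N) (f ⁻¹ᵁ U)
      (pullSec f j' hj le_rfl '' F) where
  subset := by
    rintro _ ⟨n, hn, rfl⟩
    exact pullSec_mem_inverseImage f j' hj le_rfl (hN.subset n hn)
  le V hV m hm := by
    refine Subsheaf.mem_of_mem_span _ ?_ hm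
    rintro V' W hV' k _ ⟨U₁, hW, n, hn, rfl⟩
    change IntegralClosure.res k (pullSec f j' hj hW n) ∈ _
    refine Subsheaf.glue _ _ fun y hy => ?_
    have hyU : f y ∈ U₁ ⊓ U := ⟨hW (k hy), hV (hV' hy)⟩
    obtain ⟨U₂, k₂, hyU₂, h₂⟩ := hN.exists_mem_span inf_le_right
      (N.res_mem (inf_le_left : U₁ ⊓ U ≤ U₁) hn) hyU
    refine ⟨V' ⊓ f ⁻¹ᵁ U₂, inf_le_left, ⟨hy, hyU₂⟩, ?_⟩
    rw [res_res] at h₂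
    have h₃ := pullSec_mem_span f j' hj (k₂.trans inf_le_right)
      (inf_le_right : V' ⊓ f ⁻¹ᵁ U₂ ≤ f ⁻¹ᵁ U₂) h₂
    rw [pullSec_res] at h₃
    rw [res_pullSec, res_pullSec]
    refine Submodule.span_le.2 ?_ h₃
    rintro _ ⟨b, hb, rfl⟩
    rw [← res_pullSec f j' hj (le_refl (f ⁻¹ᵁ U)) (inf_le_left.trans (hV'.trans hV))]
    exact Subsheaf.res_mem _ _ (Subsheaf.subset_span ⟨le_rfl, _, ⟨b, hb, rfl⟩, (res_self _ _).symm⟩)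

end InverseImage

/-! ### Reading membership in an inverse image on the charts of a blow-up. -/

section BlowUpTest

variable {X Y Y' : Scheme.{u}} {j : X ⟶ Y} {M : X.Modules}

theorem res_push_smul {U : Y.Opens} {P : X.Opens} (h : P ≤ j ⁻¹ᵁ U) (c : Γ(Y, U))
    (m : Γ(push j M, U)) : res (G := M) h (c • m) = pull j h c • res (G := M) h m := by
  rw [push_smul]
  refine (res_smul (G := M) _ _ _).trans ?_
  rw [resFun_pull]

theorem isReg_of_isUnit {U : Y.Opens} {a : Γ(Y, U)} (h : IsUnit a) : IsReg a :=
  IsReg.of_dvd (b := 1) (fun V k => by rw [map_one]; exact one_mem _) h.dvd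

theorem genOver_of_isUnit {W : Scheme.{u}} {T : Y.IdealSheafData} {g : W ⟶ Y} {U : Y.affineOpens}
    {t : Γ(Y, U)} (ht : t ∈ T.ideal U) {N : W.Opens} (hN : N ≤ g ⁻¹ᵁ U.1)
    (h : IsUnit (pull g hN t)) : GenOver T g U t N :=
  ⟨hN, ht, isReg_of_isUnit h, fun _ _ => h.dvd⟩

/-- The non-vanishing locus of `t` maps to the chart of the blow-up belonging to `t`. -/
theorem exists_hom_chart {T : Y.IdealSheafData} {U : Y.affineOpens} {t : Γ(Y, U)}
    (ht : t ∈ T.ideal U) {f : Y' ⟶ Y} {j' : X ⟶ Y'} (hj' : j' ≫ f = j) (hf : IsBlowUp T f)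
    {O : X.Opens} (hOU : O ≤ j ⁻¹ᵁ U.1) (hO : IsUnit (pull j hOU t)) :
    ∃ (e : O.toScheme ⟶ chart T U t) (h : chart T U t ⟶ Y'), e ≫ chartMap T U t = O.ι ≫ j ∧
      h ≫ f = chartMap T U t ∧ e ≫ h = O.ι ≫ j' := by
  have hle : ⊤ ≤ (O.ι ≫ j) ⁻¹ᵁ U.1 := fun x _ => hOU x.2
  have hG : GenOver T (O.ι ≫ j) U t ⊤ := by
    refine genOver_of_isUnit ht hle ?_
    have := hO.map (pull O.ι (top_le_preimage_ι O))
    rwa [pull_pull] at this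
  obtain ⟨e, he⟩ := exists_lift_chartMap T U hG
  obtain ⟨h, hh, -⟩ := hf.lift _ (chartMap T U t)
    (isEffectiveCartier_comap_iff.2 (isInv_chartMap T U ht))
  refine ⟨e, h, he, hh, ?_⟩
  -- Both composites to `Y'` lift `O.ι ≫ j`, and such a lift is unique because `T` is invertible on
  -- `O`, where `t` is a unit.
  refine (hf.lift _ (O.ι ≫ j) (isEffectiveCartier_comap_iff.2
    fun _ => ⟨U, t, ⊤, trivial, hG⟩)).unique ?_ ?_
  · rw [Category.assoc, hh, he]
  · rw [Category.assoc, hj']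

/-- The chart maps to `Y'` by the universal property of the blow-up, so local expressions for `n` on
`Y'` give local expressions with coefficients on the affine chart, and `exists_eq_sum_of_locally`
assembles them. It is not needed that charts cover `Y'`. -/
theorem exists_eq_sum_chartRing {T : Y.IdealSheafData} {U : Y.affineOpens} {t : Γ(Y, U)}
    (ht : t ∈ T.ideal U) [M.IsQuasicoherent] {f : Y' ⟶ Y} {j' : X ⟶ Y'} (hj' : j' ≫ f = j)
    (hf : IsBlowUp T f) {N : Subsheaf (push j M)} {F : Set Γ(push j M, U.1)} [Fintype F]
    (hN : GeneratedOn N U.1 F) {n : Γ(push j M, U.1)}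
    (hn : pullSec f j' hj' le_rfl n ∈ (inverseImage f j' hj' N).carrier (f ⁻¹ᵁ U.1))
    {O : X.Opens} (hOU : O ≤ j ⁻¹ᵁ U.1) (hO : IsUnit (pull j hOU t)) (hc : IsCompact (O : Set X)) :
    ∃ ψ : chartRing T U t →+* Γ(X, O), (∀ r, ψ ((chartRingMap T U t).hom r) = pull j hOU r) ∧
      ∃ b : F → chartRing T U t, res (G := M) hOU n = ∑ a, ψ (b a) • res (G := M) hOU a.1 := by
  obtain ⟨e, h, he, hh, comm⟩ := exists_hom_chart ht hj' hf hOU hO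
  obtain ⟨ψ, hψ⟩ := exists_ringHom_of_hom e
  refine ⟨ψ.comp (Scheme.ΓSpecIso (chartRing T U t)).inv.hom, fun r => ?_, ?_⟩
  · rw [RingHom.comp_apply, ← pull_chartMap T U t (chartMap_le T U t)]
    have hb : Function.Injective (pull O.ι (top_le_preimage_ι O)) := by
      refine (pull_ι_bijective _ ?_).1
      rw [Scheme.Hom.image_top_eq_opensRange, Scheme.Opens.opensRange_ι]
    refine hb ?_
    rw [hψ, pull_pull, pull_pull]
    exact pull_congr he _ r
  have hloc : ∀ w : chart T U t, ∃ V : Y'.Opens, h w ∈ V ∧ ∃ c : F → Γ(Y', V),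
      ∀ (P : X.Opens) (hPO : P ≤ O) (hPV : P ≤ j' ⁻¹ᵁ V),
        res hPO (res (G := M) hOU n) =
          ∑ a ∈ Finset.univ, pull j' hPV (c a) • res hPO (res (G := M) hOU a.1) := by
    intro w
    have hw : h w ∈ f ⁻¹ᵁ U.1 := by
      have : (h ≫ f) w ∈ U.1 := by rw [hh]; exact chartMap_le T U t trivial
      exact this
    obtain ⟨V, k, hwV, hV⟩ := (hN.inverseImage f j' hj').exists_mem_span le_rfl hn hw
    rw [res_pullSec, Set.image_image] at hV
    simp only [res_pullSec] at hV
    rw [Set.image_eq_range, Submodule.mem_span_range_iff_exists_fun] at hV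
    obtain ⟨c, hc⟩ := hV
    refine ⟨V, hwV, c, fun P hPO hPV => ?_⟩
    have h1 := congrArg (res (G := M) hPV) hc
    have h2 : ∀ b : Γ(push j M, U.1), res (G := M) hPV (pullSec f j' hj' k b) =
        res hPO (res (G := M) hOU b) := fun b =>
      (res_res (G := M) _ _ _).trans (res_res (G := M) _ _ _).symm
    rw [← h2]
    refine h1.symm.trans ?_
    refine (map_sum _ _ _).trans (Finset.sum_congr rfl fun a _ => ?_)
    rw [← h2]
    exact res_push_smul hPV _ _
  obtain ⟨b, hb⟩ := exists_eq_sum_of_locally M hc e h j' comm ψ hψ (res (G := M) hOU n)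
    (fun a : F => res (G := M) hOU a.1) Finset.univ hloc
  refine ⟨fun a => (Scheme.ΓSpecIso (chartRing T U t)).hom.hom (b a), ?_⟩
  rw [hb]
  refine Finset.sum_congr rfl fun a _ => ?_
  have : (Scheme.ΓSpecIso (chartRing T U t)).inv.hom
      ((Scheme.ΓSpecIso (chartRing T U t)).hom.hom (b a)) = b a :=
    congr($((Scheme.ΓSpecIso (chartRing T U t)).hom_inv_id) (b a))
  rw [RingHom.comp_apply, this]

variable {Z : Set Y.IdealSheafData}

/-- Where `t` is invertible, `n` is a combination of `F` with coefficients in the chart ring, and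
clearing denominators moves the coefficients into a power `T ^ q`. The difference of the two sides
vanishes on that locus, so another power of `t` kills it over all of `j⁻¹ U`. -/
theorem IsComplement.exists_pow_smul_mem_span (hj : IsComplement Z j)
    (hZ : ∀ D ∈ Z, IsEffectiveCartier D) {T : Y.IdealSheafData} {U : Y.affineOpens} {t : Γ(Y, U)}
    (ht : t ∈ T.ideal U) [M.IsQuasicoherent] {f : Y' ⟶ Y} {j' : X ⟶ Y'} (hj' : j' ≫ f = j)
    (hf : IsBlowUp T f) {N : Subsheaf (push j M)} {F : Set Γ(push j M, U.1)} (hF : F.Finite)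
    (hN : GeneratedOn N U.1 F) {n : Γ(push j M, U.1)}
    (hn : pullSec f j' hj' le_rfl n ∈ (inverseImage f j' hj' N).carrier (f ⁻¹ᵁ U.1)) :
    ∃ k : ℕ, t ^ k • n ∈ Submodule.span Γ(Y, U)
      {m : Γ(push j M, U.1) | ∃ a ∈ T.ideal U ^ k, ∃ b ∈ F, m = a • b} := by
  have := hF.fintype
  let τ := pull j (le_refl (j ⁻¹ᵁ U.1)) t
  let O := X.basicOpen τ
  have hOU : O ≤ j ⁻¹ᵁ U.1 := X.basicOpen_le τ
  have hτ : ∀ r, pull j hOU r = resFun hOU (pull j (le_refl (j ⁻¹ᵁ U.1)) r) := fun r =>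
    (resFun_pull j _ _ r).symm
  have hO : IsUnit (pull j hOU t) := by
    rw [hτ]; exact X.toRingedSpace.isUnit_res_basicOpen τ
  have hc : IsCompact (O : Set X) := by
    have h1 := hj.isCompact_preimage hZ (Y.affineBasicOpen t)
    have h2 : O = j ⁻¹ᵁ (Y.affineBasicOpen t).1 := by
      have e : O = j ⁻¹ᵁ U.1 ⊓ j ⁻¹ᵁ Y.basicOpen t := Scheme.basicOpen_appLE _ _ _ _ _
      rw [e]
      exact inf_eq_right.2 fun x hx => Y.basicOpen_le t hx
    rw [h2]
    exact h1
  obtain ⟨ψ, hψ, b, hb⟩ := exists_eq_sum_chartRing ht hj' hf hN hn hOU hO hc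
  choose p r hr hpr using fun a => chartRing_exists_pow_mul T U ht (b a)
  let q := Finset.univ.sup p
  let r' : F → Γ(Y, U) := fun a => t ^ (q - p a) * r a
  have hpq : ∀ a, q - p a + p a = q := fun a =>
    Nat.sub_add_cancel (Finset.le_sup (f := p) (Finset.mem_univ a))
  have hr' : ∀ a, r' a ∈ T.ideal U ^ q := fun a => by
    rw [← hpq a, pow_add]
    exact Ideal.mul_mem_mul (Ideal.pow_mem_pow ht _) (hr a)
  have hqr : ∀ a, pull j hOU t ^ q * ψ (b a) = pull j hOU (r' a) := fun a => by
    have h1 := congrArg ψ (hpr a)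
    rw [map_mul, map_pow, hψ, hψ] at h1
    rw [map_mul, map_pow, ← h1, ← mul_assoc, ← pow_add, hpq]
  let m : Γ(push j M, U.1) := t ^ q • n - ∑ a, r' a • a.1
  have hm : res (G := M) hOU m = 0 := by
    have h1 : res (G := M) hOU m = res (G := M) hOU (t ^ q • n) -
        res (G := M) hOU (∑ a, r' a • a.1) := map_sub (res (G := M) hOU) _ _
    have h2 : res (G := M) hOU (∑ a, r' a • a.1) = ∑ a : F, res (G := M) hOU (r' a • a.1) :=
      map_sum (res (G := M) hOU) _ _
    rw [h1, h2, sub_eq_zero, res_push_smul, hb, Finset.smul_sum]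
    refine Finset.sum_congr rfl fun a _ => ?_
    rw [res_push_smul, smul_smul, map_pow, hqr]
  have hcU := hj.isCompact_preimage hZ U
  obtain ⟨l, hl⟩ := exists_pow_smul_eq_zero M hcU τ m hm
  have hl' : t ^ l • m = 0 := by
    rw [push_smul, map_pow]
    exact hl
  refine ⟨l + q, ?_⟩
  rw [smul_sub, sub_eq_zero, smul_smul, ← pow_add, Finset.smul_sum] at hl'
  rw [hl']
  refine Submodule.sum_mem _ fun a _ => Submodule.subset_span ⟨t ^ l * r' a, ?_, a.1, a.2, ?_⟩
  · rw [pow_add]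
    exact Ideal.mul_mem_mul (Ideal.pow_mem_pow ht _) (hr' a)
  · rw [smul_smul]

end BlowUpTest

/-! ### From blow-ups to bounded factors. -/

section BoundedOfBlowUp

variable {X Y : Scheme.{u}} {j : X ⟶ Y} {M : X.Modules} {Z : Set Y.IdealSheafData}

theorem Subsheaf.IsFiniteType.exists_affineOpens {G : Y.Modules} {N P : Subsheaf G}
    (hN : N.IsFiniteType) (hP : P.IsFiniteType) (y : Y) : ∃ U : Y.affineOpens, y ∈ U.1 ∧
      (∃ F : Set Γ(G, U.1), F.Finite ∧ GeneratedOn N U.1 F) ∧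
      ∃ E : Set Γ(G, U.1), E.Finite ∧ GeneratedOn P U.1 E := by
  obtain ⟨U₁, hy₁, F, hF, hNF⟩ := hN.exists_generatedOn y
  obtain ⟨U₂, hy₂, E, hE, hPE⟩ := hP.exists_generatedOn y
  obtain ⟨U, hy, hU⟩ := exists_affineOpens_le (U := U₁ ⊓ U₂) (y := y) ⟨hy₁, hy₂⟩
  exact ⟨U, hy, ⟨_, hF.image _, hNF.res (hU.trans inf_le_left)⟩,
    ⟨_, hE.image _, hPE.res (hU.trans inf_le_right)⟩⟩

/-- The exponent `k` depends on `t` and `n`. Multiplying by `t ^ (K - k)`, which lies in `T ^ (K -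
k)`, makes it uniform. -/
theorem pow_smul_mem_smul {T : Y.IdealSheafData} (hT : ∀ U : Y.affineOpens, (T.ideal U).FG)
    {N : Frac j M} {U : Y.affineOpens} {t : Γ(Y, U)} (ht : t ∈ T.ideal U)
    {F : Set Γ(push j M, U.1)} (hF : ∀ b ∈ F, b ∈ N.1.carrier U.1) {n : Γ(push j M, U.1)} {k K : ℕ}
    (hkK : k ≤ K) (hn : t ^ k • n ∈ Submodule.span Γ(Y, U)
      {m : Γ(push j M, U.1) | ∃ a ∈ T.ideal U ^ k, ∃ b ∈ F, m = a • b}) :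
    t ^ K • n ∈ (idealFrac j T hT ^ K • N).1.carrier U.1 := by
  have hI : IsIdealOn (idealFrac j T hT).1 U.1 (T.ideal U) := isIdealOn_idealSubsheaf T U
  have key : ∀ m ∈ Submodule.span Γ(Y, U)
      {m : Γ(push j M, U.1) | ∃ a ∈ T.ideal U ^ k, ∃ b ∈ F, m = a • b},
      t ^ (K - k) • m ∈ (idealFrac j T hT ^ K • N).1.carrier U.1 := by
    intro m hm
    induction hm using Submodule.span_induction with
    | mem m hm =>
      obtain ⟨a, ha, b, hb, rfl⟩ := hm
      rw [smul_smul, ← act_smul_oneSec]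
      refine act_mem_prod ((hI.pow K).subset _ ⟨_, ?_, rfl⟩) (hF b hb)
      have := Ideal.mul_mem_mul (Ideal.pow_mem_pow ht (K - k)) ha
      rwa [← pow_add, Nat.sub_add_cancel hkK] at this
    | zero => rw [smul_zero]; exact zero_mem _
    | add x y _ _ hx hy => rw [smul_add]; exact add_mem hx hy
    | smul a x _ hx => rw [smul_comm]; exact Submodule.smul_mem _ _ hx
  have := key _ hn
  rwa [smul_smul, ← pow_add, Nat.sub_add_cancel hkK] at this

/-- The bounded factor is a high power of the blown-up ideal. -/
theorem IsComplement.exists_bounded_of_isIntegralExt [CompactSpace Y] (hj : IsComplement Z j)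
    (hZ : ∀ D ∈ Z, IsEffectiveCartier D) [M.IsQuasicoherent] {N N' : Frac j M}
    (h : IsIntegralExt Z N N') :
    ∃ s : Frac j (strSheaf X), IsBoundedElement s ∧ s • N' ≤ s • N := by
  obtain ⟨-, T, hT, hTZ, Y', f, j', hj', hf, heq⟩ := h
  let τ := idealFrac j T hT
  have hI : ∀ U : Y.affineOpens, IsIdealOn τ.1 U.1 (T.ideal U) := fun U =>
    isIdealOn_idealSubsheaf T U
  have hloc : ∀ y : Y, ∃ U : Y.affineOpens, y ∈ U.1 ∧ ∃ n₀ : ℕ, ∀ n ≥ n₀, ∀ V ≤ U.1,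
      (τ ^ n • N').1.carrier V ≤ (τ ^ n • N).1.carrier V := by
    intro y
    obtain ⟨U, hy, ⟨F, hF, hNF⟩, E, hE, hNE⟩ := N.2.exists_affineOpens N'.2 y
    obtain ⟨s, hs⟩ := hT U
    have hst : ∀ t ∈ s, t ∈ T.ideal U := fun t ht => hs ▸ Ideal.subset_span ht
    have hk : ∀ t ∈ s, ∀ n ∈ E, ∃ k : ℕ, t ^ k • n ∈ Submodule.span Γ(Y, U)
        {m : Γ(push j M, U.1) | ∃ a ∈ T.ideal U ^ k, ∃ b ∈ F, m = a • b} := fun t ht n hn =>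
      hj.exists_pow_smul_mem_span hZ (hst t ht) hj' hf hF hNF
        (heq ▸ pullSec_mem_inverseImage f j' hj' le_rfl (hNE.subset n hn))
    choose! k hk using hk
    let K := (s ×ˢ hE.toFinset).sup fun p => k p.1 p.2
    have hK : ∀ t ∈ s, ∀ n ∈ E, t ^ K • n ∈ (τ ^ K • N).1.carrier U.1 := fun t ht n hn =>
      pow_smul_mem_smul hT (hst t ht) hNF.subset (Finset.le_sup (f := fun p => k p.1 p.2)
        (Finset.mem_product.2 ⟨ht, hE.mem_toFinset.2 hn⟩ : (t, n) ∈ s ×ˢ hE.toFinset))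
        (hk t ht n hn)
    -- Beyond `s.card * K` factors, each product of generators of `T` contains some `t ^ K`, and `t
    -- ^ K` maps the generators of `N'` into `T ^ K N`. The remaining factors lie in `T ^ (n - K)`,
    -- so the total is in `T ^ n N`.
    refine ⟨U, hy, s.card * K + 1, fun n hn V hV => ?_⟩
    refine GeneratedOn.carrier_le (GeneratedOn.prod ((hI U).pow n) hNE) ?_ hV
    rintro _ ⟨_, ⟨a, ha, rfl⟩, b, hb, rfl⟩
    dsimp only
    rw [act_smul_oneSec]
    replace ha := span_pow_le_of_card_mul_lt hn hs.symm ha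
    induction ha using Submodule.span_induction with
    | mem a ha =>
      obtain ⟨t, ht, c, hc, rfl⟩ := ha
      have hKn : K ≤ n := (Nat.le_mul_of_pos_left K (Finset.card_pos.2 ⟨t, ht⟩)).trans
        (Nat.le_of_succ_le hn)
      have e : τ ^ n • N = τ ^ (n - K) • τ ^ K • N := by
        rw [smul_smul, ← pow_add, Nat.sub_add_cancel hKn]
      rw [e, mul_smul, ← act_smul_oneSec]
      exact act_mem_prod (((hI U).pow (n - K)).subset _ ⟨c, hc, rfl⟩) (hK t ht b hb)
    | zero => rw [zero_smul]; exact zero_mem _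
    | add x y _ _ hx hy => rw [add_smul]; exact add_mem hx hy
    | smul a x _ hx => rw [smul_assoc]; exact Submodule.smul_mem _ _ hx
  choose U hU n₀ hn₀ using hloc
  obtain ⟨t, ht⟩ := isCompact_univ.elim_finite_subcover (fun y => ((U y).1 : Set Y))
    (fun y => (U y).1.2) fun y _ => Set.mem_iUnion.2 ⟨y, hU y⟩
  -- The local statement holds for all exponents past a threshold, so the largest threshold of a
  -- finite cover works everywhere.
  refine ⟨τ ^ t.sup n₀, (hj.isBoundedElement_idealFrac hZ T hT hTZ).pow _,
    Subsheaf.le_of_locally fun y => ?_⟩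
  obtain ⟨y', hy't, hy'⟩ := Set.mem_iUnion₂.1 (ht (Set.mem_univ y))
  exact ⟨(U y').1, hy', hn₀ y' _ (Finset.le_sup hy't)⟩

end BoundedOfBlowUp

/-! ### Fractional ideals inside the structure sheaf are ideal sheaves. -/

section IdealOfFrac

variable {X Y : Scheme.{u}} {j : X ⟶ Y} {Z : Set Y.IdealSheafData}

theorem exists_open_of_finite {ι : Type*} {F : Set ι} (hF : F.Finite) {U : Y.Opens} {y : Y}
    (hy : y ∈ U) (P : ι → Y.Opens → Prop) (mono : ∀ b V V', V' ≤ V → P b V → P b V')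
    (h : ∀ b ∈ F, ∃ V ≤ U, y ∈ V ∧ P b V) : ∃ V ≤ U, y ∈ V ∧ ∀ b ∈ F, P b V := by
  induction F, hF using Set.Finite.induction_on with
  | empty => exact ⟨U, le_rfl, hy, fun _ hb => hb.elim⟩
  | @insert a s _ _ ih =>
    obtain ⟨V, hV, hyV, hPV⟩ := ih fun b hb => h b (Set.mem_insert_of_mem _ hb)
    obtain ⟨V', -, hyV', hPV'⟩ := h a (Set.mem_insert _ _)
    refine ⟨V ⊓ V', inf_le_left.trans hV, ⟨hyV, hyV'⟩, ?_⟩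
    rintro b (rfl | hb)
    · exact mono _ _ _ inf_le_right hPV'
    · exact mono _ _ _ inf_le_left (hPV b hb)

theorem exists_eq_smul_oneSec {S : Frac j (strSheaf X)} (hS : S ≤ 1) {U : Y.Opens} {y : Y}
    (hy : y ∈ U) {b : Γ(push j (strSheaf X), U)} (hb : b ∈ S.1.carrier U) :
    ∃ (V : Y.Opens) (h : V ≤ U), y ∈ V ∧ ∃ r : Γ(Y, V), res h b = r • oneSec j V := by
  obtain ⟨V, h, hyV, hV⟩ := (isIdealOn_one j U).exists_mem_span le_rfl (hS U hb) hy
  refine ⟨V, h, hyV, ?_⟩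
  generalize res h b = c at hV
  induction hV using Submodule.span_induction with
  | mem x hx =>
    obtain ⟨_, ⟨a, -, rfl⟩, rfl⟩ := hx
    exact ⟨_, res_smul_oneSec _ a⟩
  | zero => exact ⟨0, (zero_smul _ _).symm⟩
  | add x y _ _ hx hy =>
    obtain ⟨r, rfl⟩ := hx
    obtain ⟨r', rfl⟩ := hy
    exact ⟨r + r', (add_smul _ _ _).symm⟩
  | smul a x _ hx =>
    obtain ⟨r, rfl⟩ := hx
    exact ⟨a * r, (mul_smul _ _ _).symm⟩

/-- Near any point, a fractional ideal contained in the structure sheaf is given by a finitely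
generated ideal. -/
theorem exists_isIdealOn {S : Frac j (strSheaf X)} (hS : S ≤ 1) (y : Y) :
    ∃ U : Y.affineOpens, y ∈ U.1 ∧ ∃ I : Ideal Γ(Y, U), I.FG ∧ IsIdealOn S.1 U.1 I := by
  obtain ⟨U₁, hy₁, F, hF, hG⟩ := S.2.exists_generatedOn y
  obtain ⟨V, hV, hyV, hFV⟩ := exists_open_of_finite hF hy₁
    (fun b V => ∃ (h : V ≤ U₁) (r : Γ(Y, V)), res h b = r • oneSec j V)
    (fun b V V' k ⟨h, r, hr⟩ => ⟨k.trans h, resFun k r, by rw [← res_res h k, hr, res_smul_oneSec]⟩)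
    fun b hb => by
      obtain ⟨V, h, hyV, r, hr⟩ := exists_eq_smul_oneSec hS hy₁ (hG.subset b hb)
      exact ⟨V, h, hyV, h, r, hr⟩
  obtain ⟨U, hyU, hU⟩ := exists_affineOpens_le hyV
  have hG' := hG.res (hU.trans hV)
  have hr : ∀ b ∈ F, ∃ r : Γ(Y, U), res (hU.trans hV) b = r • oneSec j U.1 := by
    intro b hb
    obtain ⟨_, r, hr⟩ := hFV b hb
    exact ⟨resFun hU r, by rw [← res_res hV hU, hr, res_smul_oneSec]⟩
  choose! r hr using hr
  refine ⟨U, hyU, Ideal.span (r '' F), ⟨(hF.image r).toFinset, by simp⟩, hG'.mono ?_ ?_⟩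
  · rintro _ ⟨b, hb, rfl⟩
    exact ⟨r b, Ideal.subset_span ⟨b, hb, rfl⟩, hr b hb⟩
  · rintro _ ⟨a, ha, rfl⟩
    induction ha using Submodule.span_induction with
    | mem x hx =>
      obtain ⟨b, hb, rfl⟩ := hx
      rw [← hr b hb]
      exact S.1.res_mem _ (hG.subset b hb)
    | zero => rw [zero_smul]; exact zero_mem _
    | add x y _ _ hx hy => rw [add_smul]; exact add_mem hx hy
    | smul a x _ hx => rw [smul_assoc]; exact Submodule.smul_mem _ _ hx

theorem mem_map_of_smul_oneSec_mem_span {U V : Y.Opens} (hV : V ≤ U) {I : Ideal Γ(Y, U)}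
    {m : Γ(push j (strSheaf X), V)}
    (hm : m ∈ Submodule.span Γ(Y, V) (res hV '' {m | ∃ a ∈ I, m = a • oneSec j U})) :
    ∃ c ∈ I.map (resFun hV), m = c • oneSec j V := by
  induction hm using Submodule.span_induction with
  | mem x hx =>
    obtain ⟨_, ⟨a, ha, rfl⟩, rfl⟩ := hx
    exact ⟨_, Ideal.mem_map_of_mem _ ha, res_smul_oneSec _ a⟩
  | zero => exact ⟨0, zero_mem _, (zero_smul _ _).symm⟩
  | add x y _ _ hx hy =>
    obtain ⟨r, hr, rfl⟩ := hx
    obtain ⟨r', hr', rfl⟩ := hy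
    exact ⟨r + r', add_mem hr hr', (add_smul _ _ _).symm⟩
  | smul a x _ hx =>
    obtain ⟨r, hr, rfl⟩ := hx
    exact ⟨a * r, Ideal.mul_mem_left _ _ hr, (mul_smul _ _ _).symm⟩

theorem IsIdealOn.res {S : Subsheaf (push j (strSheaf X))} {U V : Y.Opens} {I : Ideal Γ(Y, U)}
    (h : IsIdealOn S U I) (hV : V ≤ U) : IsIdealOn S V (I.map (resFun hV)) := by
  refine (GeneratedOn.res h hV).mono ?_ ?_
  · rintro _ ⟨_, ⟨a, ha, rfl⟩, rfl⟩
    exact ⟨_, Ideal.mem_map_of_mem _ ha, res_smul_oneSec _ a⟩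
  · rintro _ ⟨a, ha, rfl⟩
    induction ha using Submodule.span_induction with
    | mem x hx =>
      obtain ⟨b, hb, rfl⟩ := hx
      rw [← res_smul_oneSec]
      exact S.res_mem _ (h.subset _ ⟨b, hb, rfl⟩)
    | zero => rw [zero_smul]; exact zero_mem _
    | add x y _ _ hx hy => rw [add_smul]; exact add_mem hx hy
    | smul a x _ hx => rw [smul_assoc]; exact Submodule.smul_mem _ _ hx

theorem IsComplement.smul_oneSec_injective (hj : IsComplement Z j)
    (hZ : ∀ D ∈ Z, IsEffectiveCartier D) {U : Y.Opens} {a b : Γ(Y, U)}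
    (h : a • oneSec j U = b • oneSec j U) : a = b := by
  rw [smul_oneSec_eq, smul_oneSec_eq] at h
  exact hj.pull_injective hZ U h

/-- The functions that multiply `r` into `I` form an ideal, shown to be the unit ideal point by
point. Near a point `r • 1` has a coefficient in the extension of `I`; this coefficient is `r`,
because functions on `Y` embed into functions on `X`. A power of `g` then clears denominators. -/
theorem IsComplement.mem_of_isIdealOn (hj : IsComplement Z j)
    (hZ : ∀ D ∈ Z, IsEffectiveCartier D) {S : Subsheaf (push j (strSheaf X))} {U : Y.Opens}
    (hU : IsAffineOpen U) {I : Ideal Γ(Y, U)} (h : IsIdealOn S U I) {r : Γ(Y, U)}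
    (hr : r • oneSec j U ∈ S.carrier U) : r ∈ I := by
  let K : Ideal Γ(Y, U) := Submodule.colon I {r}
  suffices hK : K = ⊤ by
    have h1 : (1 : Γ(Y, U)) ∈ K := hK ▸ trivial
    have := Submodule.mem_colon_singleton.1 h1
    rwa [one_smul] at this
  rw [← Ideal.span_eq K, ← hU.self_le_iSup_basicOpen_iff]
  intro y hy
  obtain ⟨W, hW, hyW, hm⟩ := GeneratedOn.exists_mem_span h le_rfl hr hy
  obtain ⟨g, hg, hyg⟩ := hU.exists_basicOpen_le ⟨y, hyW⟩ hy
  have hm' := res_mem_span (hW.trans le_rfl) hg hm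
  obtain ⟨c, hc, e⟩ := mem_map_of_smul_oneSec_mem_span _ hm'
  rw [res_res, res_smul_oneSec] at e
  have e' := hj.smul_oneSec_injective hZ e
  have hloc := hU.isLocalization_basicOpen g
  rw [← e'] at hc
  obtain ⟨_, ⟨k, rfl⟩, hk⟩ :=
    (IsLocalization.algebraMap_mem_map_algebraMap_iff (.powers g) _ I r).1 hc
  rw [Opens.mem_iSup]
  refine ⟨⟨g ^ k, Submodule.mem_colon_singleton.2 hk⟩, ?_⟩
  by_cases h0 : 0 < k
  · rw [Scheme.basicOpen_pow _ _ h0]; exact hyg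
  · have : g ^ k = 1 := by rw [Nat.eq_zero_of_not_pos h0, pow_zero]
    simp only [this, Scheme.basicOpen_one]
    exact hy

/-- The ideal of functions lying in a given subsheaf of `j_* 𝒪_X`. -/
noncomputable def functionIdeal (S : Subsheaf (push j (strSheaf X))) (U : Y.Opens) :
    Ideal Γ(Y, U) :=
  (S.carrier U).comap (LinearMap.toSpanSingleton _ _ (oneSec j U))

theorem mem_functionIdeal {S : Subsheaf (push j (strSheaf X))} {U : Y.Opens} {r : Γ(Y, U)} :
    r ∈ functionIdeal S U ↔ r • oneSec j U ∈ S.carrier U := Iff.rfl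

theorem IsComplement.functionIdeal_eq (hj : IsComplement Z j)
    (hZ : ∀ D ∈ Z, IsEffectiveCartier D) {S : Subsheaf (push j (strSheaf X))} {U : Y.Opens}
    (hU : IsAffineOpen U) {I : Ideal Γ(Y, U)} (h : IsIdealOn S U I) : functionIdeal S U = I :=
  le_antisymm (fun _ hr => hj.mem_of_isIdealOn hZ hU h hr) fun _ hr => h.subset _ ⟨_, hr, rfl⟩

/-- On a small affine open `S` is an honest ideal, and the claim describes membership in its
localisation. Finitely many such opens cover `U`, and the largest exponent serves for all. This
supplies the quasi-coherence in `IsComplement.exists_idealSheafData`. -/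
theorem IsComplement.exists_pow_mul_mem_functionIdeal (hj : IsComplement Z j)
    (hZ : ∀ D ∈ Z, IsEffectiveCartier D) {S : Frac j (strSheaf X)} (hS : S ≤ 1)
    {U : Y.Opens} (hU : IsAffineOpen U) (f r : Γ(Y, U))
    (hr : resFun (Y.basicOpen_le f) r ∈ functionIdeal S.1 (Y.basicOpen f)) :
    ∃ k : ℕ, f ^ k * r ∈ functionIdeal S.1 U := by
  have key : ∀ y ∈ U, ∃ (G : Y.Opens) (h : G ≤ U) (k : ℕ), y ∈ G ∧
      resFun h (f ^ k * r) ∈ functionIdeal S.1 G := by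
    intro y hy
    obtain ⟨V, hyV, I, -, hI⟩ := exists_isIdealOn hS y
    obtain ⟨G, hyG, hG⟩ := exists_affineOpens_le (U := V.1 ⊓ U) (y := y) ⟨hyV, hy⟩
    have hGU := hG.trans inf_le_right
    have hJ := hI.res (hG.trans inf_le_left)
    have hGaff : IsAffineOpen G.1 := G.2
    have hloc := hGaff.isLocalization_basicOpen (resFun hGU f)
    have hle : Y.basicOpen (resFun hGU f) ≤ Y.basicOpen f := by
      have : Y.basicOpen (resFun hGU f) = _ := Y.basicOpen_res f (homOfLE hGU).op
      rw [this]; exact inf_le_right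
    have h1 : resFun (Y.basicOpen_le _) (resFun hGU r) ∈
        functionIdeal S.1 (Y.basicOpen (resFun hGU f)) := by
      rw [mem_functionIdeal, resFun_resFun, ← resFun_resFun (Y.basicOpen_le f) hle,
        ← res_smul_oneSec]
      exact S.1.res_mem _ hr
    rw [hj.functionIdeal_eq hZ (hGaff.basicOpen _) (hJ.res (Y.basicOpen_le _))] at h1
    obtain ⟨_, ⟨k, rfl⟩, hk⟩ := (IsLocalization.algebraMap_mem_map_algebraMap_iff
      (.powers (resFun hGU f)) _ _ (resFun hGU r)).1 h1
    refine ⟨G.1, hGU, k, hyG, ?_⟩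
    rw [hj.functionIdeal_eq hZ hGaff hJ, map_mul, map_pow]
    exact hk
  choose! G hG k hyG hk using key
  obtain ⟨t, ht⟩ := hU.isCompact.elim_finite_subcover (fun x : U => (G x : Set Y))
    (fun x => (G x).2) fun x hx => Set.mem_iUnion.2 ⟨⟨x, hx⟩, hyG x hx⟩
  refine ⟨t.sup fun x => k x, mem_functionIdeal.2 (S.1.glue _ fun x hx => ?_)⟩
  obtain ⟨y, hyt, hxy⟩ := Set.mem_iUnion₂.1 (ht hx)
  refine ⟨G y, hG y y.2, hxy, ?_⟩
  obtain ⟨c, hc⟩ := Nat.exists_eq_add_of_le (Finset.le_sup (f := fun x : U => k x) hyt)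
  have h1 := Ideal.mul_mem_left _ (resFun (hG y y.2) (f ^ c)) (hk y y.2)
  rw [res_smul_oneSec, ← mem_functionIdeal, hc, add_comm, pow_add, mul_assoc, map_mul]
  exact h1

/-- A fractional ideal contained in the structure sheaf comes from a finite type ideal sheaf. -/
theorem IsComplement.exists_idealSheafData (hj : IsComplement Z j)
    (hZ : ∀ D ∈ Z, IsEffectiveCartier D) {S : Frac j (strSheaf X)} (hS : S ≤ 1) :
    ∃ T : Y.IdealSheafData, (∀ U : Y.affineOpens, (T.ideal U).FG) ∧
      ∀ (U : Y.affineOpens) (r : Γ(Y, U)), r ∈ T.ideal U ↔ r • oneSec j U.1 ∈ S.1.carrier U.1 := by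
  let T : Y.IdealSheafData :=
    { ideal := fun U => functionIdeal S.1 U.1
      map_ideal_basicOpen := by
        intro U f
        refine le_antisymm (Ideal.map_le_iff_le_comap.2 fun r hr => ?_) fun r hr => ?_
        · have h := S.1.res_mem (Y.basicOpen_le f) (mem_functionIdeal.1 hr)
          rw [res_smul_oneSec] at h
          exact h
        · have hUa : IsAffineOpen U.1 := U.2
          have hloc := hUa.isLocalization_basicOpen f
          -- Up to a power of `f`, which is invertible here, `r` extends to a function `r'` on `U`;
          -- a further power of `f` brings `r'` into the ideal over `U`.
          obtain ⟨k, r', hr'⟩ := IsLocalization.Away.surj f r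
          have e : resFun (Y.basicOpen_le f) r' = resFun (Y.basicOpen_le f) f ^ k * r := by
            rw [mul_comm, ← map_pow]
            exact hr'.symm.trans (by rw [map_pow]; rfl)
          obtain ⟨l, hl⟩ := hj.exists_pow_mul_mem_functionIdeal hZ hS hUa f r' (by
            rw [e]; exact Ideal.mul_mem_left _ _ hr)
          have hu : IsUnit (resFun (Y.basicOpen_le f) f) :=
            Y.toRingedSpace.isUnit_res_basicOpen f
          have h2 := Ideal.mem_map_of_mem (resFun (Y.basicOpen_le f)) hl
          rw [map_mul, map_pow, e, ← mul_assoc, ← pow_add] at h2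
          exact (Ideal.unit_mul_mem_iff_mem _ (hu.pow _)).1 h2 }
  refine ⟨T, ideal_fg_of_local T fun y => ?_, fun U r => Iff.rfl⟩
  obtain ⟨U, hyU, I, hI, h⟩ := exists_isIdealOn hS y
  refine ⟨U, hyU, ?_⟩
  have : T.ideal U = I := hj.functionIdeal_eq hZ (isAffineOpen_coe U) h
  rw [this]
  exact hI

end IdealOfFrac

/-! ### From bounded factors to blow-ups. -/

section BlowUpOfBounded

variable {X Y : Scheme.{u}} {j : X ⟶ Y} {M : X.Modules} {Z : Set Y.IdealSheafData}

/-- Some section of an invertible fractional ideal does not vanish at a given point. -/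
theorem exists_mem_basicOpen_of_unit (c : (Frac j (strSheaf X))ˣ) (x : X) :
    ∃ (W : Y.Opens) (s : Γ(X, j ⁻¹ᵁ W)), j x ∈ W ∧
      (s : Γ(push j (strSheaf X), W)) ∈ c.1.1.carrier W ∧ x ∈ X.basicOpen s := by
  -- If all sections of `c` vanished at `x`, so would all sections of `c * c⁻¹ = 1` near `j x`,
  -- including the function `1`.
  by_contra! hall
  have h1 : oneSec j ⊤ ∈ (prod c.1.1 (c⁻¹).1.1).carrier ⊤ := by
    have e : prod c.1.1 (c⁻¹).1.1 = (1 : Frac j (strSheaf X)).1 :=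
      congrArg Subtype.val (c.mul_inv)
    rw [e]
    exact Subsheaf.subset_span rfl
  obtain ⟨V, hV, hxV, hmem⟩ := h1 (j x) trivial
  rw [res_oneSec] at hmem
  let ev := X.evaluation (j ⁻¹ᵁ V) x hxV
  have hev : ∀ m ∈ Subsheaf.preSpan (fun U => {m | ∃ s ∈ c.1.1.carrier U,
      ∃ n ∈ (c⁻¹).1.1.carrier U, m = act j (strSheaf X) s n}) V,
      ev.hom (m : Γ(X, j ⁻¹ᵁ V)) = 0 := by
    intro m hm
    induction hm using Submodule.span_induction with
    | mem m hm =>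
      obtain ⟨W, k, _, ⟨s, hs, n, hn, rfl⟩, rfl⟩ := hm
      rw [res_act]
      have h2 := hall V (res k s) hxV (c.1.1.res_mem k hs)
      have h3 := (X.evaluation_eq_zero_iff_notMem_basicOpen x hxV _).2 h2
      refine (map_mul ev.hom _ _).trans ?_
      rw [show ev.hom (res k s : Γ(X, j ⁻¹ᵁ V)) = 0 from h3, zero_mul]
    | zero => exact map_zero ev.hom
    | add a b _ _ ha hb => exact (map_add ev.hom _ _).trans (by rw [ha, hb, add_zero])
    | smul r a _ ha =>
      rw [push_smul]
      exact (map_mul ev.hom _ _).trans (by rw [ha, mul_zero])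
  exact one_ne_zero ((map_one ev.hom).symm.trans (hev _ hmem))

/-- A section of the unit `c` that does not vanish at `x` is a section of `S ≤ 1`, so near `j x` it
is given by a function in `T` that does not vanish there. -/
theorem notMem_support_of_unit_le {S : Frac j (strSheaf X)} (hS : S ≤ 1)
    (c : (Frac j (strSheaf X))ˣ) (hc : (c : Frac j (strSheaf X)) ≤ S) {T : Y.IdealSheafData}
    (hT : ∀ (U : Y.affineOpens) (r : Γ(Y, U)),
      r ∈ T.ideal U ↔ r • oneSec j U.1 ∈ S.1.carrier U.1) (x : X) : j x ∉ T.support := by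
  obtain ⟨W, s, hxW, hs, hx⟩ := exists_mem_basicOpen_of_unit c x
  let σ : Γ(push j (strSheaf X), W) := s
  have hs' : σ ∈ S.1.carrier W := hc W hs
  obtain ⟨V, hVW, hxV, r, hr⟩ := exists_eq_smul_oneSec hS hxW hs'
  obtain ⟨U, hxU, hU⟩ := exists_affineOpens_le hxV
  rw [notMem_support_iff T hxU]
  have e : res (hU.trans hVW) σ = resFun hU r • oneSec j U.1 := by
    rw [← res_res hVW hU, hr, res_smul_oneSec]
  refine ⟨resFun hU r, (hT U _).2 ?_, ?_⟩
  · rw [← e]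
    exact S.1.res_mem _ hs'
  · have hxU' : x ∈ j ⁻¹ᵁ U.1 := hxU
    rw [← mem_basicOpen_pull j (le_refl (j ⁻¹ᵁ U.1)) hxU']
    rw [smul_oneSec_eq] at e
    have hle : j ⁻¹ᵁ U.1 ≤ j ⁻¹ᵁ W := fun y hy => hVW (hU hy)
    have e' : resFun hle s = pull j (le_refl (j ⁻¹ᵁ U.1)) (resFun hU r) := e
    rw [← e']
    have e2 : X.basicOpen (resFun hle s) = _ := X.basicOpen_res s (homOfLE hle).op
    rw [e2]
    exact ⟨hxU', hx⟩

/-- The spectrum of the residue field at `y` misses `Z`, so it lifts to `X`. -/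
theorem IsComplement.exists_eq_of_forall_notMem (hj : IsComplement Z j) {y : Y}
    (hy : ∀ D ∈ Z, y ∉ D.support) : ∃ x, j x = y := by
  obtain ⟨h, hh, -⟩ := hj.lift _ (Y.fromSpecResidueField y) fun w D hD => by
    rw [Y.fromSpecResidueField_apply]; exact hy D hD
  obtain ⟨z⟩ : Nonempty (Spec (Y.residueField y)) := inferInstance
  refine ⟨h z, ?_⟩
  rw [← Scheme.Hom.comp_apply, hh]
  exact Y.fromSpecResidueField_apply y z

theorem isInv_of_forall_notMem {T : Y.IdealSheafData} (h : ∀ x : X, j x ∉ T.support) :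
    IsInv T j := by
  intro x
  obtain ⟨U, hxU, -⟩ := exists_affineOpens_le (U := (⊤ : Y.Opens)) (y := j x) trivial
  obtain ⟨a, ha, hxa⟩ := (notMem_support_iff T hxU).1 (h x)
  have hxU' : x ∈ j ⁻¹ᵁ U.1 := hxU
  let N := X.basicOpen (pull j (le_refl (j ⁻¹ᵁ U.1)) a)
  have hN : N ≤ j ⁻¹ᵁ U.1 := X.basicOpen_le _
  refine ⟨U, a, N, (mem_basicOpen_pull j _ hxU' a).2 hxa, genOver_of_isUnit ha hN ?_⟩
  rw [← resFun_pull j le_rfl hN]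
  exact X.toRingedSpace.isUnit_res_basicOpen _

variable {Y' : Scheme.{u}} {f : Y' ⟶ Y} {j' : X ⟶ Y'}

/-- At each point of `X` some section of `T` is non-zero, and `t` divides it. -/
theorem GenOver.isUnit_pull (hj' : j' ≫ f = j) {T : Y.IdealSheafData}
    (h : ∀ x : X, j x ∉ T.support) {U : Y.affineOpens} {t : Γ(Y, U)} {N : Y'.Opens}
    (hN : GenOver T f U t N) : IsUnit (pull j' (le_refl (j' ⁻¹ᵁ N)) (pull f hN.le t)) := by
  refine isUnit_of_forall_mem_basicOpen _ fun x hx => ?_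
  have hx' : j' x ∈ N := hx
  have hjx : f (j' x) = j x := by rw [← hj', Scheme.Hom.comp_apply]
  have hxU : j x ∈ U.1 := hjx ▸ hN.le hx'
  obtain ⟨a, ha, hxa⟩ := (notMem_support_iff T hxU).1 (h x)
  obtain ⟨q, hq⟩ := hN.dvd a ha
  rw [mem_basicOpen_pull j' _ hx]
  have h1 : j' x ∈ Y'.basicOpen (pull f hN.le a) := by
    rw [mem_basicOpen_pull f _ hx', hjx]; exact hxa
  rw [hq, Scheme.basicOpen_mul] at h1
  exact h1.1

theorem push_smul_left_cancel {N : Y'.Opens} {a : Γ(Y', N)}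
    (ha : IsUnit (pull j' (le_refl (j' ⁻¹ᵁ N)) a)) {m m' : Γ(push j' M, N)}
    (h : a • m = a • m') : m = m' := by
  rw [push_smul, push_smul] at h
  exact (IsUnit.smul_left_cancel (β := Γ(M, j' ⁻¹ᵁ N)) ha).1 h

theorem inverseImage_mono (hj' : j' ≫ f = j) {N N' : Subsheaf (push j M)} (h : N ≤ N') :
    inverseImage f j' hj' N ≤ inverseImage f j' hj' N' := by
  refine Subsheaf.span_le.2 ?_
  rintro V _ ⟨U, hU, n, hn, rfl⟩
  exact pullSec_mem_inverseImage f j' hj' hU (h U hn)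

/-- Let `t` generate the inverse image of `T` near `y`. Then `t • n` lies in `S • N`, so near `f y`
it is a combination of products `a • b` with `a ∈ T` and `b` in `N`. Upstairs every such `a` is a
multiple of `t`, whence `t • n = t • m` with `m` in the inverse image of `N`. As `t` is a unit on
`X`, it cancels. -/
theorem pullSec_mem_inverseImage_of_smul_le (hj' : j' ≫ f = j) {T : Y.IdealSheafData}
    (hf : IsInv T f) (hTj : ∀ x : X, j x ∉ T.support) {S : Frac j (strSheaf X)} (hS : S ≤ 1)
    (hT : ∀ (U : Y.affineOpens) (r : Γ(Y, U)),
      r ∈ T.ideal U ↔ r • oneSec j U.1 ∈ S.1.carrier U.1)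
    {N N' : Frac j M} (hle : S • N' ≤ S • N) :
    inverseImage f j' hj' N'.1 ≤ inverseImage f j' hj' N.1 := by
  refine Subsheaf.span_le.2 ?_
  rintro V _ ⟨U, hU, n, hn, rfl⟩
  change pullSec f j' hj' hU n ∈ _
  refine Subsheaf.glue _ _ fun y hy => ?_
  obtain ⟨U₁, hyU₁, I, -, hI⟩ := exists_isIdealOn hS (f y)
  obtain ⟨U₂, hyU₂, F, -, hF⟩ := N.2.exists_generatedOn (f y)
  obtain ⟨U₃, hyU₃, hU₃⟩ := exists_affineOpens_le (U := U₁.1 ⊓ U₂ ⊓ U) (y := f y)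
    ⟨⟨hyU₁, hyU₂⟩, hU hy⟩
  have hI₃ := hI.res ((hU₃.trans inf_le_left).trans inf_le_left)
  have hF₃ := hF.res ((hU₃.trans inf_le_left).trans inf_le_right)
  have hU₃U : U₃.1 ≤ U := hU₃.trans inf_le_right
  obtain ⟨t, N₁, hyN₁, hN₁⟩ := hf.exists_genOver U₃ y hyU₃
  have htn : t • res hU₃U n ∈ (S • N).1.carrier U₃.1 := by
    refine hle U₃.1 ?_
    rw [← act_smul_oneSec]
    exact act_mem_prod ((hT U₃ t).1 hN₁.mem) (N'.1.res_mem _ hn)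
  obtain ⟨W, hW, hyW, hm⟩ := (GeneratedOn.prod hI₃ hF₃).exists_mem_span le_rfl htn hyU₃
  have hN₂W : N₁ ⊓ V ⊓ f ⁻¹ᵁ W ≤ f ⁻¹ᵁ W := inf_le_right
  have hN₂ := hN₁.mono (inf_le_left.trans inf_le_left : N₁ ⊓ V ⊓ f ⁻¹ᵁ W ≤ N₁)
  have h1 := pullSec_mem_span f j' hj' (hW.trans le_rfl) hN₂W hm
  rw [pullSec_res] at h1
  have h0 : pullSec f j' hj' hN₂.le (t • res hU₃U n) =
      pull f hN₂.le t • pullSec f j' hj' (fun _ hx => hU₃U (hN₂.le hx)) n := by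
    rw [pullSec_smul, pullSec_res]
  have h2 : ∀ z ∈ Submodule.span Γ(Y', N₁ ⊓ V ⊓ f ⁻¹ᵁ W) (pullSec f j' hj' hN₂.le ''
      (Set.image2 (fun s n => act j M s n)
        {m | ∃ a ∈ I.map (resFun ((hU₃.trans inf_le_left).trans inf_le_left)),
          m = a • oneSec j U₃.1} (res ((hU₃.trans inf_le_left).trans inf_le_right) '' F))),
      ∃ m ∈ (inverseImage f j' hj' N.1).carrier (N₁ ⊓ V ⊓ f ⁻¹ᵁ W),
        z = pull f hN₂.le t • m := by
    intro z hz
    induction hz using Submodule.span_induction with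
    | mem z hz =>
      obtain ⟨_, ⟨_, ⟨a, ha, rfl⟩, b, hb, rfl⟩, rfl⟩ := hz
      have haT : a ∈ T.ideal U₃ := (hT U₃ a).2 (hI₃.subset _ ⟨a, ha, rfl⟩)
      obtain ⟨q, hq⟩ := hN₂.dvd a haT
      refine ⟨q • pullSec f j' hj' hN₂.le b, Submodule.smul_mem _ _
        (pullSec_mem_inverseImage f j' hj' _ (hF₃.subset b hb)), ?_⟩
      dsimp only
      rw [act_smul_oneSec, pullSec_smul, hq, mul_smul]
    | zero => exact ⟨0, zero_mem _, (smul_zero _).symm⟩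
    | add x y _ _ hx hy =>
      obtain ⟨m, hm, rfl⟩ := hx
      obtain ⟨m', hm', rfl⟩ := hy
      exact ⟨m + m', add_mem hm hm', (smul_add _ _ _).symm⟩
    | smul r x _ hx =>
      obtain ⟨m, hm, rfl⟩ := hx
      exact ⟨r • m, Submodule.smul_mem _ _ hm, smul_comm _ _ _⟩
  obtain ⟨m, hm, e⟩ := h2 _ h1
  replace e := h0.symm.trans e
  refine ⟨N₁ ⊓ V ⊓ f ⁻¹ᵁ W, inf_le_left.trans inf_le_right, ⟨⟨hyN₁, hy⟩, hyW⟩, ?_⟩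
  rw [res_pullSec]
  have := push_smul_left_cancel (hN₂.isUnit_pull hj' hTj) e
  rw [← this] at hm
  exact hm

theorem smul_mono_frac (s : Frac j (strSheaf X)) {N N' : Frac j M} (h : N ≤ N') :
    s • N ≤ s • N' := prod_mono le_rfl h

theorem mul_mono_frac (s : Frac j (strSheaf X)) {a b : Frac j (strSheaf X)} (h : a ≤ b) :
    s * a ≤ s * b := prod_mono le_rfl h

/-- Division by the upper bound `b` turns `s` into a fractional ideal inside `1`, hence into a
finite type ideal sheaf `T` to blow up. The lower bound makes `T` trivial on `X`, which both lifts
`j` to the blow-up and bounds the cosupport. -/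
theorem IsComplement.isIntegralExt_of_bounded (hj : IsComplement Z j)
    (hZ : ∀ D ∈ Z, IsEffectiveCartier D) {N N' : Frac j M} (hN : N ≤ N')
    {s : Frac j (strSheaf X)} (hs : IsBoundedElement s) (hle : s • N' ≤ s • N) :
    IsIntegralExt Z N N' := by
  obtain ⟨a, b, has, hsb⟩ := hs
  let S : Frac j (strSheaf X) := (b⁻¹ : (Frac j (strSheaf X))ˣ) * s
  have hS : S ≤ 1 := by
    have := mul_mono_frac ((b⁻¹ : (Frac j (strSheaf X))ˣ) : Frac j (strSheaf X)) hsb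
    rwa [Units.inv_mul] at this
  have hc : ((b⁻¹ * a : (Frac j (strSheaf X))ˣ) : Frac j (strSheaf X)) ≤ S := by
    rw [Units.val_mul]
    exact mul_mono_frac _ has
  have hle' : S • N' ≤ S • N := by
    change (_ * s) • N' ≤ (_ * s) • N
    rw [mul_smul, mul_smul]
    exact smul_mono_frac _ hle
  obtain ⟨T, hfg, hT⟩ := hj.exists_idealSheafData hZ hS
  have hTj := notMem_support_of_unit_le hS _ hc hT
  obtain ⟨j', hj', -⟩ := (isBlowUp_blowUpMap T).lift X j
    (isEffectiveCartier_comap_iff.2 (isInv_of_forall_notMem hTj))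
  refine ⟨hN, T, hfg, fun y hy => ?_, blowUp T, blowUpMap T, j', hj', isBlowUp_blowUpMap T,
    le_antisymm (inverseImage_mono hj' hN)
      (pullSec_mem_inverseImage_of_smul_le hj' (isInv_blowUpMap T) hTj hS hT hle')⟩
  -- A point outside `Z` is in the image of `j`, where `T` is trivial.
  by_contra! hne
  obtain ⟨x, rfl⟩ := hj.exists_eq_of_forall_notMem hne
  exact hTj x hy

end BlowUpOfBounded

/-! ### Finite type subsheaves and directed unions. -/

section DirectedUnion

variable {Y : Scheme.{u}} {G : Y.Modules}

theorem exists_mem_forall_le_of_finite {β ι : Type*} [Preorder β] {S : Set β} (hne : S.Nonempty)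
    (hS : DirectedOn (· ≤ ·) S) {F : Set ι} (hF : F.Finite) (g : ι → β) (hg : ∀ i ∈ F, g i ∈ S) :
    ∃ P ∈ S, ∀ i ∈ F, g i ≤ P := by
  induction F, hF using Set.Finite.induction_on with
  | empty =>
    obtain ⟨P, hP⟩ := hne
    exact ⟨P, hP, fun _ h => h.elim⟩
  | @insert a s _ _ ih =>
    obtain ⟨P, hP, hle⟩ := ih fun i hi => hg i (Set.mem_insert_of_mem _ hi)
    obtain ⟨Q, hQ, hPQ, haQ⟩ := hS P hP (g a) (hg a (Set.mem_insert _ _))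
    refine ⟨Q, hQ, ?_⟩
    rintro i (rfl | hi)
    exacts [haQ, (hle i hi).trans hPQ]

theorem exists_mem_carrier_of_mem_preSpan {S : Set (Subsheaf G)} (hne : S.Nonempty)
    (hS : DirectedOn (· ≤ ·) S) {V : Y.Opens} {m : Γ(G, V)}
    (hm : m ∈ Subsheaf.preSpan (fun U => {m | ∃ N ∈ S, m ∈ N.carrier U}) V) :
    ∃ P ∈ S, m ∈ P.carrier V := by
  unfold Subsheaf.preSpan at hm
  induction hm using Submodule.span_induction with
  | mem x hx =>
    obtain ⟨W, k, b, ⟨P, hP, hb⟩, rfl⟩ := hx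
    exact ⟨P, hP, P.res_mem k hb⟩
  | zero =>
    obtain ⟨P, hP⟩ := hne
    exact ⟨P, hP, zero_mem _⟩
  | add x y _ _ hx hy =>
    obtain ⟨P, hP, hx⟩ := hx
    obtain ⟨Q, hQ, hy⟩ := hy
    obtain ⟨R, hR, hPR, hQR⟩ := hS P hP Q hQ
    exact ⟨R, hR, add_mem (hPR V hx) (hQR V hy)⟩
  | smul a x _ hx =>
    obtain ⟨P, hP, hx⟩ := hx
    exact ⟨P, hP, Submodule.smul_mem _ _ hx⟩

/-- Locally finite type subsheaves on a quasi-compact scheme are compact elements for directed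
unions. -/
theorem Subsheaf.IsFiniteType.exists_le_of_le_sup [CompactSpace Y] {N : Subsheaf G}
    (hN : N.IsFiniteType) {S : Set (Subsheaf G)} (hne : S.Nonempty)
    (hS : DirectedOn (· ≤ ·) S) (h : N ≤ Subsheaf.sup S) : ∃ P ∈ S, N ≤ P := by
  have hloc : ∀ y : Y, ∃ U : Y.Opens, y ∈ U ∧ ∃ P ∈ S, ∀ V ≤ U, N.carrier V ≤ P.carrier V := by
    intro y
    obtain ⟨U, hy, F, hF, hNF⟩ := hN.exists_generatedOn y
    have hb : ∀ b ∈ F, ∃ V : Y.Opens, ∃ hV : V ≤ U, y ∈ V ∧ ∃ P ∈ S, res hV b ∈ P.carrier V := by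
      intro b hb
      obtain ⟨V, hV, hyV, hbV⟩ := h U (hNF.subset b hb) y hy
      exact ⟨V, hV, hyV, exists_mem_carrier_of_mem_preSpan hne hS hbV⟩
    choose! V hV hyV P hP hbP using hb
    -- Directedness is used twice: here for the finitely many generators near `y`, and below for a
    -- finite subcover of `Y`.
    obtain ⟨Q, hQ, hPQ⟩ := exists_mem_forall_le_of_finite hne hS hF P hP
    obtain ⟨W, hWU, hyW, hW⟩ := exists_open_of_finite hF hy (fun b W => W ≤ V b)
      (fun _ _ _ h k => h.trans k) fun b hb => ⟨V b, hV b hb, hyV b hb, le_rfl⟩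
    refine ⟨W, hyW, Q, hQ, fun A hA => (hNF.res hWU).carrier_le ?_ hA⟩
    rintro _ ⟨b, hb, rfl⟩
    rw [← res_res (hV b hb) (hW b hb)]
    exact Q.res_mem _ (hPQ b hb _ (hbP b hb))
  choose U hU P hP hle using hloc
  obtain ⟨t, ht⟩ := isCompact_univ.elim_finite_subcover (fun y => (U y : Set Y))
    (fun y => (U y).2) fun y _ => Set.mem_iUnion.2 ⟨y, hU y⟩
  obtain ⟨Q, hQ, hPQ⟩ := exists_mem_forall_le_of_finite hne hS t.finite_toSet P fun y _ => hP y
  refine ⟨Q, hQ, Subsheaf.le_of_locally fun y => ?_⟩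
  obtain ⟨y', hy't, hy'⟩ := Set.mem_iUnion₂.1 (ht (Set.mem_univ y))
  exact ⟨U y', hy', fun V hV => (hle y' V hV).trans (hPQ y' hy't V)⟩

end DirectedUnion

/-! ### Comparison of integral closures. -/

section Closure

variable {X Y : Scheme.{u}} {j : X ⟶ Y} {M : X.Modules} {Z : Set Y.IdealSheafData}

theorem Frac.add_le {N P Q : Frac j M} : N + P ≤ Q ↔ N ≤ Q ∧ P ≤ Q :=
  Subsheaf.add_le (N := N.1) (P := P.1) (Q := Q.1)

theorem Frac.joinLE_iff {N P : Frac j M} : JoinLE N P ↔ N ≤ P :=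
  ⟨fun h => (Frac.add_le.1 (le_of_eq h)).1, fun h =>
    le_antisymm (Frac.add_le.2 ⟨h, le_rfl⟩) (Frac.add_le.1 le_rfl).2⟩

theorem Frac.le_smul_of_mul {s t : Frac j (strSheaf X)} {N P : Frac j M} (h : s • N ≤ s • P) :
    (t * s) • N ≤ (t * s) • P := by
  rw [mul_smul, mul_smul]
  exact smul_mono_frac t h

theorem Frac.smul_add_le {s t : Frac j (strSheaf X)} {N N' P : Frac j M} (h : s • N ≤ s • P)
    (h' : t • N' ≤ t • P) : (s * t) • (N + N') ≤ (s * t) • P := by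
  rw [smul_add]
  refine Frac.add_le.2 ⟨?_, Frac.le_smul_of_mul h'⟩
  rw [mul_comm]
  exact Frac.le_smul_of_mul h

theorem IsComplement.isIntegralExt_refl (hj : IsComplement Z j)
    (hZ : ∀ D ∈ Z, IsEffectiveCartier D) (N : Frac j M) : IsIntegralExt Z N N :=
  hj.isIntegralExt_of_bounded hZ le_rfl .one le_rfl

theorem IsIntegralExt.le_closure {N P : Frac j M} (h : IsIntegralExt Z N P) :
    P.1 ≤ closure Z N :=
  fun _ _ hm => Subsheaf.subset_span ⟨P.1, ⟨P, h, rfl⟩, hm⟩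

theorem closure_le {N : Frac j M} {Q : Subsheaf (push j M)} :
    closure Z N ≤ Q ↔ ∀ P : Frac j M, IsIntegralExt Z N P → P.1 ≤ Q := by
  refine ⟨fun h P hP => hP.le_closure.trans h, fun h => Subsheaf.span_le.2 ?_⟩
  rintro U b ⟨_, ⟨P, hP, rfl⟩, hb⟩
  exact h P hP U hb

/-- Passing through bounded factors, two extensions are combined by multiplying the factors, and no
comparison of two blow-ups is needed. It makes the union that defines the closure directed. -/
theorem IsComplement.isIntegralExt_add [CompactSpace Y] [M.IsQuasicoherent]
    (hj : IsComplement Z j) (hZ : ∀ D ∈ Z, IsEffectiveCartier D) {N P P' : Frac j M}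
    (h : IsIntegralExt Z N P) (h' : IsIntegralExt Z N P') : IsIntegralExt Z N (P + P') := by
  obtain ⟨s, hs, hle⟩ := hj.exists_bounded_of_isIntegralExt hZ h
  obtain ⟨t, ht, hle'⟩ := hj.exists_bounded_of_isIntegralExt hZ h'
  exact hj.isIntegralExt_of_bounded hZ (h.1.trans (Frac.add_le.1 le_rfl).1) (hs.mul ht)
    (Frac.smul_add_le hle hle')

/-- Integral closures are compared by clearing bounded denominators. -/
theorem IsComplement.closure_le_closure_iff [CompactSpace Y] [M.IsQuasicoherent]
    (hj : IsComplement Z j) (hZ : ∀ D ∈ Z, IsEffectiveCartier D) {N N' : Frac j M} :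
    closure Z N ≤ closure Z N' ↔
      ∃ s : Frac j (strSheaf X), IsBoundedElement s ∧ s • N ≤ s • N' := by
  constructor
  · intro h
    have hN : N.1 ≤ closure Z N' := (hj.isIntegralExt_refl hZ N).le_closure.trans h
    let S : Set (Subsheaf (push j M)) := {P | ∃ P' : Frac j M, IsIntegralExt Z N' P' ∧ P = P'.1}
    have hne : S.Nonempty := ⟨_, N', hj.isIntegralExt_refl hZ N', rfl⟩
    have hdir : DirectedOn (· ≤ ·) S := by
      rintro _ ⟨P, hP, rfl⟩ _ ⟨P', hP', rfl⟩
      exact ⟨(P + P').1, ⟨_, hj.isIntegralExt_add hZ hP hP', rfl⟩,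
        Subsheaf.le_add_left' P.1 P'.1, Subsheaf.le_add_right' P.1 P'.1⟩
    obtain ⟨_, ⟨P, hP, rfl⟩, hNP⟩ := N.2.exists_le_of_le_sup hne hdir hN
    obtain ⟨s, hs, hle⟩ := hj.exists_bounded_of_isIntegralExt hZ hP
    exact ⟨s, hs, (smul_mono_frac s hNP).trans hle⟩
  · rintro ⟨s, hs, hle⟩
    refine closure_le.2 fun P hP => ?_
    obtain ⟨t, ht, hle'⟩ := hj.exists_bounded_of_isIntegralExt hZ hP
    have hPN : (s * t) • P ≤ (s * t) • N' := by
      refine (Frac.le_smul_of_mul hle').trans ?_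
      rw [mul_comm]
      exact Frac.le_smul_of_mul hle
    -- `P` extends `N` and need not contain `N'`, so `N'` is added to obtain an integral extension
    -- of `N'`.
    have hext : IsIntegralExt Z N' (P + N') := by
      refine hj.isIntegralExt_of_bounded hZ (Frac.add_le.1 le_rfl).2 (hs.mul ht) ?_
      rw [smul_add]
      exact Frac.add_le.2 ⟨hPN, le_rfl⟩
    exact (Subsheaf.le_add_left' P.1 N'.1).trans hext.le_closure

end Closure

end IntegralClosure

theorem mainTheorem4 {X Xplus : Scheme.{u}} [CompactSpace Xplus] [QuasiSeparatedSpace Xplus]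
    (Z : Set Xplus.IdealSheafData) (hZ : ∀ D ∈ Z, IntegralClosure.IsEffectiveCartier D)
    (j : X ⟶ Xplus) (hj : IntegralClosure.IsComplement Z j)
    (M : X.Modules) [M.IsQuasicoherent] :
    ∃ (_ : AddCommMonoid (IntegralClosure.ClosedFrac Z j M))
      (_ : Module (IntegralClosure.Frac j (IntegralClosure.strSheaf X))
        (IntegralClosure.ClosedFrac Z j M)),
      (∀ P Q : IntegralClosure.ClosedFrac Z j M, IsLUB {P, Q} (P + Q)) ∧
      ∃ φ : IntegralClosure.Frac j M
          →ₗ[IntegralClosure.Frac j (IntegralClosure.strSheaf X)]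
            IntegralClosure.ClosedFrac Z j M,
        (∀ N, φ N = IntegralClosure.toClosed Z j M N) ∧
        IntegralClosure.IsNormalisation.{w} φ := by
  refine IntegralClosure.exists_isNormalisation ?_ fun N N' => ?_
  · rintro ⟨_, N, rfl⟩
    exact ⟨N, rfl⟩
  · simp only [IntegralClosure.Frac.joinLE_iff]
    exact hj.closure_le_closure_iff hZ
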